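/- For a topological space $Y$ and $N\ge 1$ let $F_N(Y)$ be the space of $N$-tuples of pairwise distinct points of $Y$, on which $S_N$ acts by permuting entries. Let $B_N=\pi_1(F_N(\mathbb R^2)/S_N)$ be the Artin braid group and let $B_{n,n}=\pi_1(F_{2n}(\mathbb R^2)/(S_n\times S_n))$ be the mixed braid group of the plane, both based at the class of $((1,0),\dots,(N,0))$ (with $N=2n$ for $B_{n,n}$), where $S_n\times S_n\subset S_{2n}$ consists of the permutations preserving the set of the first $n$ indices. The projection $F_{2n}(\mathbb R^2)/(S_n\times S_n)\to F_{2n}(\mathbb R^2)/S_{2n}$ induces a homomorphism $\iota: B_{n,n}\to B_{2n}$. Let $\sigma_k\in B_{2n}$ ($1\le k\le 2n-1$) be the class of the loop in which the points number $k$ and $k+1$ make a counterclockwise half turn about $(k+\tfrac12,0)$ and all the others rest; for $k\ne n$ this loop is also a loop in $F_{2n}(\mathbb R^2)/(S_n\times S_n)$, and its class in $B_{n,n}$ is denoted by $\sigma_k$ too. For $1\le i<j\le 2n$ let $$A_{i,j}=\sigma_{j-1}\cdots\sigma_{i+1}\,\sigma_i^2\,\sigma_{i+1}^{-1}\cdots\sigma_{j-1}^{-1}\in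 B_{2n}.$$ (In a product $xy$ of elements of a fundamental group the loop $y$ is run through first.) **Proposition.** Let $n\ge 2$. Then $B_{n,n}$ admits the following presentation. Precisely, there is an isomorphism $\varphi$ from the group with these generators and relations onto $B_{n,n}$ that sends each generator $\sigma_k$ to the braid $\sigma_k\in B_{n,n}$, and each generator $A_{i,j}$ to an element with $\iota(\varphi(A_{i,j}))=A_{i,j}\in B_{2n}$. *Generators:* $\sigma_k$ for $1\le k\le 2n-1$, $k\ne n$, and $A_{i,j}$ for $1\le i<j\le 2n$. *Relations* (for all generators that occur in them): 1. Pure braid relations, for $1\le r<s\le 2n$ and $1\le i<j\le 2n$: $$A_{r,s}^{-1}A_{i,j}A_{r,s}=\begin{cases}A_{i,j}, & i<r<s<j\ \text{or}\ r<s<i<j;\\ A_{r,j}A_{i,j}A_{r,j}^{-1}, & r<i=s<j;\\ A_{r,j}A_{s,j}A_{i,j}A_{s,j}^{-1}A_{r,j}^{-1}, & i=r<s<j;\\ A_{r,j}A_{s,j}A_{r,j}^{-1}A_{s,j}^{-1}A_{i,j}A_{s,j}A_{r,j}A_{s,j}^{-1}A_{r,j}^{-1}, & r<i<s<j.\end{cases}$$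 2. Artin relations: $\sigma_i\sigma_{i+1}\sigma_i=\sigma_{i+1}\sigma_i\sigma_{i+1}$ for $1\le i\le n-2$ or $n+1\le i\le 2n-2$; and $\sigma_i\sigma_j=\sigma_j\sigma_i$ for $i,j\in\{1,\dots,2n-1\}\setminus\{n\}$ with $|i-j|\ge 2$. 3. $\sigma_i^2=A_{i,i+1}$ for $1\le i\le n-1$ or $n+1\le i\le 2n-1$. 4. Conjugates, for $1\le k\le 2n-1$, $k\ne n$, and $1\le i<j\le 2n$: $$\sigma_kA_{i,j}\sigma_k^{-1}=\begin{cases}A_{i,j}, & k\notin\{i-1,i,j-1,j\};\\ A_{i,j}, & k=i,\ j=k+1;\\ A_{i,k+1}, & k=j;\\ A_{i,k+1}^{-1}A_{i,k}A_{i,k+1}, & j=k+1,\ i<k;\\ A_{i+1,j}, & i=k<j-1;\\ A_{k+1,j}^{-1}A_{k,j}A_{k+1,j}, & i=k+1.\end{cases}$$ -/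

import Mathlib

/-! ## Configuration spaces and their orbit spaces -/

/-- The ordered configuration space `F_N(Y)`: `N`-tuples of pairwise distinct points of `Y`. -/
def OrdConf (N : ℕ) (Y : Type*) : Type _ :=
  {x : Fin N → Y // Function.Injective x}

instance (N : ℕ) (Y : Type*) [TopologicalSpace Y] : TopologicalSpace (OrdConf N Y) :=
  inferInstanceAs (TopologicalSpace {x : Fin N → Y // Function.Injective x})

/-- The symmetric group `S_N` acts on `F_N(Y)` by permuting the entries of the tuples. -/
instance (N : ℕ) (Y : Type*) : MulAction (Equiv.Perm (Fin N)) (OrdConf N Y) where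
  smul π x := ⟨fun i => x.1 (π⁻¹ i), x.2.comp (Equiv.injective π⁻¹)⟩
  one_smul _ := rfl
  mul_smul π ρ x := Subtype.ext (funext fun i => by
    change x.1 ((π * ρ)⁻¹ i) = x.1 (ρ⁻¹ (π⁻¹ i))
    rw [mul_inv_rev]; rfl)

/-- The orbit space `F_N(Y) / H` of a subgroup `H` of `S_N`, with the quotient topology. -/
abbrev OrbitConf {N : ℕ} (H : Subgroup (Equiv.Perm (Fin N))) (Y : Type*) : Type _ :=
  MulAction.orbitRel.Quotient H (OrdConf N Y)

/-- The projection `F_N(Y) → F_N(Y) / H`. -/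
def OrbitConf.mk {N : ℕ} (H : Subgroup (Equiv.Perm (Fin N))) {Y : Type*} (x : OrdConf N Y) :
    OrbitConf H Y :=
  Quotient.mk _ x

theorem OrbitConf.continuous_mk {N : ℕ} (H : Subgroup (Equiv.Perm (Fin N)))
    {Y : Type*} [TopologicalSpace Y] :
    Continuous (OrbitConf.mk H : OrdConf N Y → OrbitConf H Y) :=
  continuous_quotient_mk'

theorem OrbitConf.mk_smul {N : ℕ} (H : Subgroup (Equiv.Perm (Fin N)))
    {Y : Type*} {π : Equiv.Perm (Fin N)} (hπ : π ∈ H) (x : OrdConf N Y) :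
    OrbitConf.mk H (π • x) = OrbitConf.mk H x :=
  Quotient.sound ⟨⟨π, hπ⟩, rfl⟩

/-- The projection `F_N(Y) / H → F_N(Y) / S_N`. -/
def OrbitConf.toUnordered {N : ℕ} (H : Subgroup (Equiv.Perm (Fin N)))
    (Y : Type*) [TopologicalSpace Y] :
    C(OrbitConf H Y, OrbitConf (⊤ : Subgroup (Equiv.Perm (Fin N))) Y) where
  toFun := Quotient.lift (OrbitConf.mk ⊤) (by
    rintro _ b ⟨π, rfl⟩
    exact OrbitConf.mk_smul ⊤ (Subgroup.mem_top (π : Equiv.Perm (Fin N))) b)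
  continuous_toFun := (OrbitConf.continuous_mk ⊤).quotient_lift _

/-- `S_m × S_n` as the subgroup of `S_{m+n}` of the permutations that map the first `m` indices
to themselves (hence also the last `n`). -/
def youngSubgroup (m n : ℕ) : Subgroup (Equiv.Perm (Fin (m + n))) where
  carrier := {π | ∀ i, (π i : ℕ) < m ↔ (i : ℕ) < m}
  one_mem' _ := Iff.rfl
  mul_mem' {π ρ} hπ hρ i := (hπ (ρ i)).trans (hρ i)
  inv_mem' {π} hπ i := by
    have h := hπ (π⁻¹ i)
    rw [show π (π⁻¹ i) = i from π.apply_symm_apply i] at h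
    exact h.symm

/-! ## Braid groups of the plane

The plane is `ℝ × ℝ`.  The strings are numbered `1, …, N` and string `i` starts at `(i, 0)`;
the element `i : Fin N` is the string number `i + 1`. -/

/-- The base configuration `((1, 0), (2, 0), …, (N, 0))`. -/
def baseConf (N : ℕ) : OrdConf N (ℝ × ℝ) :=
  ⟨fun i => ((i : ℝ) + 1, 0), fun i j h => by
    have h1 : (i : ℝ) + 1 = (j : ℝ) + 1 := congrArg Prod.fst h
    exact Fin.ext (by exact_mod_cast add_right_cancel h1)⟩

/-- The group `π₁(F_N(ℝ²) / H)`. -/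
abbrev PlaneBraidGroup {N : ℕ} (H : Subgroup (Equiv.Perm (Fin N))) : Type :=
  FundamentalGroup (OrbitConf H (ℝ × ℝ)) (OrbitConf.mk H (baseConf N))

/-- The Artin braid group `B_N = π₁(D_N(ℝ²))`. -/
abbrev BraidGroup (N : ℕ) : Type :=
  PlaneBraidGroup (⊤ : Subgroup (Equiv.Perm (Fin N)))

/-- The mixed braid group `B_{m,n} = π₁(D_{m,n}(ℝ²))`, where `D_{m,n} = F_{m+n} / (S_m × S_n)`. -/
abbrev MixedBraidGroup (m n : ℕ) : Type :=
  PlaneBraidGroup (youngSubgroup m n)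

/-- The homomorphism `B_{m,n} → B_{m+n}` induced by the projection `D_{m,n} → D_{m+n}`; it
regards a mixed braid as a braid. -/
noncomputable def MixedBraidGroup.toBraid (m n : ℕ) : MixedBraidGroup m n →* BraidGroup (m + n) :=
  FundamentalGroup.map (OrbitConf.toUnordered (youngSubgroup m n) (ℝ × ℝ))
    (OrbitConf.mk (youngSubgroup m n) (baseConf (m + n)))

/-- The position at time `t` of string number `i` in the half twist `σ_k`: the strings `k` and
`k + 1` make half a turn about `(k + 1/2, 0)`, all others rest. -/
noncomputable def halfTwistPoint (k : ℕ) (t : ℝ) (i : ℕ) : ℝ × ℝ :=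
  if i = k then
    ((k : ℝ) + 1 / 2 - Real.cos (Real.pi * t) / 2, -(Real.sin (Real.pi * t) / 2))
  else if i = k + 1 then
    ((k : ℝ) + 1 / 2 + Real.cos (Real.pi * t) / 2, Real.sin (Real.pi * t) / 2)
  else ((i : ℝ), 0)

theorem halfTwistPoint_injective (k : ℕ) (t : ℝ) : Function.Injective (halfTwistPoint k t) := by
  have hc1 := Real.cos_le_one (Real.pi * t)
  have hc2 := Real.neg_one_le_cos (Real.pi * t)
  have hsc := Real.sin_sq_add_cos_sq (Real.pi * t)
  have far : ∀ i : ℕ, i ≠ k → i ≠ k + 1 → (i : ℝ) < k ∨ (k : ℝ) + 1 < i := by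
    intro i h1 h2
    rcases lt_or_ge i k with h | h
    · exact Or.inl (by exact_mod_cast h)
    · exact Or.inr (by exact_mod_cast (show k + 1 < i by omega))
  intro i j hij
  unfold halfTwistPoint at hij
  split_ifs at hij with h1 h2 h3 h4 h5 h6 h7 h8 <;>
    simp only [Prod.mk.injEq] at hij <;> try omega
  · nlinarith [hij.1, hij.2]
  · rcases far j h2 h3 with h | h <;> linarith [hij.1]
  · nlinarith [hij.1, hij.2]
  · rcases far j (by assumption) (by assumption) with h | h <;> linarith [hij.1]
  · rcases far i (by assumption) (by assumption) with h | h <;> linarith [hij.1]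
  · rcases far i (by assumption) (by assumption) with h | h <;> linarith [hij.1]
  · exact_mod_cast hij.1

/-- The configuration at time `t` of the half twist `σ_k` on `N` strings. -/
noncomputable def halfTwistConf (N k : ℕ) (t : ℝ) : OrdConf N (ℝ × ℝ) :=
  ⟨fun i => halfTwistPoint k t ((i : ℕ) + 1), fun i j h => by
    have h1 := halfTwistPoint_injective k t h
    exact Fin.ext (by omega)⟩

/-- The transposition of the strings number `k` and `k + 1`. -/
def adjSwap (N k : ℕ) (hk : 1 ≤ k ∧ k < N) : Equiv.Perm (Fin N) :=
  Equiv.swap ⟨k - 1, by omega⟩ ⟨k, hk.2⟩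

theorem halfTwistConf_zero (N k : ℕ) : halfTwistConf N k 0 = baseConf N := by
  refine Subtype.ext (funext fun i => ?_)
  change halfTwistPoint k 0 ((i : ℕ) + 1) = ((i : ℝ) + 1, 0)
  unfold halfTwistPoint
  split_ifs with h1 h2
  · have h : (k : ℝ) = (i : ℝ) + 1 := by exact_mod_cast h1.symm
    simp [h]
  · have h : (k : ℝ) = (i : ℝ) := by exact_mod_cast (Nat.succ_injective h2).symm
    simp [h]; ring
  · simp

theorem halfTwistConf_one (N k : ℕ) (hk : 1 ≤ k ∧ k < N) :
    halfTwistConf N k 1 = adjSwap N k hk • baseConf N := by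
  refine Subtype.ext (funext fun i => ?_)
  change halfTwistPoint k 1 ((i : ℕ) + 1) = ((((adjSwap N k hk)⁻¹ i : Fin N) : ℝ) + 1, 0)
  unfold halfTwistPoint adjSwap
  rw [Equiv.swap_inv]
  split_ifs with h1 h2
  · have h : i = ⟨k - 1, by omega⟩ := Fin.ext (by simp; omega)
    rw [h, Equiv.swap_apply_left]
    simp; ring
  · have h : i = ⟨k, hk.2⟩ := Fin.ext (by simp; omega)
    have h' : ((k - 1 : ℕ) : ℝ) = (k : ℝ) - 1 := by
      rw [Nat.cast_sub hk.1, Nat.cast_one]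
    rw [h, Equiv.swap_apply_right]
    simp [h']; ring
  · rw [Equiv.swap_apply_of_ne_of_ne]
    · simp
    · intro h; rw [h] at h1; simp at h1; omega
    · intro h; rw [h] at h2; simp at h2

theorem continuous_halfTwistConf (N k : ℕ) : Continuous (halfTwistConf N k) := by
  refine Continuous.subtype_mk (continuous_pi fun i => ?_) _
  unfold halfTwistPoint
  split_ifs <;> fun_prop

/-- The half twist `σ_k` as a loop in `F_N(ℝ²) / H`, for `H` containing the transposition of the
strings `k` and `k + 1`. -/
noncomputable def halfTwistLoop {N : ℕ} (H : Subgroup (Equiv.Perm (Fin N))) (k : ℕ)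
    (hk : 1 ≤ k ∧ k < N) (hH : adjSwap N k hk ∈ H) :
    Path (OrbitConf.mk H (baseConf N)) (OrbitConf.mk H (baseConf N)) where
  toFun t := OrbitConf.mk H (halfTwistConf N k (t : ℝ))
  continuous_toFun := (OrbitConf.continuous_mk H).comp
    ((continuous_halfTwistConf N k).comp continuous_subtype_val)
  source' := congrArg (OrbitConf.mk H) (halfTwistConf_zero N k)
  target' := (congrArg (OrbitConf.mk H) (halfTwistConf_one N k hk)).trans
    (OrbitConf.mk_smul H hH (baseConf N))

/-- The class of the half twist `σ_k` in `π₁(F_N(ℝ²) / H)`. -/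
noncomputable def halfTwist {N : ℕ} (H : Subgroup (Equiv.Perm (Fin N))) (k : ℕ)
    (hk : 1 ≤ k ∧ k < N) (hH : adjSwap N k hk ∈ H) : PlaneBraidGroup H :=
  FundamentalGroup.fromPath (Path.Homotopic.Quotient.mk (halfTwistLoop H k hk hH))

/-- The Artin generator `σ_k` of `B_N`, `1 ≤ k ≤ N - 1` (and `1` for the other, unused, `k`). -/
noncomputable def artinSigma (N k : ℕ) : BraidGroup N :=
  if hk : 1 ≤ k ∧ k < N then halfTwist ⊤ k hk (Subgroup.mem_top _) else 1

/-- The pure braid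
`A_{i,j} = σ_{j-1} ⋯ σ_{i+1} σ_i² σ_{i+1}⁻¹ ⋯ σ_{j-1}⁻¹` of `B_N`, `1 ≤ i < j ≤ N`. -/
noncomputable def pureA (N i j : ℕ) : BraidGroup N :=
  ((List.Ico (i + 1) j).reverse.map (artinSigma N)).prod * artinSigma N i ^ 2 *
    (((List.Ico (i + 1) j).reverse.map (artinSigma N)).prod)⁻¹

theorem adjSwap_mem_youngSubgroup (m n k : ℕ) (hk : 1 ≤ k ∧ k < m + n) (hm : k ≠ m) :
    adjSwap (m + n) k hk ∈ youngSubgroup m n := by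
  intro i
  unfold adjSwap
  rw [Equiv.swap_apply_def]
  split_ifs with h1 h2
  · rw [h1]; simp; omega
  · rw [h2]; simp; omega
  · exact Iff.rfl

/-- The half twist `σ_k`, `k ≠ m`, as an element of `B_{m,n}`. -/
noncomputable def mixedSigma (m n k : ℕ) (hk : 1 ≤ k ∧ k < m + n) (hm : k ≠ m) :
    MixedBraidGroup m n :=
  halfTwist (youngSubgroup m n) k hk (adjSwap_mem_youngSubgroup m n k hk hm)

/-! ## The presentation -/

/-- The generators: `σ_k` for `1 ≤ k ≤ 2n - 1`, `k ≠ n`, and `A_{i,j}` for `1 ≤ i < j ≤ 2n`. -/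
inductive MixedGen (n : ℕ) : Type
  | sigma (k : ℕ) (hk : 1 ≤ k ∧ k < 2 * n) (hn : k ≠ n) : MixedGen n
  | pure (i j : ℕ) (h : 1 ≤ i ∧ i < j ∧ j ≤ 2 * n) : MixedGen n

namespace MixedGen

/-- The generator `σ_k` in the free group. -/
def sig {n : ℕ} (k : ℕ) (hk : 1 ≤ k ∧ k < 2 * n) (hn : k ≠ n) : FreeGroup (MixedGen n) :=
  FreeGroup.of (sigma k hk hn)

/-- The generator `A_{i,j}` in the free group. -/
def a {n : ℕ} (i j : ℕ) (h : 1 ≤ i ∧ i < j ∧ j ≤ 2 * n) : FreeGroup (MixedGen n) :=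
  FreeGroup.of (pure i j h)

end MixedGen

open MixedGen in
/-- `MixedRel n u v` says that `u = v` is one of the defining relations. -/
inductive MixedRel (n : ℕ) : FreeGroup (MixedGen n) → FreeGroup (MixedGen n) → Prop
  -- pure braid relations
  | pure_comm (r s i j : ℕ) (hrs : 1 ≤ r ∧ r < s ∧ s ≤ 2 * n) (hij : 1 ≤ i ∧ i < j ∧ j ≤ 2 * n)
      (h : (i < r ∧ r < s ∧ s < j) ∨ (r < s ∧ s < i ∧ i < j)) :
      MixedRel n ((a r s hrs)⁻¹ * a i j hij * a r s hrs) (a i j hij)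
  | pure_snd (r s j : ℕ) (hrs : 1 ≤ r ∧ r < s ∧ s ≤ 2 * n) (hsj : 1 ≤ s ∧ s < j ∧ j ≤ 2 * n) :
      MixedRel n ((a r s hrs)⁻¹ * a s j hsj * a r s hrs)
        (a r j (by omega) * a s j hsj * (a r j (by omega))⁻¹)
  | pure_fst (r s j : ℕ) (hrs : 1 ≤ r ∧ r < s ∧ s ≤ 2 * n) (hrj : 1 ≤ r ∧ r < j ∧ j ≤ 2 * n)
      (h : s < j) :
      MixedRel n ((a r s hrs)⁻¹ * a r j hrj * a r s hrs)
        (a r j hrj * a s j (by omega) * a r j hrj * (a s j (by omega))⁻¹ * (a r j hrj)⁻¹)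
  | pure_cross (r s i j : ℕ) (hrs : 1 ≤ r ∧ r < s ∧ s ≤ 2 * n) (hij : 1 ≤ i ∧ i < j ∧ j ≤ 2 * n)
      (h : r < i ∧ i < s ∧ s < j) :
      MixedRel n ((a r s hrs)⁻¹ * a i j hij * a r s hrs)
        (a r j (by omega) * a s j (by omega) * (a r j (by omega))⁻¹ * (a s j (by omega))⁻¹ *
          a i j hij *
          a s j (by omega) * a r j (by omega) * (a s j (by omega))⁻¹ * (a r j (by omega))⁻¹)
  -- Artin relations
  | artin_braid (i : ℕ) (h : (1 ≤ i ∧ i + 2 ≤ n) ∨ (n + 1 ≤ i ∧ i + 2 ≤ 2 * n)) :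
      MixedRel n
        (sig i (by omega) (by omega) * sig (i + 1) (by omega) (by omega) * sig i (by omega) (by omega))
        (sig (i + 1) (by omega) (by omega) * sig i (by omega) (by omega) *
          sig (i + 1) (by omega) (by omega))
  | artin_comm (i j : ℕ) (hi : 1 ≤ i ∧ i < 2 * n) (hin : i ≠ n) (hj : 1 ≤ j ∧ j < 2 * n)
      (hjn : j ≠ n) (h : i + 2 ≤ j ∨ j + 2 ≤ i) :
      MixedRel n (sig i hi hin * sig j hj hjn) (sig j hj hjn * sig i hi hin)
  -- squares
  | square (i : ℕ) (hi : 1 ≤ i ∧ i < 2 * n) (hin : i ≠ n) :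
      MixedRel n (sig i hi hin ^ 2) (a i (i + 1) (by omega))
  -- conjugates
  | conj_far (k i j : ℕ) (hk : 1 ≤ k ∧ k < 2 * n) (hkn : k ≠ n)
      (hij : 1 ≤ i ∧ i < j ∧ j ≤ 2 * n) (h : k + 1 ≠ i ∧ k ≠ i ∧ k + 1 ≠ j ∧ k ≠ j) :
      MixedRel n (sig k hk hkn * a i j hij * (sig k hk hkn)⁻¹) (a i j hij)
  | conj_self (k : ℕ) (hk : 1 ≤ k ∧ k < 2 * n) (hkn : k ≠ n) :
      MixedRel n (sig k hk hkn * a k (k + 1) (by omega) * (sig k hk hkn)⁻¹) (a k (k + 1) (by omega))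
  | conj_snd (k i : ℕ) (hk : 1 ≤ k ∧ k < 2 * n) (hkn : k ≠ n) (h : 1 ≤ i ∧ i < k) :
      MixedRel n (sig k hk hkn * a i k (by omega) * (sig k hk hkn)⁻¹) (a i (k + 1) (by omega))
  | conj_snd_succ (k i : ℕ) (hk : 1 ≤ k ∧ k < 2 * n) (hkn : k ≠ n) (h : 1 ≤ i ∧ i < k) :
      MixedRel n (sig k hk hkn * a i (k + 1) (by omega) * (sig k hk hkn)⁻¹)
        ((a i (k + 1) (by omega))⁻¹ * a i k (by omega) * a i (k + 1) (by omega))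
  | conj_fst (k j : ℕ) (hk : 1 ≤ k ∧ k < 2 * n) (hkn : k ≠ n) (h : k + 1 < j ∧ j ≤ 2 * n) :
      MixedRel n (sig k hk hkn * a k j (by omega) * (sig k hk hkn)⁻¹) (a (k + 1) j (by omega))
  | conj_fst_succ (k j : ℕ) (hk : 1 ≤ k ∧ k < 2 * n) (hkn : k ≠ n) (h : k + 1 < j ∧ j ≤ 2 * n) :
      MixedRel n (sig k hk hkn * a (k + 1) j (by omega) * (sig k hk hkn)⁻¹)
        ((a (k + 1) j (by omega))⁻¹ * a k j (by omega) * a (k + 1) j (by omega))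

/-- The set of the relators `u v⁻¹`, for the defining relations `u = v`. -/
def mixedRels (n : ℕ) : Set (FreeGroup (MixedGen n)) :=
  {w | ∃ u v, MixedRel n u v ∧ w = u * v⁻¹}

/-! Write G for the presented group and call a family that satisfies Artin's relations an Artin
system. Three facts about B_N are proved from the topology: the half twists form an Artin system
(`isArtinSystem_artinSigma`), they generate (`closure_artinSigma`), and every Artin system in any
group is the image of the half twists under a homomorphism from B_N (`exists_braidRep`). The last
one comes from transport in a flat bundle over the configuration space. Its charts are given by
Matsumoto's section, the product of the s_k along a reduced word, evaluated on the left-to-right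
order of the points. It is applied twice: to the adjacent transpositions, which yields the
permutation of a braid, and to an explicit action on arcs that end at the points.

The defining relations of G hold in every Artin system, so there is a homomorphism `toArtin` from G
to B_{2n} with the required values on the generators.

It is injective. An element of the kernel has trivial permutation. Modulo the normal subgroup
generated by the A_{i,j}, the σ_k are involutions satisfying Artin's relations, and such a quotient
is detected by permutations; hence the element is a word in the A_{i,j} (`mem_closure_pureGens`).
Such words are combed: the A_{i,m} generate a subgroup normalised by the A_{i,j} with j < m, so the
element is p u with p using only indices below m and u a word in the A_{i,m}. Now p fixes the arc to
the point number m, whereas the image of this arc under u determines u as a word in free generators.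
So u = 1, and induction on m finishes (`eq_one_of_mem_closure_pureGens`).

Its image consists of the braids whose permutation lies in S_n × S_n (`mem_range_toArtin`): reduced
words of such permutations avoid the letter n, and what remains after dividing by the corresponding
half twists is pure.

By covering space theory ι is injective with this same image (`toBraid_injective`, `range_toBraid`),
so φ is `toArtin` followed by the inverse of ι. Homotopies of configurations are straight-line
homotopies inside families cut out by convex conditions on differences of points, where no collision
can occur. -/

/-! ## Adjacent transpositions and Matsumoto's section -/

section

open Equiv

/-- The transposition of the values `k - 1` and `k` of `Fin N` (and `1` if there are no such). -/
def adj (N k : ℕ) : Perm (Fin N) :=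
  if hk : 1 ≤ k ∧ k < N then adjSwap N k hk else 1

theorem adj_val {N k : ℕ} (hk : 1 ≤ k ∧ k < N) (a : Fin N) :
    ((adj N k a : Fin N) : ℕ) = if (a : ℕ) + 1 = k then k else if (a : ℕ) = k then k - 1 else a := by
  rw [adj, dif_pos hk, adjSwap, swap_apply_def]
  simp only [Fin.ext_iff]
  split_ifs <;> first | rfl | omega

theorem adj_mul_self (N k : ℕ) : adj N k * adj N k = 1 := by
  unfold adj
  split_ifs with h
  · exact swap_mul_self _ _
  · exact one_mul _

theorem adj_inv (N k : ℕ) : (adj N k)⁻¹ = adj N k :=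
  inv_eq_of_mul_eq_one_left (adj_mul_self N k)

theorem adj_mul_cancel {N : ℕ} (k : ℕ) (w : Perm (Fin N)) : adj N k * (adj N k * w) = w := by
  rw [← mul_assoc, adj_mul_self, one_mul]

/-- The elements `s k`, `k ∈ K`, satisfy Artin's relations. -/
structure IsArtinSystem {Γ : Type*} [Group Γ] (s : ℕ → Γ) (K : Set ℕ) : Prop where
  braid : ∀ k, k ∈ K → k + 1 ∈ K → s k * s (k + 1) * s k = s (k + 1) * s k * s (k + 1)
  comm : ∀ k l, k ∈ K → l ∈ K → k + 2 ≤ l → s k * s l = s l * s k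

theorem IsArtinSystem.map {Γ Δ : Type*} [Group Γ] [Group Δ] {s : ℕ → Γ} {K : Set ℕ}
    (h : IsArtinSystem s K) (f : Γ →* Δ) : IsArtinSystem (fun k => f (s k)) K where
  braid k h1 h2 := by simp only [← map_mul, h.braid k h1 h2]
  comm k l h1 h2 h3 := by simp only [← map_mul, h.comm k l h1 h2 h3]

theorem IsArtinSystem.mono {Γ : Type*} [Group Γ] {s : ℕ → Γ} {K L : Set ℕ}
    (h : IsArtinSystem s K) (hL : L ⊆ K) : IsArtinSystem s L where
  braid k h1 h2 := h.braid k (hL h1) (hL h2)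
  comm k l h1 h2 h3 := h.comm k l (hL h1) (hL h2) h3

/-- The indices of the Artin generators of `B_N`. -/
def adjIndex (N : ℕ) : Set ℕ := {k | 1 ≤ k ∧ k < N}

theorem isArtinSystem_adj (N : ℕ) : IsArtinSystem (adj N) (adjIndex N) where
  braid k h1 h2 := by
    obtain ⟨h1, h1'⟩ := h1
    obtain ⟨h2, h2'⟩ := h2
    have hne : ∀ {a b : ℕ} {ha : a < N} {hb : b < N}, a ≠ b → (⟨a, ha⟩ : Fin N) ≠ ⟨b, hb⟩ :=
      fun h h' => h (congrArg Fin.val h')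
    rw [adj, adj, dif_pos ⟨h1, h1'⟩, dif_pos ⟨h2, h2'⟩, adjSwap, adjSwap]
    simp only [Nat.add_sub_cancel]
    rw [swap_mul_swap_mul_swap (hne (by omega)) (hne (by omega)), swap_comm (⟨k - 1, _⟩ : Fin N),
      swap_comm (⟨k, _⟩ : Fin N) ⟨k + 1, _⟩,
      swap_mul_swap_mul_swap (hne (by omega)) (hne (by omega)), swap_comm]
  comm k l h1 h2 h3 := by
    ext a
    simp only [Perm.mul_apply, adj_val h1, adj_val h2]
    obtain ⟨_, _⟩ := h1
    split_ifs <;> omega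

/-- `k` is a left descent of `w`: the value `k` occurs before the value `k - 1`. -/
def IsDescent {N : ℕ} (w : Perm (Fin N)) (k : ℕ) : Prop :=
  ∃ i j : Fin N, i < j ∧ (w j : ℕ) + 1 = k ∧ (w i : ℕ) = k

theorem IsDescent.mem {N : ℕ} {w : Perm (Fin N)} {k : ℕ} (h : IsDescent w k) :
    1 ≤ k ∧ k < N := by
  obtain ⟨i, j, _, h1, h2⟩ := h
  have := (w i).2
  omega

theorem exists_values {N k : ℕ} (hk : 1 ≤ k ∧ k < N) (w : Perm (Fin N)) :
    ∃ i j : Fin N, i ≠ j ∧ (w i : ℕ) + 1 = k ∧ (w j : ℕ) = k := by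
  refine ⟨w⁻¹ ⟨k - 1, by omega⟩, w⁻¹ ⟨k, hk.2⟩, ?_, ?_, ?_⟩
  · intro h
    have := congrArg Fin.val ((w⁻¹).injective h)
    simp only at this
    omega
  · rw [← Perm.mul_apply, mul_inv_cancel]; simp only [Perm.one_apply]; omega
  · rw [← Perm.mul_apply, mul_inv_cancel]; rfl

theorem isDescent_or_ascent {N k : ℕ} (hk : 1 ≤ k ∧ k < N) (w : Perm (Fin N)) :
    IsDescent w k ∨ IsDescent (adj N k * w) k := by
  obtain ⟨i, j, hij, hi, hj⟩ := exists_values hk w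
  rcases lt_or_gt_of_ne hij with h | h
  · refine Or.inr ⟨i, j, h, ?_, ?_⟩ <;>
      simp only [Perm.mul_apply, adj_val hk] <;> split_ifs <;> omega
  · exact Or.inl ⟨j, i, h, hi, hj⟩

/-- The number of inversions of a permutation. -/
def inversions {N : ℕ} (w : Perm (Fin N)) : Finset (Fin N × Fin N) :=
  Finset.univ.filter fun p => p.1 < p.2 ∧ w p.2 < w p.1

/-- Exchanging the values k - 1 and k changes the relative order of a single pair of positions, and
at a descent that pair is an inversion. This is the measure for the recursions on reduced words. -/
theorem IsDescent.inversions_lt {N : ℕ} {w : Perm (Fin N)} {k : ℕ} (h : IsDescent w k) :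
    (inversions (adj N k * w)).card < (inversions w).card := by
  have hk := h.mem
  obtain ⟨i, j, hij, hj, hi⟩ := h
  apply Finset.card_lt_card
  rw [Finset.ssubset_iff_of_subset]
  · refine ⟨(i, j), ?_, ?_⟩
    · simp only [inversions, Finset.mem_filter, Finset.mem_univ, true_and, Fin.lt_def]
      omega
    · simp only [inversions, Finset.mem_filter, Finset.mem_univ, true_and, Fin.lt_def,
        Perm.mul_apply, adj_val hk]
      split_ifs <;> omega
  · rintro ⟨a, b⟩
    simp only [inversions, Finset.mem_filter, Finset.mem_univ, true_and, Fin.lt_def,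
      Perm.mul_apply, adj_val hk]
    have hne : (a : ℕ) < b → (w a : ℕ) ≠ w b := fun h1 h2 => by
      have := congrArg Fin.val (w.injective (Fin.ext h2))
      omega
    have h1 : (w a : ℕ) = w j → (a : ℕ) = j := fun h => congrArg Fin.val (w.injective (Fin.ext h))
    have h2 : (w b : ℕ) = w i → (b : ℕ) = i := fun h => congrArg Fin.val (w.injective (Fin.ext h))
    rintro ⟨hab, h⟩
    have := hne hab
    refine ⟨hab, ?_⟩
    split_ifs at h <;> omega

/-- Without descents, a permutation is the identity. -/
theorem eq_one_of_no_descent {N : ℕ} {w : Perm (Fin N)} (h : ∀ k, ¬ IsDescent w k) : w = 1 := by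
  -- The positions of successive values increase, so the inverse is an order automorphism of `Fin
  -- N`, and there is only one.
  have hmono : StrictMono (w⁻¹ : Perm (Fin N)) := by
    rcases N with _ | N
    · intro a; exact a.elim0
    rw [Fin.strictMono_iff_lt_succ]
    intro i
    rcases lt_trichotomy ((w⁻¹ : Perm _) i.castSucc) ((w⁻¹ : Perm _) i.succ) with h1 | h1 | h1
    · exact h1
    · have := congrArg Fin.val ((w⁻¹).injective h1)
      simp at this
    · exact absurd ⟨_, _, h1, by simp, by simp⟩ (h (i + 1))
  have : (⇑(w⁻¹) : Fin N → Fin N) = id := by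
    have := Subsingleton.elim (hmono.orderIsoOfSurjective _ (w⁻¹).surjective) (OrderIso.refl _)
    ext i
    exact congrArg Fin.val (DFunLike.congr_fun this i)
  rw [← inv_eq_one]
  ext i
  simp [this]

theorem not_isDescent_one {N k : ℕ} : ¬ IsDescent (1 : Perm (Fin N)) k := by
  rintro ⟨i, j, h, h1, h2⟩
  simp only [Perm.one_apply, Fin.lt_def] at *
  omega

open Classical in
/-- Matsumoto's section: the product of the `s k` along a reduced word. -/
noncomputable def permSection {Γ : Type*} [Group Γ] {N : ℕ} (s : ℕ → Γ) (w : Perm (Fin N)) : Γ :=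
  -- The descent is an arbitrary choice; independence of it is `permSection_of_isDescent` and needs
  -- Artin's relations.
  if h : ∃ k, IsDescent w k then s h.choose * permSection s (adj N h.choose * w) else 1
termination_by (inversions w).card
decreasing_by exact h.choose_spec.inversions_lt

theorem permSection_one {Γ : Type*} [Group Γ] {N : ℕ} (s : ℕ → Γ) :
    permSection s (1 : Perm (Fin N)) = 1 := by
  rw [permSection, dif_neg]
  rintro ⟨k, hk⟩
  exact not_isDescent_one hk

/-! ### Independence of the reduced word -/

section Matsumoto

variable {Γ : Type*} [Group Γ] {N : ℕ} {s : ℕ → Γ} {K : Set ℕ} {H : Subgroup (Perm (Fin N))}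

theorem isDescent_adj_mul_of_far {w : Perm (Fin N)} {k l : ℕ} (hk : IsDescent w k)
    (hl : IsDescent w l) (h : k + 2 ≤ l ∨ l + 2 ≤ k) : IsDescent (adj N k * w) l := by
  obtain ⟨i, j, hij, hj, hi⟩ := hl
  have := hk.mem
  refine ⟨i, j, hij, ?_, ?_⟩ <;> simp only [Perm.mul_apply, adj_val hk.mem] <;> split_ifs <;> omega

/-- The values k + 1, k, k - 1 occur in this order in w, so either side of the braid relation can be
stripped from w letter by letter; these are the descents met on the way. -/
theorem isDescent_adj_mul_succ {w : Perm (Fin N)} {k : ℕ} (hk : IsDescent w k)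
    (hl : IsDescent w (k + 1)) : IsDescent (adj N k * w) (k + 1) ∧
      IsDescent (adj N (k + 1) * (adj N k * w)) k ∧ IsDescent (adj N (k + 1) * w) k ∧
      IsDescent (adj N k * (adj N (k + 1) * w)) (k + 1) := by
  have h1 := hk.mem
  have h2 := hl.mem
  obtain ⟨i, j, hij, hj, hi⟩ := hk
  obtain ⟨i', j', hij', hj', hi'⟩ := hl
  have : j' = i := w.injective (Fin.ext (by omega))
  subst this
  refine ⟨⟨i', j, hij'.trans hij, ?_, ?_⟩, ⟨i', j', hij', ?_, ?_⟩, ⟨i', j, hij'.trans hij, ?_, ?_⟩,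
    ⟨j', j, hij, ?_, ?_⟩⟩ <;>
    simp only [Perm.mul_apply, adj_val h1, adj_val h2] <;> split_ifs <;> omega

/-- Matsumoto's theorem, for the permutations in a subgroup `H` all of whose descents are in `K`. -/
theorem permSection_of_isDescent (hs : IsArtinSystem s K)
    (hdesc : ∀ w ∈ H, ∀ k, IsDescent w k → k ∈ K) (hadj : ∀ k ∈ K, adj N k ∈ H) :
    ∀ w ∈ H, ∀ k, IsDescent w k → permSection s w = s k * permSection s (adj N k * w) := by
  intro w
  induction hm : (inversions w).card using Nat.strong_induction_on generalizing w with
  | _ m ih =>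
  intro hw
  -- Confluence: starting from k or from l, strip further letters until both sides reach the same
  -- permutation. The two prefixes are then the two sides of a commutation or of a braid relation.
  have key : ∀ k l, IsDescent w k → IsDescent w l → k < l →
      s k * permSection s (adj N k * w) = s l * permSection s (adj N l * w) := by
    intro k l hk hl hkl
    have hkK := hdesc w hw k hk
    have hlK := hdesc w hw l hl
    have IH : ∀ u a, u ∈ H → (inversions u).card < m → IsDescent u a →
        permSection s u = s a * permSection s (adj N a * u) :=
      fun u a hu hum hd => ih _ hum u rfl hu a hd
    have hwk := H.mul_mem (hadj k hkK) hw
    have hwl := H.mul_mem (hadj l hlK) hw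
    have mk := hm ▸ hk.inversions_lt
    have ml := hm ▸ hl.inversions_lt
    rcases Nat.lt_or_ge (k + 1) l with h | h
    · rw [IH _ l hwk mk (isDescent_adj_mul_of_far hk hl (Or.inl h)),
        IH _ k hwl ml (isDescent_adj_mul_of_far hl hk (Or.inr h)),
        ← mul_assoc, ← mul_assoc, hs.comm k l hkK hlK h, ← mul_assoc, ← mul_assoc,
        (isArtinSystem_adj N).comm k l hk.mem hl.mem h]
    · obtain rfl : l = k + 1 := by omega
      obtain ⟨d1, d2, d3, d4⟩ := isDescent_adj_mul_succ hk hl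
      rw [IH _ _ hwk mk d1, IH _ _ (H.mul_mem (hadj _ hlK) hwk) (d1.inversions_lt.trans mk) d2,
        IH _ _ hwl ml d3, IH _ _ (H.mul_mem (hadj _ hkK) hwl) (d3.inversions_lt.trans ml) d4]
      have e := (isArtinSystem_adj N).braid k hk.mem hl.mem
      have e' : adj N k * (adj N (k + 1) * (adj N k * w)) =
          adj N (k + 1) * (adj N k * (adj N (k + 1) * w)) := by
        simp only [← mul_assoc, e]
      rw [e']
      simp only [← mul_assoc, hs.braid k hkK hlK]
  intro k hk
  have hex : ∃ k, IsDescent w k := ⟨k, hk⟩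
  rw [permSection, dif_pos hex]
  rcases lt_trichotomy hex.choose k with h | h | h
  · exact key _ _ hex.choose_spec hk h
  · rw [h]
  · exact (key _ _ hk hex.choose_spec h).symm

/-- Stripping a descent of an element of H uses a letter of K and stays in H, so the whole reduced
word is written in K. -/
theorem permSection_mem_closure
    (hdesc : ∀ w ∈ H, ∀ k, IsDescent w k → k ∈ K) (hadj : ∀ k ∈ K, adj N k ∈ H) :
    ∀ w ∈ H, permSection s w ∈ Subgroup.closure (s '' K) := by
  intro w
  induction hm : (inversions w).card using Nat.strong_induction_on generalizing w with
  | _ m ih =>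
  intro hw
  rw [permSection]
  split_ifs with h
  · have hK := hdesc w hw _ h.choose_spec
    exact mul_mem (Subgroup.subset_closure ⟨_, hK, rfl⟩)
      (ih _ (hm ▸ h.choose_spec.inversions_lt) _ rfl (H.mul_mem (hadj _ hK) hw))
  · exact one_mem _

theorem map_permSection (f : Γ →* Perm (Fin N)) (hf : ∀ k ∈ K, f (s k) = adj N k)
    (hdesc : ∀ w ∈ H, ∀ k, IsDescent w k → k ∈ K) (hadj : ∀ k ∈ K, adj N k ∈ H) :
    ∀ w ∈ H, f (permSection s w) = w := by
  intro w
  induction hm : (inversions w).card using Nat.strong_induction_on generalizing w with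
  | _ m ih =>
  intro hw
  rw [permSection]
  split_ifs with h
  · have hK := hdesc w hw _ h.choose_spec
    rw [map_mul, ih _ (hm ▸ h.choose_spec.inversions_lt) _ rfl (H.mul_mem (hadj _ hK) hw), hf _ hK,
      adj_mul_cancel]
  · rw [map_one, eq_one_of_no_descent (fun k hk => h ⟨k, hk⟩)]

/-- A group generated by involutions that satisfy the Artin relations is detected by its
permutations. -/
theorem injective_of_involutions (hs : IsArtinSystem s K)
    (hdesc : ∀ w ∈ H, ∀ k, IsDescent w k → k ∈ K) (hadj : ∀ k ∈ K, adj N k ∈ H)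
    (hK : K ⊆ adjIndex N) (hsq : ∀ k ∈ K, s k * s k = 1) (hgen : Subgroup.closure (s '' K) = ⊤)
    (f : Γ →* Perm (Fin N)) (hf : ∀ k ∈ K, f (s k) = adj N k) : Function.Injective f := by
  -- Because `s k` is an involution, the same formula holds at ascents and descents; so the values
  -- of the section are stable under the generators and exhaust Γ.
  have step : ∀ w ∈ H, ∀ k ∈ K, s k * permSection s w = permSection s (adj N k * w) := by
    intro w hw k hk
    rcases isDescent_or_ascent (hK hk) w with h | h
    · rw [permSection_of_isDescent hs hdesc hadj w hw k h, ← mul_assoc, hsq k hk, one_mul]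
    · rw [permSection_of_isDescent hs hdesc hadj _ (H.mul_mem (hadj k hk) hw) k h, adj_mul_cancel]
  have surj : ∀ g : Γ, ∃ w ∈ H, g = permSection s w := by
    intro g
    have hg : g ∈ Subgroup.closure (s '' K) := hgen ▸ Subgroup.mem_top g
    induction hg using Subgroup.closure_induction_left with
    | one => exact ⟨1, H.one_mem, (permSection_one s).symm⟩
    | mul_left x hx y _ ih =>
      obtain ⟨k, hk, rfl⟩ := hx
      obtain ⟨w, hw, rfl⟩ := ih
      exact ⟨_, H.mul_mem (hadj k hk) hw, step w hw k hk⟩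
    | inv_mul_cancel x hx y _ ih =>
      obtain ⟨k, hk, rfl⟩ := hx
      obtain ⟨w, hw, rfl⟩ := ih
      rw [inv_eq_of_mul_eq_one_left (hsq k hk)]
      exact ⟨_, H.mul_mem (hadj k hk) hw, step w hw k hk⟩
  rw [injective_iff_map_eq_one]
  intro g hg
  obtain ⟨w, hw, rfl⟩ := surj g
  rw [map_permSection f hf hdesc hadj w hw] at hg
  rw [hg, permSection_one]

end Matsumoto

end

/-! ### Dependence of the section on a reference order -/

section Cocycle

open Equiv

variable {Γ : Type*} [Group Γ] {N : ℕ} {s : ℕ → Γ}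

theorem permSection_of_isDescent_top (hs : IsArtinSystem s (adjIndex N)) (w : Perm (Fin N)) (k : ℕ)
    (h : IsDescent w k) : permSection s w = s k * permSection s (adj N k * w) :=
  permSection_of_isDescent (H := ⊤) hs (fun _ _ _ h => h.mem) (fun _ _ => Subgroup.mem_top _) w
    (Subgroup.mem_top _) k h

theorem permSection_adj_mul (hs : IsArtinSystem s (adjIndex N)) (w : Perm (Fin N)) (k : ℕ)
    {i j : Fin N} (hij : i < j) (hi : (w i : ℕ) + 1 = k) (hj : (w j : ℕ) = k) :
    permSection s (adj N k * w) = s k * permSection s w := by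
  have hk : 1 ≤ k ∧ k < N := by have := (w j).2; omega
  rw [permSection_of_isDescent_top hs (adj N k * w) k, adj_mul_cancel]
  refine ⟨i, j, hij, ?_, ?_⟩ <;> simp only [Perm.mul_apply, adj_val hk] <;> split_ifs <;> omega

/-- The recursion strips letters on the left, so a letter appended on the right has to be carried
along an induction over the left descents of w; these remain descents after appending. -/
theorem permSection_mul_adj (hs : IsArtinSystem s (adjIndex N)) (k : ℕ)
    (w : Perm (Fin N)) (a b : Fin N) (ha : (a : ℕ) + 1 = k) (hb : (b : ℕ) = k) (h : w a < w b) :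
    permSection s (w * adj N k) = permSection s w * s k := by
  have hk : 1 ≤ k ∧ k < N := by have := b.2; omega
  induction hm : (inversions w).card using Nat.strong_induction_on generalizing w with
  | _ m ih =>
  by_cases hex : ∃ l, IsDescent w l
  · obtain ⟨l, hl⟩ := hex
    have hl' := hl
    obtain ⟨i, j, hij, hj, hi⟩ := hl'
    have hd : IsDescent (w * adj N k) l := by
      refine ⟨adj N k i, adj N k j, ?_, ?_, ?_⟩
      -- The hypothesis `h` excludes the only pair of positions whose order `adj N k` reverses.
      · have h1 : ¬ (i = a ∧ j = b) := by
          rintro ⟨rfl, rfl⟩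
          rw [Fin.lt_def] at h
          omega
        rw [Fin.lt_def, adj_val hk, adj_val hk]
        simp only [Fin.ext_iff, Fin.lt_def] at h1 hij
        split_ifs <;> omega
      · rw [Perm.mul_apply, ← Perm.mul_apply (adj N k), adj_mul_self]; exact hj
      · rw [Perm.mul_apply, ← Perm.mul_apply (adj N k), adj_mul_self]; exact hi
    have hlt : (adj N l * w) a < (adj N l * w) b := by
      have h1 : (w a : ℕ) = w j → (a : ℕ) = j := fun h =>
        congrArg Fin.val (w.injective (Fin.ext h))
      have h2 : (w b : ℕ) = w i → (b : ℕ) = i := fun h =>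
        congrArg Fin.val (w.injective (Fin.ext h))
      simp only [Fin.lt_def, Perm.mul_apply, adj_val hl.mem] at *
      split_ifs <;> omega
    rw [permSection_of_isDescent_top hs _ l hd, ← mul_assoc (adj N l),
      ih _ (hm ▸ hl.inversions_lt) (adj N l * w) hlt rfl, ← mul_assoc,
      ← permSection_of_isDescent_top hs w l hl]
  · obtain rfl : w = 1 := eq_one_of_no_descent fun l hl => hex ⟨l, hl⟩
    have := permSection_adj_mul hs (1 : Perm (Fin N)) k h ha hb
    rw [mul_one] at this
    rw [one_mul, permSection_one, one_mul, this, permSection_one, mul_one]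

/-- The transport from the order `p` to the order `q` depends on the order `u` of the heights
only through the pairs on which `p` and `q` differ. -/
theorem permSection_cocycle (hs : IsArtinSystem s (adjIndex N)) (p q u u' : Perm (Fin N))
    (h : ∀ i j, p i < p j → q j < q i → (u i < u j ↔ u' i < u' j)) :
    permSection s (q * u⁻¹) * (permSection s (p * u⁻¹))⁻¹ =
      permSection s (q * u'⁻¹) * (permSection s (p * u'⁻¹))⁻¹ := by
  induction hm : (inversions (u * u'⁻¹)).card using Nat.strong_induction_on generalizing u with
  | _ m ih =>
  -- Move u towards u' by exchanging two points i, j of neighbouring heights on which they disagree.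
  -- By `h` the orders p and q then agree on i, j, so both sections gain or lose the same letter `s
  -- k` on the right, and it cancels in the quotient.
  by_cases hex : ∃ k, IsDescent (u * u'⁻¹) k
  · obtain ⟨k, hk⟩ := hex
    have hk' := hk
    obtain ⟨a, b, hab, hb, ha⟩ := hk'
    obtain ⟨i, rfl⟩ := u'.surjective a
    obtain ⟨j, rfl⟩ := u'.surjective b
    simp only [Perm.mul_apply, ← Perm.mul_apply u'⁻¹, inv_mul_cancel, Perm.one_apply] at ha hb
    have hv : ∀ c d, ¬ (c = i ∧ d = j) → ¬ (c = j ∧ d = i) →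
        ((adj N k * u) c < (adj N k * u) d ↔ u c < u d) := by
      intro c d h1 h2
      have e : ∀ c d, (u c : ℕ) = u d → c = d := fun c d h => u.injective (Fin.ext h)
      have e1 : ¬ ((u c : ℕ) = u i ∧ (u d : ℕ) = u j) := fun x => h1 ⟨e _ _ x.1, e _ _ x.2⟩
      have e2 : ¬ ((u c : ℕ) = u j ∧ (u d : ℕ) = u i) := fun x => h2 ⟨e _ _ x.1, e _ _ x.2⟩
      clear h1 h2
      simp only [Fin.lt_def, Perm.mul_apply, adj_val hk.mem]
      split_ifs <;> omega
    have hij : i ≠ j := fun e => by subst e; omega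
    have hdis : ¬ (u i < u j ↔ u' i < u' j) := by
      rw [iff_true_right hab, Fin.lt_def]; omega
    have hdis' : ¬ (u j < u i ↔ u' j < u' i) := by
      rw [iff_true_left (by rw [Fin.lt_def]; omega)]; exact hab.not_gt
    have hord : (p i < p j ↔ q i < q j) := by
      have hp : p i ≠ p j := fun e => hij (p.injective e)
      have hq : q i ≠ q j := fun e => hij (q.injective e)
      constructor <;> intro h1 <;> by_contra h2
      · exact hdis (h i j h1 (lt_of_le_of_ne (not_lt.mp h2) hq.symm))
      · exact hdis' (h j i (lt_of_le_of_ne (not_lt.mp h2) hp.symm) h1)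
    rw [← ih _ (by rw [← hm]; simpa only [mul_assoc] using hk.inversions_lt) (adj N k * u) ?_ rfl]
    · rw [mul_inv_rev, adj_inv, ← mul_assoc, ← mul_assoc]
      have apply_u : ∀ (x : Perm (Fin N)) (c : Fin N), (x * u⁻¹) (u c) = x c := fun x c => by
        rw [Perm.mul_apply, ← Perm.mul_apply u⁻¹, inv_mul_cancel, Perm.one_apply]
      have asc : ∀ x : Perm (Fin N), x j < x i →
          permSection s (x * u⁻¹ * adj N k) = permSection s (x * u⁻¹) * s k := fun x hx =>
        permSection_mul_adj hs k (x * u⁻¹) (u j) (u i) hb ha (by rwa [apply_u, apply_u])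
      have desc : ∀ x : Perm (Fin N), x i < x j →
          permSection s (x * u⁻¹) = permSection s (x * u⁻¹ * adj N k) * s k := fun x hx => by
        have e1 : adj N k (u j) = u i := Fin.ext (by rw [adj_val hk.mem]; split_ifs; all_goals omega)
        have e2 : adj N k (u i) = u j := Fin.ext (by rw [adj_val hk.mem]; split_ifs; all_goals omega)
        have := permSection_mul_adj hs k (x * u⁻¹ * adj N k) (u j) (u i) hb ha (by
          show (x * u⁻¹) (adj N k (u j)) < (x * u⁻¹) (adj N k (u i))
          rwa [e1, e2, apply_u, apply_u])
        rwa [mul_assoc, adj_mul_self, mul_one] at this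
      by_cases hp : p i < p j
      · rw [desc p hp, desc q (hord.mp hp)]
        group
      · have hp' : p j < p i := lt_of_le_of_ne (not_lt.mp hp) fun e => hij (p.injective e.symm)
        have hq' : q j < q i := lt_of_le_of_ne (not_lt.mp fun e => hp (hord.mpr e))
          fun e => hij (q.injective e.symm)
        rw [asc p hp', asc q hq']
        group
    · intro c d h1 h2
      rw [hv c d, h c d h1 h2]
      · rintro ⟨rfl, rfl⟩; exact hdis (h c d h1 h2)
      · rintro ⟨rfl, rfl⟩; exact hdis' (h c d h1 h2)
  · have : u * u'⁻¹ = 1 := eq_one_of_no_descent fun k hk => hex ⟨k, hk⟩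
    rw [mul_inv_eq_one.mp this]

end Cocycle

/-! ## The relations between the `A_{i,j}` -/

/-- `A_{i,j} = s_{j-1} ⋯ s_{i+1} s_i² s_{i+1}⁻¹ ⋯ s_{j-1}⁻¹`. -/
def bandA {Γ : Type*} [Group Γ] (s : ℕ → Γ) (i j : ℕ) : Γ :=
  ((List.Ico (i + 1) j).reverse.map s).prod * s i ^ 2 *
    (((List.Ico (i + 1) j).reverse.map s).prod)⁻¹

theorem map_bandA {Γ Δ : Type*} [Group Γ] [Group Δ] (f : Γ →* Δ) (s : ℕ → Γ) (i j : ℕ) :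
    f (bandA s i j) = bandA (fun k => f (s k)) i j := by
  simp only [bandA, map_mul, map_inv, map_pow, map_list_prod, List.map_map]
  rfl

section Band

variable {Γ : Type*} [Group Γ] {s : ℕ → Γ} {N : ℕ}

theorem bandA_self (i : ℕ) : bandA s i (i + 1) = s i ^ 2 := by
  simp [bandA]

theorem bandA_succ {i j : ℕ} (h : i < j) : bandA s i (j + 1) = s j * bandA s i j * (s j)⁻¹ := by
  simp only [bandA, List.Ico.succ_top h, List.reverse_append, List.map_append, List.prod_append]
  simp [mul_assoc]

theorem bandA_mem_closure {i j : ℕ} (h : i < j) :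
    bandA s i j ∈ Subgroup.closure (s '' {k | i ≤ k ∧ k < j}) := by
  obtain ⟨d, rfl⟩ := Nat.exists_eq_add_of_lt h
  clear h
  induction d with
  | zero =>
    rw [add_zero, bandA_self]
    refine pow_mem (Subgroup.subset_closure (Set.mem_image_of_mem s ?_)) 2
    exact ⟨le_rfl, by omega⟩
  | succ d ih =>
    rw [← add_assoc i, bandA_succ (by omega)]
    have h1 : s (i + d + 1) ∈ Subgroup.closure (s '' {k | i ≤ k ∧ k < i + d + 1 + 1}) :=
      Subgroup.subset_closure ⟨i + d + 1, ⟨by omega, by omega⟩, rfl⟩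
    refine mul_mem (mul_mem h1 (Subgroup.closure_mono (Set.image_mono ?_) ih)) (inv_mem h1)
    rintro k ⟨h1, h2⟩
    exact ⟨h1, by omega⟩

theorem commute_bandA {i j : ℕ} (h : i < j) {x : Γ} (hx : ∀ k, i ≤ k → k < j → Commute x (s k)) :
    Commute x (bandA s i j) := by
  have := bandA_mem_closure (s := s) h
  generalize bandA s i j = b at this ⊢
  induction this using Subgroup.closure_induction with
  | mem y hy => obtain ⟨k, hk, rfl⟩ := hy; exact hx k hk.1 hk.2
  | one => exact Commute.one_right _
  | mul y z _ _ h1 h2 => exact h1.mul_right h2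
  | inv y _ h => exact h.inv_right

theorem conj_eq_of_commute {x y : Γ} (h : Commute x y) : MulAut.conj x y = y := by
  rw [MulAut.conj_apply, h.eq, mul_inv_cancel_right]

open MulAut in
theorem conj_bandA_snd {k i : ℕ} (h : i < k) : conj (s k) (bandA s i k) = bandA s i (k + 1) :=
  (bandA_succ h).symm

variable (hs : IsArtinSystem s (adjIndex N))
include hs

theorem IsArtinSystem.commute {k l : ℕ} (hk : 1 ≤ k ∧ k < N) (hl : 1 ≤ l ∧ l < N)
    (h : k + 2 ≤ l ∨ l + 2 ≤ k) : Commute (s k) (s l) := by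
  rcases h with h | h
  · exact hs.comm k l hk hl h
  · exact (hs.comm l k hl hk h).symm

theorem commute_bandA_of_far {k i j : ℕ} (hk : 1 ≤ k ∧ k < N) (hij : 1 ≤ i ∧ i < j ∧ j ≤ N)
    (h : k + 1 < i ∨ j < k) : Commute (s k) (bandA s i j) :=
  commute_bandA hij.2.1 fun l h1 h2 => hs.commute hk (by omega) (by omega)

/-- For j = k + 2, conjugation by s_{k+1} s_k carries the commuting pair s_{k+1}, A_{i,k} to the
pair s_k, A_{i,k+2}. A larger j only adds conjugation by letters that commute with s_k. -/
theorem commute_bandA_of_between {k i j : ℕ} (hi : 1 ≤ i) (hik : i < k)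
    (hkj : k + 1 < j) (hj : j ≤ N) : Commute (s k) (bandA s i j) := by
  obtain ⟨d, rfl⟩ := Nat.exists_eq_add_of_lt hkj
  clear hkj
  induction d with
  | zero =>
    have hb := hs.braid k ⟨by omega, by omega⟩ ⟨by omega, by omega⟩
    have hc : Commute (s (k + 1)) (bandA s i k) :=
      commute_bandA_of_far hs ⟨by omega, by omega⟩ ⟨by omega, by omega, by omega⟩ (Or.inr (by omega))
    have h1 : s k = s (k + 1) * s k * s (k + 1) * (s (k + 1) * s k)⁻¹ := by
      rw [← hb]; group
    have := (Commute.conj_iff (s (k + 1) * s k)).mpr hc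
    rw [← h1] at this
    rw [add_zero, bandA_succ (by omega), bandA_succ hik]
    simpa only [mul_inv_rev, mul_assoc] using this
  | succ d ih =>
    rw [← add_assoc, bandA_succ (by omega)]
    have h1 : Commute (s k) (s (k + 1 + d + 1)) :=
      hs.commute ⟨by omega, by omega⟩ ⟨by omega, by omega⟩ (by omega)
    exact (h1.mul_right (ih (by omega))).mul_right h1.inv_right

theorem commute_bandA_of_ne {k i j : ℕ} (hk : 1 ≤ k ∧ k < N) (hij : 1 ≤ i ∧ i < j ∧ j ≤ N)
    (h : k + 1 ≠ i ∧ k ≠ i ∧ k + 1 ≠ j ∧ k ≠ j) : Commute (s k) (bandA s i j) := by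
  by_cases h1 : i < k ∧ k + 1 < j
  · exact commute_bandA_of_between hs hij.1 h1.1 h1.2 hij.2.2
  · exact commute_bandA_of_far hs hk hij (by omega)

open MulAut

theorem conj_bandA_fst {k j : ℕ} (hk : 1 ≤ k) (hkj : k + 1 < j) (hj : j ≤ N) :
    conj (s k) (bandA s k j) = bandA s (k + 1) j := by
  obtain ⟨d, rfl⟩ := Nat.exists_eq_add_of_lt hkj
  clear hkj
  induction d with
  | zero =>
    have hb := hs.braid k ⟨by omega, by omega⟩ ⟨by omega, by omega⟩
    rw [add_zero, bandA_succ (by omega), bandA_self, bandA_self]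
    have h1 : s (k + 1) = conj (s k * s (k + 1)) (s k) := by
      rw [MulAut.conj_apply, hb]; group
    conv_rhs => rw [h1]
    rw [← map_pow, map_mul conj, MulAut.mul_apply, MulAut.conj_apply (s (k + 1))]
  | succ d ih =>
    rw [← add_assoc, bandA_succ (j := k + 1 + d + 1) (by omega),
      bandA_succ (i := k + 1) (by omega), map_mul, map_mul, map_inv, ih (by omega), conj_eq_of_commute
        (hs.commute (l := k + 1 + d + 1) ⟨by omega, by omega⟩ ⟨by omega, by omega⟩ (by omega))]

/-- Geometrically, the strand k + 2 encircles the strands k and k + 1, which may be half twisted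
before or after. -/
theorem commute_square_sandwich {k : ℕ} (hk : 1 ≤ k ∧ k + 1 < N) :
    Commute (s (k + 1) * s k ^ 2 * s (k + 1)) (s k) := by
  have hb := hs.braid k ⟨by omega, by omega⟩ ⟨by omega, by omega⟩
  show _ * _ = _ * _
  calc s (k + 1) * s k ^ 2 * s (k + 1) * s k
      = s (k + 1) * s k * (s k * s (k + 1) * s k) := by simp only [pow_two, mul_assoc]
    _ = (s (k + 1) * s k * s (k + 1)) * s k * s (k + 1) := by rw [hb]; simp only [mul_assoc]
    _ = s k * (s (k + 1) * s k ^ 2 * s (k + 1)) := by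
        rw [← hb]; simp only [pow_two, mul_assoc]

/-- This and `commute_bandA_snd` grow out of `commute_square_sandwich` by conjugation. They supply
the relations in which a half twist conjugates A_{i,j} to something other than a single generator.
-/
theorem commute_bandA_fst {k j : ℕ} (hk : 1 ≤ k) (hkj : k + 1 < j) (hj : j ≤ N) :
    Commute (bandA s (k + 1) j * s k ^ 2) (bandA s k j) := by
  obtain ⟨d, rfl⟩ := Nat.exists_eq_add_of_lt hkj
  clear hkj
  induction d with
  | zero =>
    rw [add_zero, bandA_self, bandA_succ (by omega), bandA_self]
    have := (Commute.conj_iff (s (k + 1))).mpr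
      ((commute_square_sandwich hs (k := k) ⟨hk, by omega⟩).pow_right 2)
    convert this using 1
    simp only [pow_two, mul_assoc, mul_inv_cancel, mul_one]
  | succ d ih =>
    have h1 : Commute (s (k + 1 + d + 1)) (s k) :=
      hs.commute ⟨by omega, by omega⟩ ⟨by omega, by omega⟩ (by omega)
    have := (ih (by omega)).map (conj (s (k + 1 + d + 1)))
    rwa [map_mul, conj_bandA_snd (by omega), conj_bandA_snd (by omega), map_pow,
      conj_eq_of_commute h1] at this

theorem commute_bandA_snd {k i : ℕ} (hi : 1 ≤ i) (hik : i < k) (hk : k < N) :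
    Commute (bandA s i (k + 1) * s k ^ 2) (bandA s i k) := by
  obtain ⟨d, rfl⟩ := Nat.exists_eq_add_of_lt hik
  clear hik
  induction d generalizing i with
  | zero =>
    rw [add_zero, bandA_succ (by omega), bandA_self]
    have := (commute_square_sandwich hs (k := i) ⟨hi, by omega⟩).pow_right 2
    convert this using 1
    simp only [pow_two, mul_assoc, inv_mul_cancel_left]
  | succ d ih =>
    have e : i + (d + 1) + 1 = i + 1 + d + 1 := by omega
    have h1 : Commute (s i) (s (i + 1 + d + 1)) :=
      hs.commute ⟨by omega, by omega⟩ ⟨by omega, by omega⟩ (by omega)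
    have := ih (i := i + 1) (by omega) (by omega)
    rw [← conj_eq_of_commute h1, ← conj_bandA_fst hs hi (by omega) (by omega),
      ← conj_bandA_fst hs hi (by omega) (by omega), ← map_pow, ← map_mul,
      MulAut.conj_apply, MulAut.conj_apply, Commute.conj_iff] at this
    rwa [e]

omit hs in
-- With y = c x c⁻¹ the commutation says c² x c⁻² = y⁻¹ x y, and the left side is c y c⁻¹.
theorem conj_eq_of_commute_mul_sq {x y c : Γ} (h : Commute (y * c ^ 2) x) (hc : conj c x = y) :
    conj c y = y⁻¹ * x * y := by
  calc conj c y = y⁻¹ * (y * c ^ 2 * x) * (c ^ 2)⁻¹ := by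
        rw [← hc]; simp [MulAut.conj_apply, pow_two, mul_assoc]
    _ = y⁻¹ * x * y := by rw [h.eq]; group

theorem conj_bandA_snd_succ {k i : ℕ} (hi : 1 ≤ i) (hik : i < k) (hk : k < N) :
    conj (s k) (bandA s i (k + 1)) =
      (bandA s i (k + 1))⁻¹ * bandA s i k * bandA s i (k + 1) :=
  conj_eq_of_commute_mul_sq (commute_bandA_snd hs hi hik hk) (conj_bandA_snd hik)

theorem conj_bandA_fst_succ {k j : ℕ} (hk : 1 ≤ k) (hkj : k + 1 < j) (hj : j ≤ N) :
    conj (s k) (bandA s (k + 1) j) =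
      (bandA s (k + 1) j)⁻¹ * bandA s k j * bandA s (k + 1) j :=
  conj_eq_of_commute_mul_sq (commute_bandA_fst hs hk hkj hj) (conj_bandA_fst hs hk hkj hj)

theorem inv_conj_bandA_fst {k j : ℕ} (hk : 1 ≤ k) (hkj : k + 1 < j) (hj : j ≤ N) :
    (s k)⁻¹ * bandA s (k + 1) j * s k = bandA s k j := by
  rw [← conj_bandA_fst hs hk hkj hj, MulAut.conj_apply]; group

theorem inv_conj_bandA_fst_self {k j : ℕ} (hk : 1 ≤ k) (hkj : k + 1 < j) (hj : j ≤ N) :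
    (s k)⁻¹ * bandA s k j * s k = bandA s k j * bandA s (k + 1) j * (bandA s k j)⁻¹ := by
  have h1 := conj_bandA_fst_succ hs hk hkj hj
  have h2 := inv_conj_bandA_fst hs hk hkj hj
  rw [mul_assoc, eq_inv_mul_iff_mul_eq, MulAut.conj_apply] at h1
  have h3 : (s k)⁻¹ * bandA s k j * s k =
      ((s k)⁻¹ * bandA s (k + 1) j * s k) * bandA s (k + 1) j *
        ((s k)⁻¹ * bandA s (k + 1) j * s k)⁻¹ := by
    rw [← mul_inv_eq_iff_eq_mul] at h1
    conv_lhs => rw [← h1]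
    group
  rw [h3, h2]

theorem commute_bandA_bandA {r t i j : ℕ} (hrs : 1 ≤ r ∧ r < t ∧ t ≤ N)
    (hij : 1 ≤ i ∧ i < j ∧ j ≤ N)
    (h : (i < r ∧ r < t ∧ t < j) ∨ (r < t ∧ t < i ∧ i < j)) :
    Commute (bandA s r t) (bandA s i j) :=
  (commute_bandA hrs.2.1 fun k h1 h2 =>
    (commute_bandA_of_ne hs (k := k) (by omega) hij (by omega)).symm).symm

/-- For t = r + 1 the conjugator is s_r², so the rule for s_r⁻¹ is used twice. Conjugation by s_t
then raises t: it shifts the index t of both A_{r,t} and A_{t,j} and fixes A_{r,j}. The next two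
relations are propagated in the same way. -/
theorem inv_conj_bandA_right {r t j : ℕ} (hr : 1 ≤ r) (hrt : r < t) (htj : t < j) (hj : j ≤ N) :
    (bandA s r t)⁻¹ * bandA s t j * bandA s r t =
      bandA s r j * bandA s t j * (bandA s r j)⁻¹ := by
  obtain ⟨d, rfl⟩ := Nat.exists_eq_add_of_lt hrt
  clear hrt
  induction d with
  | zero =>
    rw [add_zero, bandA_self, ← inv_conj_bandA_fst_self hs hr htj hj,
      ← inv_conj_bandA_fst hs hr htj hj]
    simp only [pow_two, mul_inv_rev, mul_assoc]
  | succ d ih =>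
    have := congrArg (conj (s (r + d + 1))) (ih (by omega))
    simp only [map_mul, map_inv] at this
    rwa [conj_bandA_snd (by omega), conj_bandA_fst hs (by omega) (by omega) hj,
      conj_eq_of_commute (commute_bandA_of_between hs hr (by omega) (by omega) hj)] at this

theorem inv_conj_bandA_left {r t j : ℕ} (hr : 1 ≤ r) (hrt : r < t) (htj : t < j) (hj : j ≤ N) :
    (bandA s r t)⁻¹ * bandA s r j * bandA s r t =
      bandA s r j * bandA s t j * bandA s r j * (bandA s t j)⁻¹ * (bandA s r j)⁻¹ := by
  obtain ⟨d, rfl⟩ := Nat.exists_eq_add_of_lt hrt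
  clear hrt
  induction d with
  | zero =>
    have h1 := inv_conj_bandA_fst_self hs hr htj hj
    have h2 := inv_conj_bandA_fst hs hr htj hj
    calc (bandA s r (r + 0 + 1))⁻¹ * bandA s r j * bandA s r (r + 0 + 1)
        = (s r)⁻¹ * ((s r)⁻¹ * bandA s r j * s r) * s r := by 
          rw [add_zero, bandA_self]; simp only [pow_two, mul_inv_rev, mul_assoc]
      _ = ((s r)⁻¹ * bandA s r j * s r) * ((s r)⁻¹ * bandA s (r + 1) j * s r) *
            ((s r)⁻¹ * bandA s r j * s r)⁻¹ := by
          conv_lhs => rw [h1]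
          group
      _ = _ := by rw [h1, h2]; group
  | succ d ih =>
    have := congrArg (conj (s (r + d + 1))) (ih (by omega))
    simp only [map_mul, map_inv] at this
    rwa [conj_bandA_snd (by omega), conj_bandA_fst hs (by omega) (by omega) hj,
      conj_eq_of_commute (commute_bandA_of_between hs hr (by omega) (by omega) hj)] at this

theorem inv_conj_bandA_cross {r t i j : ℕ} (hr : 1 ≤ r) (hri : r < i) (hit : i < t) (htj : t < j)
    (hj : j ≤ N) :
    (bandA s r t)⁻¹ * bandA s i j * bandA s r t =
      bandA s r j * bandA s t j * (bandA s r j)⁻¹ * (bandA s t j)⁻¹ * bandA s i j *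
        bandA s t j * bandA s r j * (bandA s t j)⁻¹ * (bandA s r j)⁻¹ := by
  obtain ⟨d, rfl⟩ := Nat.exists_eq_add_of_lt hit
  clear hit
  induction d with
  | zero =>
    rw [add_zero] at *
    have h1 := inv_conj_bandA_fst_self hs (k := i) (by omega) htj hj
    have h2 := inv_conj_bandA_right hs hr hri (by omega : i < j) hj
    have h3 : Commute (bandA s r i) (bandA s (i + 1) j) :=
      commute_bandA_bandA hs (by omega) (by omega) (by omega)
    have h4 := conj_bandA_fst hs (k := i) (by omega) htj hj
    have h5 := conj_bandA_fst_succ hs (k := i) (by omega) htj hj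
    have h6 := conj_eq_of_commute (commute_bandA_of_between hs hr hri htj hj)
    -- A_{r,i+1} is A_{r,i} conjugated by s_i, so the computation takes place inside this
    -- conjugation, where the relation for r < i < j and one commutation suffice.
    calc (bandA s r (i + 1))⁻¹ * bandA s i j * bandA s r (i + 1)
        = conj (s i) ((bandA s r i)⁻¹ * ((s i)⁻¹ * bandA s i j * s i) * bandA s r i) := by
          rw [bandA_succ hri, MulAut.conj_apply]; group
      _ = conj (s i) (((bandA s r i)⁻¹ * bandA s i j * bandA s r i) *
            ((bandA s r i)⁻¹ * bandA s (i + 1) j * bandA s r i) *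
            ((bandA s r i)⁻¹ * bandA s i j * bandA s r i)⁻¹) := by
          rw [h1]; group
      _ = _ := by
          rw [h2, mul_assoc _ _ (bandA s r i), ← h3.eq, inv_mul_cancel_left]
          simp only [map_mul, map_inv, h4, h5, h6]
          group
  | succ d ih =>
    have := congrArg (conj (s (i + d + 1))) (ih (by omega))
    simp only [map_mul, map_inv] at this
    rwa [conj_bandA_snd (by omega), conj_bandA_fst hs (by omega) (by omega) hj,
      conj_eq_of_commute (commute_bandA_of_between hs hr (by omega) (by omega) hj),
      conj_eq_of_commute (commute_bandA_of_between hs (by omega : 1 ≤ i) (by omega) (by omega) hj)]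
      at this

end Band

/-! ## A free action of the pure braids that push one string -/

namespace ArcAction

open FreeGroup (of lift)

/-- The endomorphism `x_k ↦ x_{k+1}`, `x_{k+1} ↦ x_{k+1}⁻¹ x_k x_{k+1}` of the free group. -/
def twistHom (k : ℕ) : FreeGroup ℕ →* FreeGroup ℕ :=
  lift fun i => if i = k then of (k + 1) else
    if i = k + 1 then (of (k + 1))⁻¹ * of k * of (k + 1) else of i

/-- The inverse of `twistHom k`. -/
def untwistHom (k : ℕ) : FreeGroup ℕ →* FreeGroup ℕ :=
  lift fun i => if i = k + 1 then of k else
    if i = k then of k * of (k + 1) * (of k)⁻¹ else of i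

theorem twistHom_left (k : ℕ) : twistHom k (of k) = of (k + 1) := by
  simp [twistHom]

theorem twistHom_right (k : ℕ) :
    twistHom k (of (k + 1)) = (of (k + 1))⁻¹ * of k * of (k + 1) := by
  simp [twistHom]

theorem twistHom_of_ne {k i : ℕ} (h : i ≠ k) (h' : i ≠ k + 1) : twistHom k (of i) = of i := by
  simp [twistHom, h, h']

/-- `twistHom` as an automorphism. -/
def twist (k : ℕ) : MulAut (FreeGroup ℕ) :=
  MonoidHom.toMulEquiv (twistHom k) (untwistHom k)
    (by
      ext i
      by_cases h : i = k
      · subst h; simp [twistHom, untwistHom]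
      by_cases h' : i = k + 1
      · subst h'; simp [twistHom, untwistHom]; group
      · simp [twistHom, untwistHom, h, h'])
    (by
      ext i
      by_cases h : i = k
      · subst h; simp [twistHom, untwistHom]; group
      by_cases h' : i = k + 1
      · subst h'; simp [twistHom, untwistHom]
      · simp [twistHom, untwistHom, h, h'])

theorem twist_left (k : ℕ) : twist k (of k) = of (k + 1) := twistHom_left k

theorem twist_right (k : ℕ) : twist k (of (k + 1)) = (of (k + 1))⁻¹ * of k * of (k + 1) :=
  twistHom_right k

theorem twist_of_ne {k i : ℕ} (h : i ≠ k) (h' : i ≠ k + 1) : twist k (of i) = of i :=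
  twistHom_of_ne h h'

theorem mulAut_ext {f g : MulAut (FreeGroup ℕ)} (h : ∀ i, f (of i) = g (of i)) : f = g := by
  have : f.toMonoidHom = g.toMonoidHom := FreeGroup.ext_hom _ _ h
  ext v
  exact DFunLike.congr_fun this v

theorem twist_braid (k : ℕ) :
    twist k * twist (k + 1) * twist k = twist (k + 1) * twist k * twist (k + 1) := by
  apply mulAut_ext
  intro i
  simp only [MulAut.mul_apply]
  by_cases h : i = k
  · subst h
    rw [twist_left, twist_left, twist_of_ne (by omega) (by omega),
      twist_of_ne (by omega : i ≠ i + 1) (by omega), twist_left, twist_left]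
  by_cases h' : i = k + 1
  · subst h'
    simp only [twist_left, twist_right, map_mul, map_inv,
      twist_of_ne (show k ≠ k + 1 by omega) (show k ≠ k + 1 + 1 by omega),
      twist_of_ne (show k + 1 + 1 ≠ k by omega) (show k + 1 + 1 ≠ k + 1 by omega)]
  by_cases h'' : i = k + 2
  · subst h''
    rw [twist_of_ne (k := k) h h', show k + 2 = k + 1 + 1 from rfl, twist_right]
    simp only [twist_left, twist_right, map_mul, map_inv,
      twist_of_ne (show k ≠ k + 1 by omega) (show k ≠ k + 1 + 1 by omega),
      twist_of_ne (show k + 1 + 1 ≠ k by omega) (show k + 1 + 1 ≠ k + 1 by omega)]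
    group
  · simp only [twist_of_ne h h', twist_of_ne h' h'']

theorem twist_comm {k l : ℕ} (h : k + 2 ≤ l) : twist k * twist l = twist l * twist k := by
  apply mulAut_ext
  intro i
  simp only [MulAut.mul_apply]
  have hk := twist_of_ne (show l ≠ k by omega) (show l ≠ k + 1 by omega)
  have hk' := twist_of_ne (show l + 1 ≠ k by omega) (show l + 1 ≠ k + 1 by omega)
  have hl := twist_of_ne (show k ≠ l by omega) (show k ≠ l + 1 by omega)
  have hl' := twist_of_ne (show k + 1 ≠ l by omega) (show k + 1 ≠ l + 1 by omega)
  by_cases h1 : i = k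
  · subst h1; simp only [twist_left, hl, hl']
  by_cases h2 : i = k + 1
  · subst h2; simp only [twist_right, hl, hl', map_mul, map_inv]
  by_cases h3 : i = l
  · subst h3; simp only [twist_left, hk, hk']
  by_cases h4 : i = l + 1
  · subst h4; simp only [twist_right, hk, hk', map_mul, map_inv]
  simp only [twist_of_ne h1 h2, twist_of_ne h3 h4]

/-- The factor picked up by the arc that ends at the point number `i`. -/
def factor (k i : ℕ) : FreeGroup ℕ := if i = k + 1 then (of (k + 1))⁻¹ else 1

/-- The half twist acting on the arcs `w y_i`. -/
def arcTwist (k : ℕ) : Equiv.Perm (FreeGroup ℕ × ℕ) where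
  -- On the basic arcs y_k ↦ y_{k+1} and y_{k+1} ↦ x_{k+1}⁻¹ y_k. This matches `twist` if x_i is the
  -- loop that follows y_i, circles the point number i and returns.
  toFun p := (twist k p.1 * factor k p.2, Equiv.swap k (k + 1) p.2)
  invFun p := ((twist k).symm (p.1 * (factor k (Equiv.swap k (k + 1) p.2))⁻¹),
    Equiv.swap k (k + 1) p.2)
  left_inv p := by simp
  right_inv p := by simp

theorem arcTwist_left (k : ℕ) (w : FreeGroup ℕ) : arcTwist k (w, k) = (twist k w, k + 1) := by
  simp [arcTwist, factor]

theorem arcTwist_right (k : ℕ) (w : FreeGroup ℕ) :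
    arcTwist k (w, k + 1) = (twist k w * (of (k + 1))⁻¹, k) := by
  simp [arcTwist, factor]

theorem arcTwist_of_ne {k i : ℕ} (h : i ≠ k) (h' : i ≠ k + 1) (w : FreeGroup ℕ) :
    arcTwist k (w, i) = (twist k w, i) := by
  simp [arcTwist, factor, h', Equiv.swap_apply_of_ne_of_ne h h']

/-- Through `exists_braidRep` this makes the combinatorial rule an action of the braid group. -/
theorem isArtinSystem_arcTwist : IsArtinSystem arcTwist Set.univ where
  braid k _ _ := by
    have hb : ∀ w, twist k (twist (k + 1) (twist k w)) =
        twist (k + 1) (twist k (twist (k + 1) w)) := fun w =>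
      DFunLike.congr_fun (twist_braid k) w
    apply Equiv.ext
    rintro ⟨w, i⟩
    simp only [Equiv.Perm.mul_apply]
    have h1 := twist_of_ne (show k ≠ k + 1 by omega) (show k ≠ k + 1 + 1 by omega)
    have h2 := twist_of_ne (show k + 1 + 1 ≠ k by omega) (show k + 1 + 1 ≠ k + 1 by omega)
    have a1 := arcTwist_of_ne (show k ≠ k + 1 by omega) (show k ≠ k + 1 + 1 by omega)
    have a2 := arcTwist_of_ne (show k + 1 + 1 ≠ k by omega) (show k + 1 + 1 ≠ k + 1 by omega)
    by_cases h : i = k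
    · subst h
      simp only [arcTwist_left, a1, a2, hb]
    by_cases h' : i = k + 1
    · subst h'
      simp only [arcTwist_left, arcTwist_right, a1, map_mul, map_inv, twist_left, h2, a2, hb]
    by_cases h'' : i = k + 2
    · subst h''
      rw [show k + 2 = k + 1 + 1 from rfl]
      simp only [arcTwist_right, a1, map_mul, map_inv, twist_left, twist_right, h2, a2, hb]
      group
    · simp only [arcTwist_of_ne h h', arcTwist_of_ne h' h'', hb]
  comm k l _ _ h := by
    have hb : ∀ w, twist k (twist l w) = twist l (twist k w) := fun w =>
      DFunLike.congr_fun (twist_comm h) w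
    apply Equiv.ext
    rintro ⟨w, i⟩
    simp only [Equiv.Perm.mul_apply]
    have hk := twist_of_ne (show l + 1 ≠ k by omega) (show l + 1 ≠ k + 1 by omega)
    have hl' := twist_of_ne (show k + 1 ≠ l by omega) (show k + 1 ≠ l + 1 by omega)
    have b1 := arcTwist_of_ne (show l ≠ k by omega) (show l ≠ k + 1 by omega)
    have b2 := arcTwist_of_ne (show l + 1 ≠ k by omega) (show l + 1 ≠ k + 1 by omega)
    have b3 := arcTwist_of_ne (show k ≠ l by omega) (show k ≠ l + 1 by omega)
    have b4 := arcTwist_of_ne (show k + 1 ≠ l by omega) (show k + 1 ≠ l + 1 by omega)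
    by_cases h1 : i = k
    · subst h1; simp only [arcTwist_left, b3, b4, hb]
    by_cases h2 : i = k + 1
    · subst h2; simp only [arcTwist_right, b3, b4, hb, hl', map_mul, map_inv]
    by_cases h3 : i = l
    · subst h3; simp only [arcTwist_left, b1, b2, hb]
    by_cases h4 : i = l + 1
    · subst h4; simp only [arcTwist_right, b1, b2, hb, hk, map_mul, map_inv]
    simp only [arcTwist_of_ne h1 h2, arcTwist_of_ne h3 h4, hb]

/-- The quotient of the free group in which `x_m` is trivial. -/
def kill (m : ℕ) : FreeGroup ℕ →* FreeGroup ℕ := lift fun i => if i = m then 1 else of i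

theorem kill_self (m : ℕ) : kill m (of m) = 1 := by simp [kill]

theorem kill_of_ne {m i : ℕ} (h : i ≠ m) : kill m (of i) = of i := by simp [kill, h]

/-- The action of `p` on the arcs covers the automorphism `a` of the free group. -/
def Covers (p : Equiv.Perm (FreeGroup ℕ × ℕ)) (a : MulAut (FreeGroup ℕ)) : Prop :=
  ∀ v w i, p (v * w, i) = (a v * (p (w, i)).1, (p (w, i)).2)

theorem Covers.mul {p p' : Equiv.Perm (FreeGroup ℕ × ℕ)} {a a' : MulAut (FreeGroup ℕ)}
    (h : Covers p a) (h' : Covers p' a') : Covers (p * p') (a * a') := by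
  intro v w i
  rw [Equiv.Perm.mul_apply, h', h]
  rfl

theorem Covers.inv {p : Equiv.Perm (FreeGroup ℕ × ℕ)} {a : MulAut (FreeGroup ℕ)}
    (h : Covers p a) : Covers p⁻¹ a⁻¹ := by
  intro v w i
  rw [Equiv.Perm.inv_eq_iff_eq, h, ← MulAut.mul_apply, mul_inv_cancel, MulAut.one_apply]
  simp only [Prod.mk.eta]
  rw [← Equiv.Perm.mul_apply, mul_inv_cancel]
  rfl

theorem covers_arcTwist (k : ℕ) : Covers (arcTwist k) (twist k) := by
  intro v w i
  simp [arcTwist, mul_assoc]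

/-- `p` pushes the point number `m` around the others, along the inverse of the loop `g`. -/
def Pushes (m : ℕ) (p : Equiv.Perm (FreeGroup ℕ × ℕ)) (g : FreeGroup ℕ) : Prop :=
  -- Once the point number m is filled in, the push acts trivially on loops; this condition on `kill
  -- m` is what makes the invariant g multiplicative, with the order reversed.
  ∃ a, Covers p a ∧ (∀ v, kill m (a v) = kill m v) ∧ ∃ w, p (1, m) = (w, m) ∧ kill m w = g

theorem Pushes.one (m : ℕ) : Pushes m 1 1 :=
  ⟨1, fun _ _ _ => rfl, fun _ => rfl, 1, rfl, map_one _⟩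

theorem Pushes.mul {m : ℕ} {p p' : Equiv.Perm (FreeGroup ℕ × ℕ)} {g g' : FreeGroup ℕ}
    (h : Pushes m p g) (h' : Pushes m p' g') : Pushes m (p * p') (g' * g) := by
  obtain ⟨a, ha, hk, w, hw, rfl⟩ := h
  obtain ⟨a', ha', hk', w', hw', rfl⟩ := h'
  refine ⟨a * a', ha.mul ha', fun v => by rw [MulAut.mul_apply, hk, hk'], a w' * w, ?_, ?_⟩
  · rw [Equiv.Perm.mul_apply, hw', ← mul_one w', ha, hw, mul_one]
  · rw [map_mul, hk]

theorem Pushes.inv {m : ℕ} {p : Equiv.Perm (FreeGroup ℕ × ℕ)} {g : FreeGroup ℕ}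
    (h : Pushes m p g) : Pushes m p⁻¹ g⁻¹ := by
  obtain ⟨a, ha, hk, w, hw, rfl⟩ := h
  have hk' : ∀ v, kill m (a⁻¹ v) = kill m v := fun v => by
    rw [← hk, ← MulAut.mul_apply, mul_inv_cancel, MulAut.one_apply]
  refine ⟨a⁻¹, ha.inv, hk', a⁻¹ w⁻¹, ?_, ?_⟩
  · rw [Equiv.Perm.inv_eq_iff_eq, ← mul_one (a⁻¹ w⁻¹), ha, hw, ← MulAut.mul_apply, mul_inv_cancel,
      MulAut.one_apply, inv_mul_cancel]
  · rw [hk', map_inv]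

theorem Pushes.eq_one {m : ℕ} {p : Equiv.Perm (FreeGroup ℕ × ℕ)} {g : FreeGroup ℕ}
    (h : Pushes m p g) (hp : p (1, m) = (1, m)) : g = 1 := by
  obtain ⟨a, _, _, w, hw, rfl⟩ := h
  obtain rfl : 1 = w := congrArg Prod.fst (hp.symm.trans hw)
  exact map_one _

/-- Forgetting the point j before the twist or j + 1 after it leaves only a renumbering, so
triviality modulo `kill` survives conjugation by `twist j`. -/
theorem kill_twist (j : ℕ) (v : FreeGroup ℕ) :
    kill (j + 1) (twist j v) = FreeGroup.map (Equiv.swap j (j + 1)) (kill j v) := by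
  have : (kill (j + 1)).comp (twistHom j) = (FreeGroup.map (Equiv.swap j (j + 1))).comp (kill j) := by
    ext i
    simp only [MonoidHom.comp_apply]
    by_cases h : i = j
    · subst h; rw [twistHom_left, kill_self, kill_self, map_one]
    by_cases h' : i = j + 1
    · subst h'
      rw [twistHom_right, map_mul, map_mul, map_inv, kill_self, kill_of_ne (by omega),
        kill_of_ne (by omega)]
      simp
    · rw [twistHom_of_ne h h', kill_of_ne h, kill_of_ne h']
      simp [Equiv.swap_apply_of_ne_of_ne h h']
  exact DFunLike.congr_fun this v

theorem pushes_bandA {i m : ℕ} (h : i < m) : Pushes m (bandA arcTwist i m) (of i)⁻¹ := by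
  -- The induction on m needs the image of the arc before x_m is killed.
  suffices H : ∃ a, Covers (bandA arcTwist i m) a ∧ (∀ v, kill m (a v) = kill m v) ∧
      bandA arcTwist i m (1, m) = ((of m)⁻¹ * (of i)⁻¹ * of m, m) by
    obtain ⟨a, h1, h2, h3⟩ := H
    refine ⟨a, h1, h2, _, h3, ?_⟩
    rw [map_mul, map_mul, map_inv, map_inv, kill_self, kill_of_ne h.ne]
    simp
  obtain ⟨d, rfl⟩ := Nat.exists_eq_add_of_lt h
  clear h
  induction d with
  | zero =>
    rw [add_zero, bandA_self, pow_two]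
    refine ⟨twist i * twist i, (covers_arcTwist i).mul (covers_arcTwist i), fun v => ?_, ?_⟩
    · have : ((kill (i + 1)).comp (twistHom i)).comp (twistHom i) = kill (i + 1) := by
        ext j
        simp only [MonoidHom.comp_apply]
        by_cases h : j = i
        · subst h
          rw [twistHom_left, twistHom_right, map_mul, map_mul, map_inv, kill_self,
            kill_of_ne (by omega)]
          simp
        by_cases h' : j = i + 1
        · subst h'
          rw [twistHom_right]
          simp only [map_mul, map_inv, twistHom_left, twistHom_right, kill_self]
          simp
        · rw [twistHom_of_ne h h', twistHom_of_ne h h']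
      exact DFunLike.congr_fun this v
    · rw [Equiv.Perm.mul_apply, arcTwist_right, arcTwist_left]
      simp only [map_one, one_mul, map_inv, twist_right]
      simp [mul_assoc]
  | succ d ih =>
    obtain ⟨a, h1, h2, h3⟩ := ih
    rw [← add_assoc, bandA_succ (by omega)]
    set j := i + d + 1 with hj
    refine ⟨twist j * a * (twist j)⁻¹, ((covers_arcTwist j).mul h1).mul (covers_arcTwist j).inv,
      fun v => ?_, ?_⟩
    · rw [MulAut.mul_apply, MulAut.mul_apply, kill_twist, h2, ← kill_twist, ← MulAut.mul_apply,
        mul_inv_cancel, MulAut.one_apply]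
    · have : (arcTwist j)⁻¹ (1, j + 1) = (1, j) := by
        rw [Equiv.Perm.inv_eq_iff_eq, arcTwist_left, map_one]
      rw [Equiv.Perm.mul_apply, Equiv.Perm.mul_apply, this, h3, arcTwist_left]
      simp only [map_mul, map_inv, twist_left, twist_of_ne (show i ≠ j by omega)
        (show i ≠ j + 1 by omega)]

/-- The elements `α i` that push the point number `m` around the point number `i < m` are free
generators. -/
theorem lift_eq_one_of_pushes {G : Type*} [Group G] (ρ : G →* Equiv.Perm (FreeGroup ℕ × ℕ)) {m : ℕ}
    {ι : Type*} (e : ι → ℕ) (he : Function.Injective e) (α : ι → G)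
    (hα : ∀ i, Pushes m (ρ (α i)) (of (e i))⁻¹) (v : FreeGroup ι)
    (hv : ρ (lift α v) (1, m) = (1, m)) :
    v = 1 := by
  -- The inverse absorbs the reversal of order in `Pushes.mul`; the invariant of a word thus
  -- recovers the word.
  have key : ∀ v : FreeGroup ι, Pushes m (ρ (lift α v)) (FreeGroup.map e v)⁻¹ := by
    intro v
    induction v using FreeGroup.induction_on with
    | C1 => simpa using Pushes.one m
    | of i => simpa using hα i
    | inv_of i h => simpa using h.inv
    | mul x y hx hy => simpa using hx.mul hy
  have h2 := inv_eq_one.mp ((key v).eq_one hv)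
  exact FreeGroup.map_injective he (h2.trans (map_one _).symm)

end ArcAction

/-! ## The presented group and its image in a braid group -/

namespace MixedPresentation

open Subgroup

theorem mem_normalizer_closure {G : Type*} [Group G] {S : Set G} {g : G}
    (h : ∀ x ∈ S, g * x * g⁻¹ ∈ closure S ∧ g⁻¹ * x * g ∈ closure S) :
    g ∈ normalizer (closure S : Set G) := by
  rw [mem_normalizer_iff]
  have h1 : closure S ≤ (closure S).comap (MulAut.conj g).toMonoidHom := by
    rw [closure_le]; exact fun x hx => (h x hx).1
  have h2 : closure S ≤ (closure S).comap (MulAut.conj g⁻¹).toMonoidHom := by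
    rw [closure_le]; intro x hx
    show g⁻¹ * x * g⁻¹⁻¹ ∈ closure S
    rw [inv_inv]; exact (h x hx).2
  intro x
  refine ⟨fun hx => h1 hx, fun hx => ?_⟩
  have := h2 hx
  change g⁻¹ * (g * x * g⁻¹) * g⁻¹⁻¹ ∈ closure S at this
  simpa [mul_assoc] using this

/-! ### The defining relations in an Artin system -/

section Images

variable {n : ℕ} {B : Type*} [Group B] {s : ℕ → B}

/-- The images of the generators in a group with Artin generators. -/
def genImage (s : ℕ → B) : MixedGen n → B
  | .sigma k _ _ => s k
  | .pure i j _ => bandA s i j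

theorem lift_sig (k : ℕ) (hk : 1 ≤ k ∧ k < 2 * n) (hn : k ≠ n) :
    FreeGroup.lift (genImage s) (MixedGen.sig k hk hn) = s k :=
  FreeGroup.lift_apply_of

theorem lift_a (i j : ℕ) (h : 1 ≤ i ∧ i < j ∧ j ≤ 2 * n) :
    FreeGroup.lift (genImage s) (MixedGen.a i j h) = bandA s i j :=
  FreeGroup.lift_apply_of

theorem genImage_rel (hs : IsArtinSystem s (adjIndex (n + n))) {u v : FreeGroup (MixedGen n)}
    (h : MixedRel n u v) :
    FreeGroup.lift (genImage s) u = FreeGroup.lift (genImage s) v := by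
  cases h <;> simp only [map_mul, map_inv, map_pow, lift_sig, lift_a]
  case pure_comm r t i j hrs hij h =>
    rw [mul_assoc, ← (commute_bandA_bandA hs (by omega) (by omega) h).eq, inv_mul_cancel_left]
  case pure_snd r t j hrs hsj => exact inv_conj_bandA_right hs hrs.1 hrs.2.1 hsj.2.1 (by omega)
  case pure_fst r t j hrs hrj h => exact inv_conj_bandA_left hs hrs.1 hrs.2.1 h (by omega)
  case pure_cross r t i j hrs hij h =>
    exact inv_conj_bandA_cross hs hrs.1 h.1 h.2.1 h.2.2 (by omega)
  case artin_braid i h => exact hs.braid i ⟨by omega, by omega⟩ ⟨by omega, by omega⟩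
  case artin_comm i j hi hin hj hjn h =>
    exact (hs.commute ⟨hi.1, by omega⟩ ⟨hj.1, by omega⟩ h).eq
  case square i hi hin => exact (bandA_self i).symm
  case conj_far k i j hk hkn hij h =>
    exact (MulAut.conj_apply _ _).symm.trans <| conj_eq_of_commute (commute_bandA_of_ne hs (by omega) (by omega) h)
  case conj_self k hk hkn =>
    rw [bandA_self]
    exact (MulAut.conj_apply _ _).symm.trans <| conj_eq_of_commute ((Commute.refl (s k)).pow_right 2)
  case conj_snd k i hk hkn h =>
    exact (MulAut.conj_apply _ _).symm.trans <| conj_bandA_snd h.2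
  case conj_snd_succ k i hk hkn h =>
    exact (MulAut.conj_apply _ _).symm.trans <| conj_bandA_snd_succ hs h.1 h.2 (by omega)
  case conj_fst k j hk hkn h =>
    exact (MulAut.conj_apply _ _).symm.trans <| conj_bandA_fst hs hk.1 h.1 (by omega)
  case conj_fst_succ k j hk hkn h =>
    exact (MulAut.conj_apply _ _).symm.trans <| conj_bandA_fst_succ hs hk.1 h.1 (by omega)

theorem lift_genImage_mixedRels (hs : IsArtinSystem s (adjIndex (n + n))) :
    ∀ r ∈ mixedRels n, FreeGroup.lift (genImage s) r = 1 := by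
  rintro _ ⟨u, v, h, rfl⟩
  rw [map_mul, map_inv, genImage_rel hs h, mul_inv_cancel]

/-- The homomorphism from the presented group to a group with Artin generators. -/
def toArtin (hs : IsArtinSystem s (adjIndex (n + n))) : PresentedGroup (mixedRels n) →* B :=
  PresentedGroup.toGroup (lift_genImage_mixedRels hs)

end Images

/-! ### The generators of the presented group -/

open Classical in
/-- The generator `σ_k` of the presented group. -/
noncomputable def gs (n k : ℕ) : PresentedGroup (mixedRels n) :=
  if h : (1 ≤ k ∧ k < 2 * n) ∧ k ≠ n then PresentedGroup.of (MixedGen.sigma k h.1 h.2) else 1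

open Classical in
/-- The generator `A_{i,j}` of the presented group. -/
noncomputable def ga (n i j : ℕ) : PresentedGroup (mixedRels n) :=
  if h : 1 ≤ i ∧ i < j ∧ j ≤ 2 * n then PresentedGroup.of (MixedGen.pure i j h) else 1

variable {n : ℕ}

theorem mk_sig {k : ℕ} (hk : 1 ≤ k ∧ k < 2 * n) (hn : k ≠ n) :
    PresentedGroup.mk (mixedRels n) (MixedGen.sig k hk hn) = gs n k := by
  rw [gs, dif_pos ⟨hk, hn⟩]; rfl

theorem mk_a {i j : ℕ} (h : 1 ≤ i ∧ i < j ∧ j ≤ 2 * n) :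
    PresentedGroup.mk (mixedRels n) (MixedGen.a i j h) = ga n i j := by
  rw [ga, dif_pos h]; rfl

theorem mk_eq_of_rel {u v : FreeGroup (MixedGen n)} (h : MixedRel n u v) :
    PresentedGroup.mk (mixedRels n) u = PresentedGroup.mk (mixedRels n) v :=
  PresentedGroup.mk_eq_mk_of_mul_inv_mem ⟨u, v, h, rfl⟩

theorem ga_comm {r t i j : ℕ} (hrs : 1 ≤ r ∧ r < t ∧ t ≤ 2 * n) (hij : 1 ≤ i ∧ i < j ∧ j ≤ 2 * n)
    (h : (i < r ∧ r < t ∧ t < j) ∨ (r < t ∧ t < i ∧ i < j)) :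
    Commute (ga n r t) (ga n i j) := by
  have := mk_eq_of_rel (.pure_comm r t i j hrs hij h)
  simp only [map_mul, map_inv, mk_a] at this
  rw [mul_assoc, inv_mul_eq_iff_eq_mul] at this
  exact this.symm

theorem ga_snd {r t j : ℕ} (hr : 1 ≤ r) (hrt : r < t) (htj : t < j) (hj : j ≤ 2 * n) :
    (ga n r t)⁻¹ * ga n t j * ga n r t = ga n r j * ga n t j * (ga n r j)⁻¹ := by
  have := mk_eq_of_rel (.pure_snd (n := n) r t j (by omega) (by omega))
  simpa only [map_mul, map_inv, mk_a] using this

theorem ga_fst {r t j : ℕ} (hr : 1 ≤ r) (hrt : r < t) (htj : t < j) (hj : j ≤ 2 * n) :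
    (ga n r t)⁻¹ * ga n r j * ga n r t =
      ga n r j * ga n t j * ga n r j * (ga n t j)⁻¹ * (ga n r j)⁻¹ := by
  have := mk_eq_of_rel (.pure_fst (n := n) r t j (by omega) (by omega) htj)
  simpa only [map_mul, map_inv, mk_a] using this

theorem ga_cross {r t i j : ℕ} (hr : 1 ≤ r) (hri : r < i) (hit : i < t) (htj : t < j)
    (hj : j ≤ 2 * n) : (ga n r t)⁻¹ * ga n i j * ga n r t =
      ga n r j * ga n t j * (ga n r j)⁻¹ * (ga n t j)⁻¹ * ga n i j *
        ga n t j * ga n r j * (ga n t j)⁻¹ * (ga n r j)⁻¹ := by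
  have := mk_eq_of_rel (.pure_cross (n := n) r t i j (by omega) (by omega) ⟨hri, hit, htj⟩)
  simpa only [map_mul, map_inv, mk_a] using this

theorem gs_sq {k : ℕ} (hk : 1 ≤ k ∧ k < 2 * n) (hkn : k ≠ n) :
    gs n k ^ 2 = ga n k (k + 1) := by
  have := mk_eq_of_rel (.square k hk hkn)
  simpa only [map_pow, mk_a, mk_sig] using this

/-- The indices of the generators `σ_k` of the mixed braid group. -/
def sigmaIndex (n : ℕ) : Set ℕ := {k | (1 ≤ k ∧ k < n + n) ∧ k ≠ n}

theorem isArtinSystem_gs : IsArtinSystem (gs n) (sigmaIndex n) where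
  braid k h1 h2 := by
    obtain ⟨h1, h1'⟩ := h1
    obtain ⟨h2, h2'⟩ := h2
    have := mk_eq_of_rel (.artin_braid (n := n) k (by omega))
    simpa only [map_mul, mk_sig] using this
  comm k l h1 h2 h := by
    obtain ⟨h1, h1'⟩ := h1
    obtain ⟨h2, h2'⟩ := h2
    have := mk_eq_of_rel (.artin_comm (n := n) k l (by omega) h1' (by omega) h2' (Or.inl h))
    simpa only [map_mul, mk_sig] using this

theorem toArtin_gs {B : Type*} [Group B] {s : ℕ → B} (hs : IsArtinSystem s (adjIndex (n + n)))
    {k : ℕ} (hk : k ∈ sigmaIndex n) : toArtin hs (gs n k) = s k := by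
  obtain ⟨h1, h2⟩ := hk
  rw [gs, dif_pos ⟨by omega, h2⟩]
  exact PresentedGroup.toGroup.of _

theorem toArtin_ga {B : Type*} [Group B] {s : ℕ → B} (hs : IsArtinSystem s (adjIndex (n + n)))
    {i j : ℕ} (h : 1 ≤ i ∧ i < j ∧ j ≤ 2 * n) : toArtin hs (ga n i j) = bandA s i j := by
  rw [ga, dif_pos h]
  exact PresentedGroup.toGroup.of _

/-! ### The pure subgroups -/

/-- The generators `A_{i,j}` with `j ≤ m`. -/
def pureGens (n m : ℕ) : Set (PresentedGroup (mixedRels n)) :=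
  {x | ∃ i j, 1 ≤ i ∧ i < j ∧ j ≤ m ∧ x = ga n i j}

/-- The generators `A_{i,m}`. -/
def pushGens (n m : ℕ) : Set (PresentedGroup (mixedRels n)) :=
  {x | ∃ i, 1 ≤ i ∧ i < m ∧ x = ga n i m}

theorem ga_mem_closure_pushGens {i m : ℕ} (h : 1 ≤ i ∧ i < m) :
    ga n i m ∈ closure (pushGens n m) :=
  subset_closure ⟨i, h.1, h.2, rfl⟩

theorem ga_mem_closure_pureGens {i j m : ℕ} (h : 1 ≤ i ∧ i < j ∧ j ≤ m) :
    ga n i j ∈ closure (pureGens n m) :=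
  subset_closure ⟨i, j, h.1, h.2.1, h.2.2, rfl⟩

/-- The relations describe only g⁻¹ x g. On A_{r,m} and A_{t,m} this is conjugation by A_{r,m}
A_{t,m}, and on A_{i,m} with r < i < t it is conjugation by the commutator of these two; the
remaining A_{i,m} commute with g. Since all conjugators lie in the subgroup, g x g⁻¹ can be solved
for. -/
theorem ga_mem_normalizer {r t m : ℕ} (hr : 1 ≤ r) (hrt : r < t) (htm : t < m) (hm : m ≤ 2 * n) :
    ga n r t ∈ normalizer (closure (pushGens n m) : Set _) := by
  apply mem_normalizer_closure
  rintro _ ⟨i, hi, him, rfl⟩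
  have hmem : ∀ i, 1 ≤ i → i < m → ga n i m ∈ closure (pushGens n m) := fun i h1 h2 =>
    ga_mem_closure_pushGens ⟨h1, h2⟩
  have mr := hmem r hr (by omega)
  have mt := hmem t (by omega) htm
  have mi := hmem i hi him
  have e1 := ga_snd hr hrt htm hm
  have e2 := ga_fst hr hrt htm hm
  generalize hg : ga n r t = g at e1 e2 ⊢
  have e3 : g * ga n r m * g⁻¹ = (ga n t m)⁻¹ * ga n r m * ga n t m := by
    have h : g⁻¹ * ((ga n t m)⁻¹ * ga n r m * ga n t m) * g = ga n r m := by
      calc g⁻¹ * ((ga n t m)⁻¹ * ga n r m * ga n t m) * g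
          = (g⁻¹ * ga n t m * g)⁻¹ * (g⁻¹ * ga n r m * g) * (g⁻¹ * ga n t m * g) := by group
        _ = ga n r m := by rw [e1, e2]; group
    conv_lhs => rw [← h]
    group
  have e4 : g * ga n t m * g⁻¹ =
      (ga n r m * ga n t m)⁻¹ * ga n t m * (ga n r m * ga n t m) := by
    have h : g⁻¹ * ((ga n r m * ga n t m)⁻¹ * ga n t m * (ga n r m * ga n t m)) * g =
        ga n t m := by
      calc g⁻¹ * ((ga n r m * ga n t m)⁻¹ * ga n t m * (ga n r m * ga n t m)) * g
          = ((g⁻¹ * ga n r m * g) * (g⁻¹ * ga n t m * g))⁻¹ * (g⁻¹ * ga n t m * g) *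
              ((g⁻¹ * ga n r m * g) * (g⁻¹ * ga n t m * g)) := by group
        _ = ga n t m := by rw [e1, e2]; group
    conv_lhs => rw [← h]
    group
  have m3 : g * ga n r m * g⁻¹ ∈ closure (pushGens n m) := by
    rw [e3]; exact mul_mem (mul_mem (inv_mem mt) mr) mt
  have m4 : g * ga n t m * g⁻¹ ∈ closure (pushGens n m) := by
    rw [e4]; exact mul_mem (mul_mem (inv_mem (mul_mem mr mt)) mt) (mul_mem mr mt)
  have comm_case : Commute g (ga n i m) →
      g * ga n i m * g⁻¹ ∈ closure (pushGens n m) ∧ g⁻¹ * ga n i m * g ∈ closure (pushGens n m) := by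
    intro h
    rw [h.eq, mul_inv_cancel_right, mul_assoc, ← h.eq, inv_mul_cancel_left]
    exact ⟨mi, mi⟩
  rcases lt_trichotomy i r with h | rfl | h
  · exact comm_case (hg ▸ ga_comm ⟨hr, hrt, by omega⟩ ⟨hi, him, hm⟩ (by omega))
  · refine ⟨m3, ?_⟩
    rw [e2]
    exact mul_mem (mul_mem (mul_mem (mul_mem mr mt) mr) (inv_mem mt)) (inv_mem mr)
  rcases lt_trichotomy i t with h' | rfl | h'
  · have e5 := ga_cross hr h h' htm hm
    rw [hg] at e5
    set c := ga n r m * ga n t m * (ga n r m)⁻¹ * (ga n t m)⁻¹ with hc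
    have mc : c ∈ closure (pushGens n m) := mul_mem (mul_mem (mul_mem mr mt) (inv_mem mr)) (inv_mem mt)
    have e6 : g⁻¹ * ga n i m * g = c * ga n i m * c⁻¹ := by rw [e5, hc]; group
    have mgc : g * c * g⁻¹ ∈ closure (pushGens n m) := by
      have : g * c * g⁻¹ = (g * ga n r m * g⁻¹) * (g * ga n t m * g⁻¹) * (g * ga n r m * g⁻¹)⁻¹ *
          (g * ga n t m * g⁻¹)⁻¹ := by rw [hc]; group
      rw [this]
      exact mul_mem (mul_mem (mul_mem m3 m4) (inv_mem m3)) (inv_mem m4)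
    constructor
    · have : g * ga n i m * g⁻¹ = (g * c * g⁻¹)⁻¹ * ga n i m * (g * c * g⁻¹) := by
        calc g * ga n i m * g⁻¹ = g * (c⁻¹ * (c * ga n i m * c⁻¹) * c) * g⁻¹ := by group
          _ = _ := by rw [← e6]; group
      rw [this]
      exact mul_mem (mul_mem (inv_mem mgc) mi) mgc
    · rw [e6]
      exact mul_mem (mul_mem mc mi) (inv_mem mc)
  · refine ⟨m4, ?_⟩
    rw [e1]
    exact mul_mem (mul_mem mr mt) (inv_mem mr)
  · exact comm_case (hg ▸ ga_comm ⟨hr, hrt, by omega⟩ ⟨hi, him, hm⟩ (by omega))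

theorem closure_pureGens_succ (m : ℕ) :
    closure (pureGens n (m + 1)) = closure (pureGens n m) ⊔ closure (pushGens n (m + 1)) := by
  rw [← Subgroup.closure_union]
  congr 1
  ext x
  constructor
  · rintro ⟨i, j, hi, hij, hj, rfl⟩
    rcases Nat.lt_or_ge j (m + 1) with h | h
    · exact Or.inl ⟨i, j, hi, hij, by omega, rfl⟩
    · obtain rfl : j = m + 1 := by omega
      exact Or.inr ⟨i, hi, hij, rfl⟩
  · rintro (⟨i, j, hi, hij, hj, rfl⟩ | ⟨i, hi, hij, rfl⟩)
    · exact ⟨i, j, hi, hij, by omega, rfl⟩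
    · exact ⟨i, m + 1, hi, hij, le_rfl, rfl⟩

theorem conj_ga_mem {k i j : ℕ} (hk : 1 ≤ k ∧ k < 2 * n) (hkn : k ≠ n)
    (h : 1 ≤ i ∧ i < j ∧ j ≤ 2 * n) :
    gs n k * ga n i j * (gs n k)⁻¹ ∈ closure (pureGens n (2 * n)) := by
  have M : ∀ i j, 1 ≤ i → i < j → j ≤ 2 * n → ga n i j ∈ closure (pureGens n (2 * n)) :=
    fun i j h1 h2 h3 => ga_mem_closure_pureGens ⟨h1, h2, h3⟩
  by_cases c1 : j = k
  · subst c1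
    have := mk_eq_of_rel (.conj_snd j i hk hkn ⟨h.1, h.2.1⟩)
    simp only [map_mul, map_inv, mk_a, mk_sig] at this
    rw [this]
    exact M _ _ h.1 (by omega) (by omega)
  by_cases c2 : j = k + 1
  · subst c2
    rcases Nat.lt_or_ge i k with c3 | c3
    · have := mk_eq_of_rel (.conj_snd_succ k i hk hkn ⟨h.1, c3⟩)
      simp only [map_mul, map_inv, mk_a, mk_sig] at this
      rw [this]
      exact mul_mem (mul_mem (inv_mem (M _ _ h.1 (by omega) (by omega)))
        (M _ _ h.1 (by omega) (by omega))) (M _ _ h.1 (by omega) (by omega))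
    · obtain rfl : i = k := by omega
      have := mk_eq_of_rel (.conj_self i hk hkn)
      simp only [map_mul, map_inv, mk_a, mk_sig] at this
      rw [this]
      exact M _ _ h.1 (by omega) (by omega)
  by_cases c3 : i = k
  · subst c3
    have := mk_eq_of_rel (.conj_fst i j hk hkn (by omega))
    simp only [map_mul, map_inv, mk_a, mk_sig] at this
    rw [this]
    exact M _ _ (by omega) (by omega) (by omega)
  by_cases c4 : i = k + 1
  · subst c4
    have := mk_eq_of_rel (.conj_fst_succ k j hk hkn (by omega))
    simp only [map_mul, map_inv, mk_a, mk_sig] at this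
    rw [this]
    exact mul_mem (mul_mem (inv_mem (M _ _ (by omega) (by omega) (by omega)))
      (M _ _ (by omega) (by omega) (by omega))) (M _ _ (by omega) (by omega) (by omega))
  · have := mk_eq_of_rel (.conj_far k i j hk hkn h (by omega))
    simp only [map_mul, map_inv, mk_a, mk_sig] at this
    rw [this]
    exact M _ _ h.1 h.2.1 h.2.2

theorem closure_generators :
    closure (gs n '' sigmaIndex n ∪ pureGens n (2 * n)) = ⊤ := by
  rw [eq_top_iff, ← PresentedGroup.closure_range_of, closure_le]
  rintro _ ⟨x, rfl⟩
  apply Subgroup.subset_closure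
  cases x with
  | sigma k hk hn => exact Or.inl ⟨k, ⟨by omega, hn⟩, by rw [gs, dif_pos ⟨hk, hn⟩]⟩
  | pure i j h => exact Or.inr ⟨i, j, h.1, h.2.1, h.2.2, by rw [ga, dif_pos h]⟩

instance normal_closure_pureGens : (closure (pureGens n (2 * n))).Normal := by
  rw [← normalizer_eq_top_iff, eq_top_iff, ← closure_generators, closure_le, Set.union_subset_iff]
  constructor
  · rintro _ ⟨k, ⟨hk, hkn⟩, rfl⟩
    apply mem_normalizer_closure
    rintro _ ⟨i, j, h1, h2, h3, rfl⟩
    have hc := conj_ga_mem (k := k) (by omega) hkn ⟨h1, h2, h3⟩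
    refine ⟨hc, ?_⟩
    -- The relations give conjugation by σ_k only; conjugation by σ_k⁻¹ differs from it by σ_k²,
    -- which is one of the A_{i,j}.
    have hsq : gs n k ^ 2 ∈ closure (pureGens n (2 * n)) := by
      rw [gs_sq (by omega) hkn]
      exact ga_mem_closure_pureGens (by omega)
    have : (gs n k)⁻¹ * ga n i j * gs n k =
        (gs n k ^ 2)⁻¹ * (gs n k * ga n i j * (gs n k)⁻¹) * gs n k ^ 2 := by
      simp [pow_two, mul_assoc]
    rw [this]
    exact mul_mem (mul_mem (inv_mem hsq) hc) hsq
  · exact Subgroup.subset_closure.trans le_normalizer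

/-! ### The image in the braid group -/

/-- A descent at m would place a value of the second block before a value of the first. Hence
reduced words of block permutations avoid the letter m. -/
theorem isDescent_youngSubgroup {m k : ℕ} {w : Equiv.Perm (Fin (m + m))}
    (hw : w ∈ youngSubgroup m m) (hk : IsDescent w k) : k ∈ sigmaIndex m := by
  refine ⟨hk.mem, ?_⟩
  rintro rfl
  obtain ⟨i, j, hij, hj, hi⟩ := hk
  have h1 := hw i
  have h2 := hw j
  rw [Fin.lt_def] at hij
  omega

theorem adj_mem_youngSubgroup {m k : ℕ} (hk : k ∈ sigmaIndex m) :
    adj (m + m) k ∈ youngSubgroup m m := by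
  rw [adj, dif_pos hk.1]
  exact adjSwap_mem_youngSubgroup m m k hk.1 hk.2

variable {B : Type*} [Group B] {s : ℕ → B} (hs : IsArtinSystem s (adjIndex (n + n)))
  (perm : B →* Equiv.Perm (Fin (n + n))) (hperm : ∀ k ∈ adjIndex (n + n), perm (s k) = adj (n + n) k)

include hperm in
theorem perm_bandA {i j : ℕ} (h : 1 ≤ i ∧ i < j ∧ j ≤ 2 * n) : perm (bandA s i j) = 1 := by
  rw [bandA, map_mul, map_mul, map_pow, map_inv, hperm i ⟨h.1, by omega⟩, pow_two, adj_mul_self,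
    mul_one, mul_inv_cancel]

include hperm in
-- Modulo the A_{i,j} the σ_k become involutions that generate and satisfy Artin's relations, so
-- `injective_of_involutions` applies to the quotient.
theorem mem_closure_pureGens (g : PresentedGroup (mixedRels n)) (hg : perm (toArtin hs g) = 1) :
    g ∈ closure (pureGens n (2 * n)) := by
  have hle : closure (pureGens n (2 * n)) ≤ (perm.comp (toArtin hs)).ker := by
    rw [closure_le]
    rintro _ ⟨i, j, h1, h2, h3, rfl⟩
    show perm (toArtin hs (ga n i j)) = 1
    rw [toArtin_ga hs ⟨h1, h2, h3⟩, perm_bandA perm hperm ⟨h1, h2, h3⟩]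
  set π := QuotientGroup.mk' (closure (pureGens n (2 * n))) with hπ
  have hinj := injective_of_involutions (isArtinSystem_gs.map π) (H := youngSubgroup n n)
    (fun w hw k hk => isDescent_youngSubgroup hw hk) (fun k hk => adj_mem_youngSubgroup hk)
    (fun k hk => hk.1) ?_ ?_ (QuotientGroup.lift _ (perm.comp (toArtin hs)) hle) ?_
  · rw [← QuotientGroup.eq_one_iff]
    apply hinj
    rw [map_one]
    exact hg
  · intro k hk
    rw [← map_mul, ← pow_two, gs_sq (by have := hk.1; omega) hk.2]
    exact (QuotientGroup.eq_one_iff _).mpr (ga_mem_closure_pureGens (by have := hk.1; omega))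
  · rw [← Set.image_image π (gs n), ← MonoidHom.map_closure, eq_top_iff]
    have htop : (⊤ : Subgroup (PresentedGroup (mixedRels n))) =
        closure (gs n '' sigmaIndex n) ⊔ closure (pureGens n (2 * n)) := by
      rw [← Subgroup.closure_union, closure_generators]
    have hker : (closure (pureGens n (2 * n))).map π = ⊥ := by
      rw [Subgroup.map_eq_bot_iff, hπ, QuotientGroup.ker_mk']
    calc (⊤ : Subgroup _) = (⊤ : Subgroup (PresentedGroup (mixedRels n))).map π :=
          (Subgroup.map_top_of_surjective _ (QuotientGroup.mk'_surjective _)).symm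
      _ = (closure (gs n '' sigmaIndex n)).map π := by rw [htop, Subgroup.map_sup, hker, sup_bot_eq]
      _ ≤ _ := le_rfl
  · intro k hk
    show perm (toArtin hs (gs n k)) = _
    rw [toArtin_gs hs hk, hperm k hk.1]

open ArcAction in
/-- Artin's combing: a pure word that acts trivially is trivial. -/
theorem eq_one_of_mem_closure_pureGens (ρ : B →* Equiv.Perm (FreeGroup ℕ × ℕ))
    (hρ : ∀ k ∈ adjIndex (n + n), ρ (s k) = arcTwist k) (m : ℕ) (hm : m ≤ 2 * n) :
    ∀ g ∈ closure (pureGens n m), ρ (toArtin hs g) = 1 → g = 1 := by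
  have hband : ∀ i j, 1 ≤ i → i < j → j ≤ 2 * n →
      ρ (toArtin hs (ga n i j)) = bandA arcTwist i j := by
    intro i j h1 h2 h3
    rw [toArtin_ga hs ⟨h1, h2, h3⟩, map_bandA, bandA, bandA, hρ i ⟨h1, by omega⟩]
    have : List.map (fun k => ρ (s k)) (List.Ico (i + 1) j).reverse =
        List.map arcTwist (List.Ico (i + 1) j).reverse := by
      apply List.map_congr_left
      intro k hk
      rw [List.mem_reverse, List.Ico.mem] at hk
      exact hρ k ⟨by omega, by omega⟩
    rw [this]
  induction m with
  | zero =>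
    intro g hg _
    have : pureGens n 0 = ∅ := by
      rw [Set.eq_empty_iff_forall_notMem]
      rintro _ ⟨i, j, h1, h2, h3, _⟩
      omega
    rwa [this, Subgroup.closure_empty, mem_bot] at hg
  | succ m ih =>
    intro g hg hg1
    -- Normalisation lets every pure word be written as p u, with u in the subgroup generated by the
    -- A_{i,m+1}.
    have hle : closure (pureGens n m) ≤ normalizer (closure (pushGens n (m + 1)) : Set _) := by
      rw [closure_le]
      rintro _ ⟨i, j, h1, h2, h3, rfl⟩
      exact ga_mem_normalizer h1 h2 (by omega) hm
    rw [closure_pureGens_succ, ← SetLike.mem_coe, coe_mul_of_left_le_normalizer_right _ _ hle] at hg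
    obtain ⟨p, hp, u, hu, rfl⟩ := hg
    -- The factor p involves only half twists among the points 1, …, m, which do not touch the arc
    -- to the point m + 1.
    have hfix : closure (pureGens n m) ≤
        (MulAction.stabilizer (Equiv.Perm (FreeGroup ℕ × ℕ)) ((1, m + 1) : FreeGroup ℕ × ℕ)).comap
          (ρ.comp (toArtin hs)) := by
      rw [closure_le]
      rintro _ ⟨i, j, h1, h2, h3, rfl⟩
      show ρ (toArtin hs (ga n i j)) ∈ MulAction.stabilizer _ _
      rw [hband i j h1 h2 (by omega)]
      refine (closure_le _).mpr ?_ (bandA_mem_closure h2)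
      rintro _ ⟨k, ⟨hk1, hk2⟩, rfl⟩
      show arcTwist k (1, m + 1) = (1, m + 1)
      rw [arcTwist_of_ne (by omega) (by omega), map_one]
    have hp1 : ρ (toArtin hs p) (1, m + 1) = (1, m + 1) := hfix hp
    have hu1 : ρ (toArtin hs u) (1, m + 1) = (1, m + 1) := by
      rw [map_mul, map_mul] at hg1
      apply (ρ (toArtin hs p)).injective
      rw [hp1]
      exact DFunLike.congr_fun hg1 (1, m + 1)
    -- Then u fixes that arc too. Written as a word in the A_{i,m+1}, it pushes the point m + 1
    -- along a loop that spells the word, so the word is trivial.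
    have hu' : u = 1 := by
      let α : {i : ℕ // 1 ≤ i ∧ i < m + 1} → PresentedGroup (mixedRels n) := fun i => ga n i (m + 1)
      have hrange : closure (pushGens n (m + 1)) ≤ (FreeGroup.lift α).range := by
        rw [FreeGroup.range_lift_eq_closure]
        apply Subgroup.closure_mono
        rintro _ ⟨i, h1, h2, rfl⟩
        exact ⟨⟨i, h1, h2⟩, rfl⟩
      obtain ⟨v, rfl⟩ := hrange hu
      rw [lift_eq_one_of_pushes (ρ.comp (toArtin hs)) Subtype.val Subtype.val_injective α
        (fun i => ?_) v hu1, map_one]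
      show Pushes _ (ρ (toArtin hs (ga n i (m + 1)))) _
      rw [hband i (m + 1) i.2.1 i.2.2 hm]
      exact pushes_bandA i.2.2
    subst hu'
    simp only [mul_one] at hg1 ⊢
    exact ih (by omega) p hp hg1

open ArcAction in
include hperm in
theorem toArtin_injective (ρ : B →* Equiv.Perm (FreeGroup ℕ × ℕ))
    (hρ : ∀ k ∈ adjIndex (n + n), ρ (s k) = arcTwist k) : Function.Injective (toArtin hs) := by
  rw [injective_iff_map_eq_one]
  intro g hg
  refine eq_one_of_mem_closure_pureGens hs ρ hρ (2 * n) le_rfl g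
    (mem_closure_pureGens hs perm hperm g ?_) ?_
  · rw [hg, map_one]
  · rw [hg, map_one]

/-- The elements `A_{i,j}` of a group with Artin generators. -/
def bandGens (s : ℕ → B) (N : ℕ) : Set B :=
  {x | ∃ i j, 1 ≤ i ∧ i < j ∧ j ≤ N ∧ x = bandA s i j}

/-- The counterpart of `normal_closure_pureGens` in the target, where conjugation by `s n` must be
allowed for as well when N = 2n. -/
theorem normal_closure_bandGens {N : ℕ} {s : ℕ → B} (hs : IsArtinSystem s (adjIndex N))
    (hgen : closure (s '' adjIndex N) = ⊤) : (closure (bandGens s N)).Normal := by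
  have M : ∀ i j, 1 ≤ i → i < j → j ≤ N → bandA s i j ∈ closure (bandGens s N) :=
    fun i j h1 h2 h3 => subset_closure ⟨i, j, h1, h2, h3, rfl⟩
  have hconj : ∀ k i j, 1 ≤ k ∧ k < N → 1 ≤ i ∧ i < j ∧ j ≤ N →
      s k * bandA s i j * (s k)⁻¹ ∈ closure (bandGens s N) := by
    intro k i j hk h
    rw [← MulAut.conj_apply]
    by_cases c1 : j = k
    · subst c1
      rw [conj_bandA_snd h.2.1]
      exact M _ _ h.1 (by omega) (by omega)
    by_cases c2 : j = k + 1
    · subst c2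
      rcases Nat.lt_or_ge i k with c3 | c3
      · rw [conj_bandA_snd_succ hs h.1 c3 hk.2]
        exact mul_mem (mul_mem (inv_mem (M _ _ h.1 (by omega) (by omega)))
          (M _ _ h.1 (by omega) (by omega))) (M _ _ h.1 (by omega) (by omega))
      · obtain rfl : i = k := by omega
        rw [bandA_self, conj_eq_of_commute ((Commute.refl (s i)).pow_right 2), ← bandA_self]
        exact M _ _ h.1 (by omega) (by omega)
    by_cases c3 : i = k
    · subst c3
      rw [conj_bandA_fst hs hk.1 (by omega) h.2.2]
      exact M _ _ (by omega) (by omega) (by omega)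
    by_cases c4 : i = k + 1
    · subst c4
      rw [conj_bandA_fst_succ hs hk.1 (by omega) h.2.2]
      exact mul_mem (mul_mem (inv_mem (M _ _ (by omega) (by omega) (by omega)))
        (M _ _ (by omega) (by omega) (by omega))) (M _ _ (by omega) (by omega) (by omega))
    · rw [conj_eq_of_commute (commute_bandA_of_ne hs hk h (by omega))]
      exact M _ _ h.1 h.2.1 h.2.2
  rw [← normalizer_eq_top_iff, eq_top_iff, ← hgen, closure_le]
  rintro _ ⟨k, hk, rfl⟩
  apply mem_normalizer_closure
  rintro _ ⟨i, j, h1, h2, h3, rfl⟩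
  have hc := hconj k i j hk ⟨h1, h2, h3⟩
  refine ⟨hc, ?_⟩
  have hsq : s k ^ 2 ∈ closure (bandGens s N) := by
    rw [← bandA_self]
    exact M _ _ hk.1 (by omega) hk.2
  have : (s k)⁻¹ * bandA s i j * s k = (s k ^ 2)⁻¹ * (s k * bandA s i j * (s k)⁻¹) * s k ^ 2 := by
    simp [pow_two, mul_assoc]
  rw [this]
  exact mul_mem (mul_mem (inv_mem hsq) hc) hsq

include hperm in
-- Divide b by the Matsumoto lift of its permutation. The lift is a word in the `s k` with k ≠ n,
-- and the quotient has trivial permutation, hence is a word in the A_{i,j} by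
-- `injective_of_involutions` modulo these.
theorem mem_range_toArtin (hgen : closure (s '' adjIndex (n + n)) = ⊤) {b : B}
    (hb : perm b ∈ youngSubgroup n n) : b ∈ (toArtin (n := n) hs).range := by
  have hnormal := normal_closure_bandGens hs hgen
  have hle : closure (bandGens s (n + n)) ≤ perm.ker := by
    rw [closure_le]
    rintro _ ⟨i, j, h1, h2, h3, rfl⟩
    exact perm_bandA perm hperm (by omega)
  set π := QuotientGroup.mk' (closure (bandGens s (n + n))) with hπ
  have hinj := injective_of_involutions (hs.map π) (H := ⊤)
    (fun w hw k hk => hk.mem) (fun k hk => mem_top _)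
    le_rfl ?_ ?_ (QuotientGroup.lift _ perm hle) hperm
  · have h1 : b * (permSection s (perm b))⁻¹ ∈ closure (bandGens s (n + n)) := by
      rw [← QuotientGroup.eq_one_iff]
      apply hinj
      rw [map_one]
      show perm (b * (permSection s (perm b))⁻¹) = 1
      rw [map_mul, map_inv, map_permSection (H := youngSubgroup n n) (K := sigmaIndex n) perm
        (fun k hk => hperm k hk.1) (fun w hw k hk => isDescent_youngSubgroup hw hk)
        (fun k hk => adj_mem_youngSubgroup hk) _ hb, mul_inv_cancel]
    have h2 : closure (bandGens s (n + n)) ≤ (toArtin (n := n) hs).range := by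
      rw [closure_le]
      rintro _ ⟨i, j, h1, h2, h3, rfl⟩
      exact ⟨ga n i j, toArtin_ga hs (by omega)⟩
    have h3 : permSection s (perm b) ∈ (toArtin (n := n) hs).range := by
      refine (closure_le _).mpr ?_ (permSection_mem_closure (K := sigmaIndex n)
        (fun w hw k hk => isDescent_youngSubgroup hw hk) (fun k hk => adj_mem_youngSubgroup hk) _ hb)
      rintro _ ⟨k, hk, rfl⟩
      exact ⟨gs n k, toArtin_gs hs hk⟩
    simpa using mul_mem (h2 h1) h3
  · intro k hk
    rw [← map_mul, ← pow_two, ← bandA_self]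
    exact (QuotientGroup.eq_one_iff _).mpr
      (subset_closure ⟨k, k + 1, hk.1, by omega, hk.2, rfl⟩)
  · rw [← Set.image_image π s, ← MonoidHom.map_closure, hgen,
      Subgroup.map_top_of_surjective _ (QuotientGroup.mk'_surjective _)]

end MixedPresentation

/-! ## Convex families of configurations -/

section ConvexConfigurations

open unitInterval

variable {N : ℕ}

instance : ContinuousConstSMul (Equiv.Perm (Fin N)) (OrdConf N (ℝ × ℝ)) where
  continuous_const_smul h := by
    have : Continuous fun x : OrdConf N (ℝ × ℝ) => fun i => x.1 (h⁻¹ i) :=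
      continuous_pi fun i => (continuous_apply (h⁻¹ i)).comp continuous_subtype_val
    exact Continuous.subtype_mk this _

/-- A set of configurations that contains the straight homotopy between any two of its members. -/
def IsConvexConf (K : Set (OrdConf N (ℝ × ℝ))) : Prop :=
  ∀ x ∈ K, ∀ y ∈ K, ∀ t : I, ∃ z ∈ K, z.1 = AffineMap.lineMap x.1 y.1 (t : ℝ)

/-- Straight motion leads from one configuration to the other without collisions. -/
def Joinable (x y : OrdConf N (ℝ × ℝ)) : Prop :=
  ∀ t : I, Function.Injective (AffineMap.lineMap x.1 y.1 (t : ℝ) : Fin N → ℝ × ℝ)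

theorem IsConvexConf.joinable {K : Set (OrdConf N (ℝ × ℝ))} (hK : IsConvexConf K)
    {x y : OrdConf N (ℝ × ℝ)} (hx : x ∈ K) (hy : y ∈ K) : Joinable x y := fun t => by
  obtain ⟨z, -, hz⟩ := hK x hx y hy t
  exact hz ▸ z.2

/-- The straight motion. -/
noncomputable def straightPath {x y : OrdConf N (ℝ × ℝ)} (h : Joinable x y) : Path x y where
  toFun t := ⟨AffineMap.lineMap x.1 y.1 (t : ℝ), h t⟩
  continuous_toFun := by
    refine Continuous.subtype_mk ?_ _
    simp only [AffineMap.lineMap_apply_module]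
    fun_prop
  source' := Subtype.ext (by simp)
  target' := Subtype.ext (by simp)

theorem IsConvexConf.straightPath_mem {K : Set (OrdConf N (ℝ × ℝ))} (hK : IsConvexConf K)
    {x y : OrdConf N (ℝ × ℝ)} (hx : x ∈ K) (hy : y ∈ K) (h : Joinable x y) (t : I) :
    straightPath h t ∈ K := by
  obtain ⟨z, hzK, hz⟩ := hK x hx y hy t
  have : straightPath h t = z := Subtype.ext hz.symm
  rwa [this]

/-- The straight homotopy stays in K and so avoids collisions: inside K only the endpoints of a
motion matter. -/
theorem IsConvexConf.homotopic {K : Set (OrdConf N (ℝ × ℝ))} (hK : IsConvexConf K)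
    {x y : OrdConf N (ℝ × ℝ)} (p q : Path x y) (hp : ∀ t, p t ∈ K) (hq : ∀ t, q t ∈ K) :
    p.Homotopic q := by
  have hinj : ∀ a : I × I, Function.Injective
      (AffineMap.lineMap (p a.2).1 (q a.2).1 (a.1 : ℝ) : Fin N → ℝ × ℝ) := fun a => by
    obtain ⟨z, -, hz⟩ := hK _ (hp a.2) _ (hq a.2) a.1
    exact hz ▸ z.2
  refine ⟨⟨⟨⟨fun a => ⟨_, hinj a⟩, ?_⟩, ?_, ?_⟩, ?_⟩⟩
  · refine Continuous.subtype_mk ?_ _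
    simp only [AffineMap.lineMap_apply_module]
    have h1 : Continuous fun a : I × I => (p a.2).1 :=
      continuous_subtype_val.comp (p.continuous.comp continuous_snd)
    have h2 : Continuous fun a : I × I => (q a.2).1 :=
      continuous_subtype_val.comp (q.continuous.comp continuous_snd)
    fun_prop
  · intro t
    exact Subtype.ext (by simp)
  · intro t
    exact Subtype.ext (by simp)
  · rintro t s (rfl | rfl)
    · refine Subtype.ext ?_
      change AffineMap.lineMap (p 0).1 (q 0).1 (t : ℝ) = (p 0).1
      simp
    · refine Subtype.ext ?_
      change AffineMap.lineMap (p 1).1 (q 1).1 (t : ℝ) = (p 1).1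
      simp

/-- The configurations with prescribed regions for the differences of their points. -/
def coneConf (C : Fin N → Fin N → Set (ℝ × ℝ)) : Set (OrdConf N (ℝ × ℝ)) :=
  {x | ∀ i j, x.1 j - x.1 i ∈ C i j}

/-- Differences of points interpolate linearly; for each pair it is enough that one of the two
regions misses 0. -/
theorem isConvexConf_coneConf {C : Fin N → Fin N → Set (ℝ × ℝ)}
    (hC : ∀ i j, Convex ℝ (C i j)) (h0 : ∀ i j, i ≠ j → 0 ∉ C i j ∨ 0 ∉ C j i) :
    IsConvexConf (coneConf C) := by
  intro x hx y hy t
  set z : Fin N → ℝ × ℝ := AffineMap.lineMap x.1 y.1 (t : ℝ) with hz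
  have hmem : ∀ i j, z j - z i ∈ C i j := by
    intro i j
    have := (hC i j) (hx i j) (hy i j) (sub_nonneg.2 t.2.2) t.2.1 (sub_add_cancel 1 (t : ℝ))
    convert this using 1
    simp only [hz, AffineMap.lineMap_apply_module, Pi.add_apply, Pi.smul_apply, smul_sub]
    abel
  have hinj : Function.Injective z := by
    intro i j hij
    by_contra hne
    rcases h0 i j hne with h | h
    · exact h (by simpa [hij] using hmem i j)
    · exact h (by simpa [hij] using hmem j i)
  exact ⟨⟨z, hinj⟩, hmem, rfl⟩

/-- The vectors that point to the right, or vertically upwards. -/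
def lexCone : Set (ℝ × ℝ) := {v | 0 < v.1 ∨ (v.1 = 0 ∧ 0 < v.2)}

/-- The vectors that point upwards, or horizontally to the left. -/
def turnedLexCone : Set (ℝ × ℝ) := {v | 0 < v.2 ∨ (v.2 = 0 ∧ v.1 < 0)}

theorem convex_lexCone : Convex ℝ lexCone := by
  rw [convex_iff_forall_pos]
  rintro x hx y hy a b ha hb -
  simp only [lexCone, Set.mem_ofPred_eq, Prod.fst_add, Prod.snd_add, Prod.smul_fst, Prod.smul_snd,
    smul_eq_mul] at hx hy ⊢
  rcases hx with hx | ⟨hx, hx'⟩ <;> rcases hy with hy | ⟨hy, hy'⟩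
  · left; positivity
  · left; rw [hy]; simp only [mul_zero, add_zero]; positivity
  · left; rw [hx]; simp only [mul_zero, zero_add]; positivity
  · right; exact ⟨by rw [hx, hy]; simp, by positivity⟩

theorem convex_turnedLexCone : Convex ℝ turnedLexCone := by
  rw [convex_iff_forall_pos]
  rintro x hx y hy a b ha hb -
  simp only [turnedLexCone, Set.mem_ofPred_eq, Prod.fst_add, Prod.snd_add, Prod.smul_fst,
    Prod.smul_snd, smul_eq_mul] at hx hy ⊢
  rcases hx with hx | ⟨hx, hx'⟩ <;> rcases hy with hy | ⟨hy, hy'⟩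
  · left; positivity
  · left; rw [hy]; simp only [mul_zero, add_zero]; positivity
  · left; rw [hx]; simp only [mul_zero, zero_add]; positivity
  · right; exact ⟨by rw [hx, hy]; simp, by
      nlinarith [mul_pos ha (neg_pos.2 hx'), mul_pos hb (neg_pos.2 hy')]⟩

theorem convex_fst_pos : Convex ℝ {v : ℝ × ℝ | 0 < v.1} :=
  (convex_Ioi (0 : ℝ)).is_linear_preimage (LinearMap.fst ℝ ℝ ℝ).isLinear

theorem convex_snd_pos : Convex ℝ {v : ℝ × ℝ | 0 < v.2} :=
  (convex_Ioi (0 : ℝ)).is_linear_preimage (LinearMap.snd ℝ ℝ ℝ).isLinear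

theorem zero_notMem_lexCone : (0 : ℝ × ℝ) ∉ lexCone := by simp [lexCone]

theorem zero_notMem_turnedLexCone : (0 : ℝ × ℝ) ∉ turnedLexCone := by simp [turnedLexCone]

/-! ### The lexicographic order of the points -/

/-- The order of the plane from left to right, and upwards on vertical lines. -/
def LexLT (p q : ℝ × ℝ) : Prop := p.1 < q.1 ∨ (p.1 = q.1 ∧ p.2 < q.2)

theorem lexLT_iff {p q : ℝ × ℝ} : LexLT p q ↔ q - p ∈ lexCone := by
  simp only [LexLT, lexCone, Set.mem_ofPred_eq, Prod.fst_sub, Prod.snd_sub, sub_pos, sub_eq_zero]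
  rw [eq_comm (a := p.1)]

theorem lexLT_iff_toLex {p q : ℝ × ℝ} : LexLT p q ↔ toLex p < toLex q :=
  Prod.Lex.toLex_lt_toLex.symm

/-- The permutation that sends each index to the position of its point in the lexicographic
order. -/
noncomputable def OrdConf.rank (x : OrdConf N (ℝ × ℝ)) : Equiv.Perm (Fin N) :=
  (Tuple.sort fun i => toLex (x.1 i))⁻¹

theorem OrdConf.rank_lt_iff (x : OrdConf N (ℝ × ℝ)) (i j : Fin N) :
    x.rank i < x.rank j ↔ LexLT (x.1 i) (x.1 j) := by
  have hm : StrictMono ((fun i => toLex (x.1 i)) ∘ Tuple.sort fun i => toLex (x.1 i)) :=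
    (Tuple.monotone_sort _).strictMono_of_injective
      ((toLex.injective.comp x.2).comp (Equiv.injective _))
  have := hm.lt_iff_lt (a := x.rank i) (b := x.rank j)
  rw [← this, lexLT_iff_toLex]
  simp [OrdConf.rank]

theorem OrdConf.eq_rank {x : OrdConf N (ℝ × ℝ)} {w : Equiv.Perm (Fin N)}
    (h : ∀ i j, w i < w j → LexLT (x.1 i) (x.1 j)) : w = x.rank := by
  have h' : StrictMono (x.rank * w⁻¹) := fun a b hab => by
    rw [Equiv.Perm.mul_apply, Equiv.Perm.mul_apply, x.rank_lt_iff]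
    exact h _ _ (by simpa using hab)
  have h1 : (x.rank * w⁻¹ : Equiv.Perm (Fin N)) = 1 :=
    Equiv.ext fun a => by
      have := StrictMono.range_inj h' (strictMono_id (α := Fin N))
      rw [(Equiv.surjective _).range_eq, Set.range_id] at this
      exact congrFun (this.1 rfl) a
  exact (mul_inv_eq_one.1 h1).symm

theorem OrdConf.rank_eq_iff {x : OrdConf N (ℝ × ℝ)} {w : Equiv.Perm (Fin N)} :
    x.rank = w ↔ ∀ i j, w i < w j → LexLT (x.1 i) (x.1 j) :=
  ⟨fun h i j hij => (x.rank_lt_iff i j).1 (h ▸ hij), fun h => (OrdConf.eq_rank h).symm⟩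

theorem OrdConf.rank_smul (h : Equiv.Perm (Fin N)) (x : OrdConf N (ℝ × ℝ)) :
    (h • x).rank = x.rank * h⁻¹ := by
  rw [OrdConf.rank_eq_iff]
  intro i j hij
  exact (x.rank_lt_iff _ _).1 hij

theorem rank_baseConf : (baseConf N).rank = 1 := by
  rw [OrdConf.rank_eq_iff]
  intro i j hij
  left
  have : (i : ℝ) < (j : ℝ) := by exact_mod_cast hij
  change (i : ℝ) + 1 < (j : ℝ) + 1
  linarith

/-- The configurations with a given lexicographic order. -/
def lexChamber (w : Equiv.Perm (Fin N)) : Set (OrdConf N (ℝ × ℝ)) :=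
  coneConf fun i j => if w i < w j then lexCone else Set.univ

theorem mem_lexChamber {w : Equiv.Perm (Fin N)} {x : OrdConf N (ℝ × ℝ)} :
    x ∈ lexChamber w ↔ x.rank = w := by
  rw [OrdConf.rank_eq_iff]
  refine forall_congr' fun i => forall_congr' fun j => ?_
  by_cases h : w i < w j
  · simp [h, lexLT_iff]
  · simp [h]

theorem isConvexConf_lexChamber (w : Equiv.Perm (Fin N)) : IsConvexConf (lexChamber w) := by
  refine isConvexConf_coneConf (fun i j => ?_) fun i j hij => ?_
  · split_ifs
    exacts [convex_lexCone, convex_univ]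
  · rcases lt_or_gt_of_ne (w.injective.ne hij) with h | h
    · left; rw [if_pos h]; exact zero_notMem_lexCone
    · right; rw [if_pos h]; exact zero_notMem_lexCone

end ConvexConfigurations

/-! ## The braid traced by a motion -/

namespace Path.Homotopic.Quotient

variable {X : Type*} [TopologicalSpace X] {x y z x' y' z' : X}

theorem cast_trans_cast (a : Path.Homotopic.Quotient x y) (b : Path.Homotopic.Quotient y z)
    (hx : x' = x) (hy : y' = y) (hz : z' = z) :
    (a.cast hx hy).trans (b.cast hy hz) = (a.trans b).cast hx hz := by
  subst hx hy hz; simp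

theorem map_trans {Y : Type*} [TopologicalSpace Y] (a : Path.Homotopic.Quotient x y)
    (b : Path.Homotopic.Quotient y z) (f : C(X, Y)) :
    (a.trans b).map f = (a.map f).trans (b.map f) := by
  induction a using Path.Homotopic.Quotient.ind with | _ a
  induction b using Path.Homotopic.Quotient.ind with | _ b
  rw [← mk_trans, ← mk_map, ← mk_map, ← mk_map, ← mk_trans]
  congr 1
  exact Path.map_trans a b f.continuous

/-- The loop that runs along `p`, `γ`, and back along `q`. -/
noncomputable def loopAlong {a : X} (p : Path.Homotopic.Quotient a x)
    (γ : Path.Homotopic.Quotient x y) (q : Path.Homotopic.Quotient a y) : FundamentalGroup X a :=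
  FundamentalGroup.fromPath ((p.trans γ).trans q.symm)

theorem loopAlong_trans {a : X} (p : Path.Homotopic.Quotient a x)
    (γ : Path.Homotopic.Quotient x y) (q : Path.Homotopic.Quotient a y)
    (δ : Path.Homotopic.Quotient y z) (r : Path.Homotopic.Quotient a z) :
    loopAlong p (γ.trans δ) r = loopAlong q δ r * loopAlong p γ q := by
  rw [FundamentalGroup.mul_def]
  change (p.trans (γ.trans δ)).trans r.symm =
    ((p.trans γ).trans q.symm).trans ((q.trans δ).trans r.symm)
  simp only [trans_assoc]
  rw [← trans_assoc q.symm, symm_trans, refl_trans]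

theorem loopAlong_cast {a : X} (p : Path.Homotopic.Quotient a x)
    (γ : Path.Homotopic.Quotient x y) (q : Path.Homotopic.Quotient a y)
    (hx : x' = x) (hy : y' = y) :
    loopAlong (p.cast rfl hx) (γ.cast hx hy) (q.cast rfl hy) = loopAlong p γ q := by
  subst hx hy; simp

theorem loopAlong_eq_one {a : X} {p : Path.Homotopic.Quotient a x}
    {γ : Path.Homotopic.Quotient x y} {q : Path.Homotopic.Quotient a y} (h : p.trans γ = q) :
    loopAlong p γ q = 1 := by
  subst h
  exact trans_symm _

theorem loopAlong_refl {a : X} (γ : Path.Homotopic.Quotient x y) (hx : x = a) (hy : y = a) :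
    loopAlong ((refl a).cast rfl hx) γ ((refl a).cast rfl hy) =
      FundamentalGroup.fromPath (γ.cast hx.symm hy.symm) := by
  subst hx hy
  simp only [cast_rfl_rfl]
  change ((refl y).trans γ).trans (mk (Path.refl y).symm) = γ
  rw [refl_trans, Path.refl_symm, mk_refl, trans_refl]

end Path.Homotopic.Quotient

section TracedBraid

open unitInterval

variable {N : ℕ}

/-- The projection to the unordered configurations. -/
def unorderedProj (N : ℕ) :
    C(OrdConf N (ℝ × ℝ), OrbitConf (⊤ : Subgroup (Equiv.Perm (Fin N))) (ℝ × ℝ)) :=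
  ⟨OrbitConf.mk ⊤, OrbitConf.continuous_mk ⊤⟩

theorem unorderedProj_smul (h : Equiv.Perm (Fin N)) (x : OrdConf N (ℝ × ℝ)) :
    unorderedProj N (h • x) = unorderedProj N x :=
  OrbitConf.mk_smul ⊤ (Subgroup.mem_top h) x

theorem rank_smul_baseConf (w : Equiv.Perm (Fin N)) : (w⁻¹ • baseConf N).rank = w := by
  rw [OrdConf.rank_smul, rank_baseConf, one_mul, inv_inv]

theorem joinable_smul_baseConf {w : Equiv.Perm (Fin N)} {x : OrdConf N (ℝ × ℝ)}
    (hx : x.rank = w) : Joinable (w⁻¹ • baseConf N) x :=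
  (isConvexConf_lexChamber w).joinable (mem_lexChamber.2 (rank_smul_baseConf w))
    (mem_lexChamber.2 hx)

/-- The path from the base point to an unordered configuration that keeps the lexicographic
order. -/
noncomputable def connector {w : Equiv.Perm (Fin N)} {x : OrdConf N (ℝ × ℝ)} (hx : x.rank = w) :
    Path (unorderedProj N (baseConf N)) (unorderedProj N x) :=
  ((straightPath (joinable_smul_baseConf hx)).map (unorderedProj N).continuous).cast
    (unorderedProj_smul w⁻¹ _).symm rfl

/-- The braid traced by a motion. -/
noncomputable def tracedBraid {x y : OrdConf N (ℝ × ℝ)} (γ : Path.Homotopic.Quotient x y) :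
    BraidGroup N :=
  -- The motion is closed up inside the lexicographic chambers of its ends. Each chamber is convex
  -- and contains exactly one renumbering of the base configuration, so no further choice is
  -- involved.
  Path.Homotopic.Quotient.loopAlong (.mk (connector (x := x) rfl)) (γ.map (unorderedProj N))
    (.mk (connector (x := y) rfl))

theorem tracedBraid_trans {x y z : OrdConf N (ℝ × ℝ)} (γ : Path.Homotopic.Quotient x y)
    (δ : Path.Homotopic.Quotient y z) :
    tracedBraid (γ.trans δ) = tracedBraid δ * tracedBraid γ := by
  unfold tracedBraid
  rw [Path.Homotopic.Quotient.map_trans]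
  exact Path.Homotopic.Quotient.loopAlong_trans _ _ _ _ _

theorem connector_smul (h : Equiv.Perm (Fin N)) (x : OrdConf N (ℝ × ℝ)) :
    connector (x := h • x) rfl = (connector (x := x) rfl).cast rfl (unorderedProj_smul h x) := by
  ext t
  change unorderedProj N (straightPath (joinable_smul_baseConf (x := h • x) rfl) t) =
    unorderedProj N (straightPath (joinable_smul_baseConf (x := x) rfl) t)
  rw [← unorderedProj_smul h (straightPath (joinable_smul_baseConf (x := x) rfl) t)]
  congr 1
  refine Subtype.ext (funext fun i => ?_)
  change (AffineMap.lineMap ((h • x).rank⁻¹ • baseConf N).1 (h • x).1 (t : ℝ) : Fin N → ℝ × ℝ) i =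
    (AffineMap.lineMap (x.rank⁻¹ • baseConf N).1 x.1 (t : ℝ) : Fin N → ℝ × ℝ) (h⁻¹ i)
  rw [OrdConf.rank_smul, mul_inv_rev, inv_inv, mul_smul]
  simp only [AffineMap.lineMap_apply_module]
  rfl

/-- The motion `γ` with permuted indices. -/
def permuted (h : Equiv.Perm (Fin N)) {x y : OrdConf N (ℝ × ℝ)}
    (γ : Path.Homotopic.Quotient x y) : Path.Homotopic.Quotient (h • x) (h • y) :=
  γ.map ⟨fun z => h • z, continuous_const_smul h⟩

theorem map_permuted (h : Equiv.Perm (Fin N)) {x y : OrdConf N (ℝ × ℝ)}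
    (γ : Path.Homotopic.Quotient x y) :
    (permuted h γ).map (unorderedProj N) =
      (γ.map (unorderedProj N)).cast (unorderedProj_smul h x) (unorderedProj_smul h y) := by
  induction γ using Path.Homotopic.Quotient.ind with | _ p
  change Path.Homotopic.Quotient.mk _ = Path.Homotopic.Quotient.mk _
  congr 1
  ext t
  exact unorderedProj_smul h (p t)

theorem tracedBraid_permuted (h : Equiv.Perm (Fin N)) {x y : OrdConf N (ℝ × ℝ)}
    (γ : Path.Homotopic.Quotient x y) : tracedBraid (permuted h γ) = tracedBraid γ := by
  unfold tracedBraid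
  rw [map_permuted, connector_smul, connector_smul]
  exact Path.Homotopic.Quotient.loopAlong_cast (.mk (connector (x := x) rfl))
    (γ.map (unorderedProj N)) (.mk (connector (x := y) rfl))
    (unorderedProj_smul h x) (unorderedProj_smul h y)

/-- By convexity of the chamber, the first connector followed by p is homotopic to the second
connector. -/
theorem tracedBraid_mk_of_mem_lexChamber {w : Equiv.Perm (Fin N)} {x y : OrdConf N (ℝ × ℝ)}
    (p : Path x y) (hp : ∀ t, p t ∈ lexChamber w) :
    tracedBraid (Path.Homotopic.Quotient.mk p) = 1 := by
  have key : ∀ (v : Equiv.Perm (Fin N)) (hx : x.rank = v) (hy : y.rank = v), v = w →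
      (Path.Homotopic.Quotient.mk (connector hx)).trans
          ((Path.Homotopic.Quotient.mk p).map (unorderedProj N)) =
        Path.Homotopic.Quotient.mk (connector hy) := by
    rintro v hx hy rfl
    have hxy : (Path.Homotopic.Quotient.mk (straightPath (joinable_smul_baseConf hx))).trans
          (Path.Homotopic.Quotient.mk p) =
        Path.Homotopic.Quotient.mk (straightPath (joinable_smul_baseConf hy)) := by
      rw [← Path.Homotopic.Quotient.mk_trans, Path.Homotopic.Quotient.eq]
      refine (isConvexConf_lexChamber v).homotopic _ _ (fun t => ?_) fun t => ?_
      · rw [Path.trans_apply]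
        split_ifs
        · exact (isConvexConf_lexChamber v).straightPath_mem
            (mem_lexChamber.2 (rank_smul_baseConf v)) (mem_lexChamber.2 hx) _ _
        · exact hp _
      · exact (isConvexConf_lexChamber v).straightPath_mem
            (mem_lexChamber.2 (rank_smul_baseConf v)) (mem_lexChamber.2 hy) _ _
    have h2 := congrArg (fun γ : Path.Homotopic.Quotient (v⁻¹ • baseConf N) y =>
      (γ.map (unorderedProj N)).cast
      (unorderedProj_smul v⁻¹ (baseConf N)).symm rfl) hxy
    rw [Path.Homotopic.Quotient.map_trans,
      ← Path.Homotopic.Quotient.cast_trans_cast _ _ _ rfl rfl, Path.Homotopic.Quotient.cast_rfl_rfl] at h2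
    exact h2
  have hx : x.rank = w := mem_lexChamber.1 (p.source ▸ hp 0)
  have hy : y.rank = w := mem_lexChamber.1 (p.target ▸ hp 1)
  have hgen : ∀ (v v' : Equiv.Perm (Fin N)) (hx : x.rank = v) (hy : y.rank = v'), v = w → v' = w →
      Path.Homotopic.Quotient.loopAlong (.mk (connector hx))
        ((Path.Homotopic.Quotient.mk p).map (unorderedProj N)) (.mk (connector hy)) = 1 := by
    rintro v v' hx hy rfl rfl
    exact Path.Homotopic.Quotient.loopAlong_eq_one (key v' hx hy rfl)
  exact hgen _ _ rfl rfl hx hy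

theorem connector_eq_refl (w : Equiv.Perm (Fin N)) :
    connector (x := w • baseConf N) rfl =
      (Path.refl (unorderedProj N (baseConf N))).cast rfl (unorderedProj_smul w _) := by
  ext t
  change unorderedProj N (straightPath (joinable_smul_baseConf (x := w • baseConf N) rfl) t) =
    unorderedProj N (baseConf N)
  rw [← unorderedProj_smul w (baseConf N)]
  congr 1
  refine Subtype.ext ?_
  change (AffineMap.lineMap ((w • baseConf N).rank⁻¹ • baseConf N).1 (w • baseConf N).1 (t : ℝ)) =
    (w • baseConf N).1
  rw [OrdConf.rank_smul, rank_baseConf, one_mul, inv_inv, AffineMap.lineMap_same_apply]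

theorem tracedBraid_smul_baseConf (v w : Equiv.Perm (Fin N))
    (γ : Path.Homotopic.Quotient (v • baseConf N) (w • baseConf N)) :
    tracedBraid γ = FundamentalGroup.fromPath ((γ.map (unorderedProj N)).cast
      (unorderedProj_smul v _).symm (unorderedProj_smul w _).symm) := by
  unfold tracedBraid
  rw [connector_eq_refl, connector_eq_refl]
  exact Path.Homotopic.Quotient.loopAlong_refl _ _ _

/-! ### Straight motions -/

open Classical in
/-- The braid traced by the straight motion between two configurations (and `1` if the points
collide). -/
noncomputable def straightBraid (x y : OrdConf N (ℝ × ℝ)) : BraidGroup N :=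
  if h : Joinable x y then tracedBraid (Path.Homotopic.Quotient.mk (straightPath h)) else 1

theorem IsConvexConf.tracedBraid_mk {K : Set (OrdConf N (ℝ × ℝ))} (hK : IsConvexConf K)
    {x y : OrdConf N (ℝ × ℝ)} (p : Path x y) (hp : ∀ t, p t ∈ K) :
    tracedBraid (Path.Homotopic.Quotient.mk p) = straightBraid x y := by
  have hx : x ∈ K := by simpa using hp 0
  have hy : y ∈ K := by simpa using hp 1
  have h := hK.joinable hx hy
  rw [straightBraid, dif_pos h]
  congr 1
  exact Path.Homotopic.Quotient.eq.2 (hK.homotopic _ _ hp fun t => hK.straightPath_mem hx hy h t)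

theorem IsConvexConf.straightBraid_mul {K : Set (OrdConf N (ℝ × ℝ))} (hK : IsConvexConf K)
    {x y z : OrdConf N (ℝ × ℝ)} (hx : x ∈ K) (hy : y ∈ K) (hz : z ∈ K) :
    straightBraid y z * straightBraid x y = straightBraid x z := by
  rw [straightBraid, dif_pos (hK.joinable hy hz), straightBraid, dif_pos (hK.joinable hx hy),
    ← tracedBraid_trans, ← Path.Homotopic.Quotient.mk_trans]
  refine hK.tracedBraid_mk _ fun t => ?_
  rw [Path.trans_apply]
  split_ifs
  · exact hK.straightPath_mem hx hy _ _
  · exact hK.straightPath_mem hy hz _ _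

theorem straightBraid_of_rank_eq {x y : OrdConf N (ℝ × ℝ)} (h : x.rank = y.rank) :
    straightBraid x y = 1 := by
  have hK := isConvexConf_lexChamber y.rank
  have hx := mem_lexChamber.2 h
  have hy := mem_lexChamber.2 (rfl : y.rank = y.rank)
  rw [straightBraid, dif_pos (hK.joinable hx hy)]
  exact tracedBraid_mk_of_mem_lexChamber _ fun t => hK.straightPath_mem hx hy _ t

theorem IsConvexConf.straightBraid_inv {K : Set (OrdConf N (ℝ × ℝ))} (hK : IsConvexConf K)
    {x y : OrdConf N (ℝ × ℝ)} (hx : x ∈ K) (hy : y ∈ K) :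
    (straightBraid x y)⁻¹ = straightBraid y x := by
  rw [inv_eq_iff_mul_eq_one, hK.straightBraid_mul hy hx hy, straightBraid_of_rank_eq rfl]

theorem Joinable.smul {x y : OrdConf N (ℝ × ℝ)} (hxy : Joinable x y) (h : Equiv.Perm (Fin N)) :
    Joinable (h • x) (h • y) := fun t => by
  have := (hxy t).comp (Equiv.injective h⁻¹)
  convert this using 1
  funext i
  simp only [AffineMap.lineMap_apply_module]
  rfl

theorem straightBraid_smul (h : Equiv.Perm (Fin N)) (x y : OrdConf N (ℝ × ℝ)) :
    straightBraid (h • x) (h • y) = straightBraid x y := by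
  by_cases hxy : Joinable x y
  · rw [straightBraid, dif_pos (hxy.smul h), straightBraid, dif_pos hxy,
      ← tracedBraid_permuted h (.mk (straightPath hxy))]
    refine congrArg tracedBraid ?_
    refine congrArg Path.Homotopic.Quotient.mk
      (Path.ext (funext fun t => Subtype.ext (funext fun i => ?_)))
    change (AffineMap.lineMap (h • x).1 (h • y).1 (t : ℝ) : Fin N → ℝ × ℝ) i =
      (AffineMap.lineMap x.1 y.1 (t : ℝ) : Fin N → ℝ × ℝ) (h⁻¹ i)
    simp only [AffineMap.lineMap_apply_module]
    rfl
  · have : ¬ Joinable (h • x) (h • y) := fun hh => hxy (by simpa using hh.smul h⁻¹)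
    rw [straightBraid, dif_neg this, straightBraid, dif_neg hxy]

end TracedBraid

/-! ## The half twists and the grid configurations -/

section HalfTwists

open unitInterval

variable {N : ℕ}

theorem closure_adj (N : ℕ) : Subgroup.closure (adj N '' adjIndex N) = ⊤ := by
  rw [eq_top_iff]
  intro w _
  have h1 := permSection_mem_closure (s := adj N) (K := adjIndex N) (H := ⊤)
    (fun w _ k h => h.mem) (fun _ _ => Subgroup.mem_top _) w (Subgroup.mem_top w)
  have h2 := map_permSection (s := adj N) (K := adjIndex N) (H := ⊤) (MonoidHom.id _)
    (fun _ _ => rfl) (fun w _ k h => h.mem) (fun _ _ => Subgroup.mem_top _) w (Subgroup.mem_top w)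
  rw [MonoidHom.id_apply] at h2
  rwa [h2] at h1

theorem tracedBraid_cast {x y x' y' : OrdConf N (ℝ × ℝ)} (γ : Path.Homotopic.Quotient x y)
    (hx : x' = x) (hy : y' = y) : tracedBraid (γ.cast hx hy) = tracedBraid γ := by
  subst hx hy; rw [Path.Homotopic.Quotient.cast_rfl_rfl]

theorem tracedBraid_subpath_mul {x y : OrdConf N (ℝ × ℝ)} (p : Path x y) (a b c : I) :
    tracedBraid (.mk (p.subpath b c)) * tracedBraid (.mk (p.subpath a b)) =
      tracedBraid (.mk (p.subpath a c)) := by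
  rw [← tracedBraid_trans, ← Path.Homotopic.Quotient.mk_trans]
  exact congrArg tracedBraid (Path.Homotopic.Quotient.eq.2
    ⟨Path.Homotopy.subpathTransSubpath p a b c⟩)

theorem tracedBraid_subpath_zero_one {x y : OrdConf N (ℝ × ℝ)} (p : Path x y) :
    tracedBraid (.mk (p.subpath 0 1)) = tracedBraid (.mk p) := by
  rw [Path.subpath_zero_one, Path.Homotopic.Quotient.mk_cast, tracedBraid_cast]

theorem Path.exists_subpath_apply {X : Type*} [TopologicalSpace X] {x y : X} (p : Path x y)
    {a b : I} (hab : a ≤ b) (t : I) : ∃ s, a ≤ s ∧ s ≤ b ∧ p.subpath a b t = p s := by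
  have : p.subpath a b t ∈ Set.range (p.subpath a b) := ⟨t, rfl⟩
  rw [Path.range_subpath_of_le p a b hab] at this
  obtain ⟨s, hs, h⟩ := this
  exact ⟨s, hs.1, hs.2, h.symm⟩

/-- The half twist as a motion of numbered points. -/
noncomputable def halfTwistPath {k : ℕ} (hk : 1 ≤ k ∧ k < N) :
    Path ((1 : Equiv.Perm (Fin N)) • baseConf N) (adj N k • baseConf N) where
  toFun t := halfTwistConf N k t
  continuous_toFun := (continuous_halfTwistConf N k).comp continuous_subtype_val
  source' := by rw [one_smul]; exact halfTwistConf_zero N k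
  target' := by rw [adj, dif_pos hk]; exact halfTwistConf_one N k hk

theorem artinSigma_eq_tracedBraid {k : ℕ} (hk : 1 ≤ k ∧ k < N) :
    artinSigma N k = tracedBraid (.mk (halfTwistPath hk)) := by
  rw [tracedBraid_smul_baseConf, artinSigma, dif_pos hk]
  rfl

theorem halfTwistConf_apply (k : ℕ) (t : ℝ) (i : Fin N) :
    (halfTwistConf N k t).1 i = halfTwistPoint k t ((i : ℕ) + 1) := rfl

theorem halfTwistPoint_fst_lt {k : ℕ} {t : ℝ} {a b : ℕ} (hab : a < b) (h : ¬ (a = k ∧ b = k + 1)) :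
    (halfTwistPoint k t a).1 < (halfTwistPoint k t b).1 := by
  have hc1 := Real.cos_le_one (Real.pi * t)
  have hc2 := Real.neg_one_le_cos (Real.pi * t)
  have hk : ∀ {m n : ℕ}, m < n → (m : ℝ) + 1 ≤ n := fun h => by exact_mod_cast h
  unfold halfTwistPoint
  by_cases ha : a = k
  · have := hk (show k + 1 < b by omega)
    rw [if_pos ha, if_neg (by omega), if_neg (by omega)]
    push_cast at this
    dsimp only
    linarith
  by_cases ha' : a = k + 1
  · have := hk (show k + 1 < b by omega)
    rw [if_neg ha, if_pos ha', if_neg (by omega), if_neg (by omega)]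
    push_cast at this
    dsimp only
    linarith
  rw [if_neg ha, if_neg ha']
  by_cases hb : b = k
  · have := hk (show a < k by omega)
    rw [if_pos hb]
    dsimp only
    linarith
  by_cases hb' : b = k + 1
  · have := hk (show a < k by omega)
    rw [if_neg hb, if_pos hb']
    dsimp only
    linarith
  · have := hk hab
    rw [if_neg hb, if_neg hb']
    dsimp only
    linarith

theorem halfTwistPoint_sub (k : ℕ) (t : ℝ) :
    halfTwistPoint k t (k + 1) - halfTwistPoint k t k =
      (Real.cos (Real.pi * t), Real.sin (Real.pi * t)) := by
  unfold halfTwistPoint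
  rw [if_neg (by omega), if_pos rfl, if_pos rfl]
  ext
  · simp
  · simp

theorem halfTwistConf_mem_lexChamber {k : ℕ} {t : ℝ} (h0 : 0 ≤ t) (h1 : t ≤ 1 / 2) :
    halfTwistConf N k t ∈ lexChamber (1 : Equiv.Perm (Fin N)) := by
  rw [mem_lexChamber, OrdConf.rank_eq_iff]
  intro i j hij
  rw [Equiv.Perm.one_apply, Equiv.Perm.one_apply, Fin.lt_def] at hij
  by_cases h : (i : ℕ) + 1 = k ∧ (j : ℕ) + 1 = k + 1
  · rw [lexLT_iff, halfTwistConf_apply, halfTwistConf_apply, h.1, h.2, halfTwistPoint_sub]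
    have hpi := Real.pi_pos
    rcases h1.lt_or_eq with h1 | rfl
    · left
      exact Real.cos_pos_of_mem_Ioo ⟨by nlinarith, by nlinarith⟩
    · right
      rw [show Real.pi * (1 / 2) = Real.pi / 2 by ring]
      simp
  · exact Or.inl (halfTwistPoint_fst_lt (by omega) h)

/-- The configurations ordered from left to right, except that the points `k` and `k + 1` are
ordered by height. -/
def turnChamber (N k : ℕ) : Set (OrdConf N (ℝ × ℝ)) :=
  coneConf fun i j => if i < j then
    (if (i : ℕ) + 1 = k ∧ (j : ℕ) + 1 = k + 1 then turnedLexCone else {v | 0 < v.1}) else Set.univ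

theorem isConvexConf_turnChamber (k : ℕ) : IsConvexConf (turnChamber N k) := by
  refine isConvexConf_coneConf (fun i j => ?_) fun i j hij => ?_
  · split_ifs
    exacts [convex_turnedLexCone, convex_fst_pos, convex_univ]
  · have : ∀ i j : Fin N, i < j → (0 : ℝ × ℝ) ∉ (if i < j then
        (if (i : ℕ) + 1 = k ∧ (j : ℕ) + 1 = k + 1 then turnedLexCone else {v | 0 < v.1})
        else Set.univ) := by
      intro i j h
      rw [if_pos h]
      split_ifs
      · exact zero_notMem_turnedLexCone
      · simp
    exact (lt_or_gt_of_ne hij).imp (this i j) (this j i)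

theorem mem_turnChamber {k : ℕ} {x : OrdConf N (ℝ × ℝ)}
    (h1 : ∀ i j : Fin N, i < j → ¬ ((i : ℕ) + 1 = k ∧ (j : ℕ) = k) → (x.1 i).1 < (x.1 j).1)
    (h2 : ∀ i j : Fin N, (i : ℕ) + 1 = k → (j : ℕ) = k → x.1 j - x.1 i ∈ turnedLexCone) :
    x ∈ turnChamber N k := by
  intro i j
  dsimp only
  split_ifs with h h'
  · exact h2 i j h'.1 (by omega)
  · exact sub_pos.2 (h1 i j h (by omega))
  · trivial

theorem halfTwistConf_mem_turnChamber {k : ℕ} {t : ℝ} (h0 : 1 / 2 ≤ t) (h1 : t ≤ 1) :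
    halfTwistConf N k t ∈ turnChamber N k := by
  refine mem_turnChamber (fun i j hij h => ?_) fun i j hi hj => ?_
  · exact halfTwistPoint_fst_lt (by have := Fin.lt_def.1 hij; omega) (by omega)
  · rw [halfTwistConf_apply, halfTwistConf_apply, hi, hj, halfTwistPoint_sub]
    have hpi := Real.pi_pos
    rcases h1.lt_or_eq with h1 | rfl
    · left
      exact Real.sin_pos_of_pos_of_lt_pi (by nlinarith) (by nlinarith)
    · right
      simp

/-- The middle of the half twist. -/
noncomputable def midTwist (N k : ℕ) : OrdConf N (ℝ × ℝ) := halfTwistConf N k (1 / 2)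

theorem rank_midTwist (k : ℕ) : (midTwist N k).rank = 1 :=
  mem_lexChamber.1 (halfTwistConf_mem_lexChamber (by norm_num) le_rfl)

theorem midTwist_mem_turnChamber (k : ℕ) : midTwist N k ∈ turnChamber N k :=
  halfTwistConf_mem_turnChamber le_rfl (by norm_num)

theorem adj_smul_baseConf_mem_turnChamber {k : ℕ} (hk : 1 ≤ k ∧ k < N) :
    adj N k • baseConf N ∈ turnChamber N k := by
  rw [adj, dif_pos hk, ← halfTwistConf_one]
  exact halfTwistConf_mem_turnChamber (by norm_num) le_rfl

/-- Up to and including the vertical position the lexicographic order is unchanged, so the first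
half of the motion contributes nothing; the second half stays in the convex `turnChamber N k`. -/
theorem artinSigma_eq_straightBraid {k : ℕ} (hk : 1 ≤ k ∧ k < N) :
    artinSigma N k = straightBraid (midTwist N k) (adj N k • baseConf N) := by
  set p := halfTwistPath hk with hp
  let a : I := ⟨1 / 2, by norm_num, by norm_num⟩
  rw [artinSigma_eq_tracedBraid hk, ← tracedBraid_subpath_zero_one,
    ← tracedBraid_subpath_mul _ 0 a 1]
  have e1 : tracedBraid (.mk ((halfTwistPath hk).subpath 0 a)) = 1 := by
    refine tracedBraid_mk_of_mem_lexChamber (w := 1) _ fun t => ?_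
    obtain ⟨s, hs0, hs1, hs⟩ := Path.exists_subpath_apply (halfTwistPath hk)
      (show (0 : I) ≤ a from a.2.1) t
    rw [hs]
    exact halfTwistConf_mem_lexChamber s.2.1 hs1
  have e2 : tracedBraid (.mk ((halfTwistPath hk).subpath a 1)) =
      straightBraid (halfTwistPath hk a) (halfTwistPath hk 1) := by
    refine (isConvexConf_turnChamber k).tracedBraid_mk _ fun t => ?_
    obtain ⟨s, hs0, hs1, hs⟩ := Path.exists_subpath_apply (halfTwistPath hk)
      (show a ≤ (1 : I) from a.2.2) t
    rw [hs]
    exact halfTwistConf_mem_turnChamber hs0 s.2.2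
  rw [e1, e2, mul_one, Path.target]
  rfl

/-! ### Grid configurations -/

/-- The configuration whose points have abscissas `w` and ordinates `u`. -/
def gridConf (u w : Equiv.Perm (Fin N)) : OrdConf N (ℝ × ℝ) :=
  ⟨fun i => (((w i : ℕ) : ℝ), ((u i : ℕ) : ℝ)), fun i j h => by
    have h1 : ((w i : ℕ) : ℝ) = ((w j : ℕ) : ℝ) := congrArg Prod.fst h
    exact w.injective (Fin.ext (by exact_mod_cast h1))⟩

theorem gridConf_eq_smul (u w v : Equiv.Perm (Fin N)) :
    gridConf u (v * w) = w⁻¹ • gridConf (u * w⁻¹) v := by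
  refine Subtype.ext (funext fun i => ?_)
  change _ = ((((v ((w⁻¹)⁻¹ i) : Fin N) : ℕ) : ℝ), ((((u * w⁻¹) ((w⁻¹)⁻¹ i) : Fin N) : ℕ) : ℝ))
  rw [inv_inv, Equiv.Perm.mul_apply u, ← Equiv.Perm.mul_apply w⁻¹, inv_mul_cancel]
  rfl

theorem rank_gridConf (u w : Equiv.Perm (Fin N)) : (gridConf u w).rank = w := by
  rw [OrdConf.rank_eq_iff]
  intro i j hij
  left
  change ((w i : ℕ) : ℝ) < ((w j : ℕ) : ℝ)
  exact_mod_cast hij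

/-- The higher point j passes over i from right to left, which is counterclockwise. This motion and
the second half of σ_k lie in one `turnChamber`, and their corresponding ends have the same
lexicographic order. -/
theorem straightBraid_gridConf_one_adj {u : Equiv.Perm (Fin N)} {k : ℕ} {i j : Fin N}
    (hi : (i : ℕ) + 1 = k) (hj : (j : ℕ) = k) (hu : u i < u j) :
    straightBraid (gridConf u 1) (gridConf u (adj N k)) = artinSigma N k := by
  have hk : 1 ≤ k ∧ k < N := by have := j.2; omega
  have hpair : ∀ i' j' : Fin N, (i' : ℕ) + 1 = k → (j' : ℕ) = k →
      ∀ w, (gridConf u w).1 j' - (gridConf u w).1 i' ∈ turnedLexCone := by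
    intro i' j' hi' hj' w
    obtain rfl : i' = i := Fin.ext (by omega)
    obtain rfl : j' = j := Fin.ext (by omega)
    left
    have : ((u i' : ℕ) : ℝ) < ((u j' : ℕ) : ℝ) := by exact_mod_cast hu
    exact sub_pos.2 this
  have m1 : gridConf u 1 ∈ turnChamber N k := by
    refine mem_turnChamber (fun a b hab _ => ?_) fun a b ha hb => hpair a b ha hb 1
    change (((a : ℕ) : ℝ)) < ((b : ℕ) : ℝ)
    exact_mod_cast hab
  have m2 : gridConf u (adj N k) ∈ turnChamber N k := by
    refine mem_turnChamber (fun a b hab h => ?_) fun a b ha hb => hpair a b ha hb _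
    change (((adj N k a : Fin N) : ℕ) : ℝ) < (((adj N k b : Fin N) : ℕ) : ℝ)
    rw [adj_val hk, adj_val hk]
    have := Fin.lt_def.1 hab
    exact_mod_cast (by split_ifs <;> omega)
  have hK := isConvexConf_turnChamber (N := N) k
  rw [artinSigma_eq_straightBraid hk,
    ← hK.straightBraid_mul m1 (adj_smul_baseConf_mem_turnChamber hk) m2,
    ← hK.straightBraid_mul m1 (midTwist_mem_turnChamber k) (adj_smul_baseConf_mem_turnChamber hk),
    straightBraid_of_rank_eq (x := adj N k • baseConf N),
    straightBraid_of_rank_eq (x := gridConf u 1),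
    mul_one, one_mul]
  · rw [rank_gridConf, rank_midTwist]
  · rw [rank_gridConf, OrdConf.rank_smul, rank_baseConf, one_mul, adj_inv]

theorem straightBraid_gridConf_adj_mul {u w : Equiv.Perm (Fin N)} {k : ℕ} {i j : Fin N}
    (hi : (w i : ℕ) + 1 = k) (hj : (w j : ℕ) = k) (hu : u i < u j) :
    straightBraid (gridConf u w) (gridConf u (adj N k * w)) = artinSigma N k := by
  rw [gridConf_eq_smul u w (adj N k), show gridConf u w = w⁻¹ • gridConf (u * w⁻¹) 1 by
    rw [← gridConf_eq_smul, one_mul], straightBraid_smul]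
  exact straightBraid_gridConf_one_adj hi hj (by simpa using hu)

/-- The configurations ordered by height. -/
def heightChamber (u : Equiv.Perm (Fin N)) : Set (OrdConf N (ℝ × ℝ)) :=
  coneConf fun i j => if u i < u j then {v | 0 < v.2} else Set.univ

theorem isConvexConf_heightChamber (u : Equiv.Perm (Fin N)) :
    IsConvexConf (heightChamber u) := by
  refine isConvexConf_coneConf (fun i j => ?_) fun i j hij => ?_
  · split_ifs
    exacts [convex_snd_pos, convex_univ]
  · rcases lt_or_gt_of_ne (u.injective.ne hij) with h | h
    · left; rw [if_pos h]; simp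
    · right; rw [if_pos h]; simp

theorem gridConf_mem_heightChamber (u w : Equiv.Perm (Fin N)) :
    gridConf u w ∈ heightChamber u := by
  intro i j
  dsimp only
  split_ifs with h
  · have : ((u i : ℕ) : ℝ) < ((u j : ℕ) : ℝ) := by exact_mod_cast h
    exact sub_pos.2 this
  · trivial

/-- With pairwise distinct heights kept fixed, points slide freely past each other and the braid
depends only on the initial and final abscissas. Reading the two sides of a relation between
permutations as such slides gives the relation between half twists; in each step the higher point
moves left over the lower one. -/
theorem isArtinSystem_artinSigma (N : ℕ) : IsArtinSystem (artinSigma N) (adjIndex N) := by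
  have hK := isConvexConf_heightChamber (1 : Equiv.Perm (Fin N))
  have hr : ∀ (w : Equiv.Perm (Fin N)) (k : ℕ) (i j : Fin N), (w i : ℕ) + 1 = k → (w j : ℕ) = k →
      i < j → straightBraid (gridConf 1 1) (gridConf 1 (adj N k * w)) =
        artinSigma N k * straightBraid (gridConf 1 1) (gridConf 1 w) := by
    intro w k i j hi hj hij
    rw [← straightBraid_gridConf_adj_mul (u := 1) hi hj hij]
    exact (hK.straightBraid_mul (gridConf_mem_heightChamber _ _) (gridConf_mem_heightChamber _ _)
      (gridConf_mem_heightChamber _ _)).symm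
  have h1 : straightBraid (gridConf (1 : Equiv.Perm (Fin N)) 1) (gridConf 1 1) = 1 :=
    straightBraid_of_rank_eq rfl
  constructor
  · intro k hk hk'
    obtain ⟨hk1, -⟩ := hk
    have hkN := hk'.2
    have hk : 1 ≤ k ∧ k < N := ⟨hk1, by omega⟩
    have hk' : 1 ≤ k + 1 ∧ k + 1 < N := ⟨by omega, hkN⟩
    have e := congrArg (fun w => straightBraid (gridConf 1 1) (gridConf 1 (w * 1)))
      ((isArtinSystem_adj N).braid k hk hk')
    simp only [mul_assoc] at e
    -- These are the points number k, k + 1, k + 2; the rewriting below names the pair exchanged by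
    -- each letter, read from the last letter of the word to the first.
    let a : Fin N := ⟨k - 1, by omega⟩
    let b : Fin N := ⟨k, by omega⟩
    let c : Fin N := ⟨k + 1, hkN⟩
    have hab : a < b := Fin.lt_def.2 (show k - 1 < k by omega)
    have hbc : b < c := Fin.lt_def.2 (show k < k + 1 by omega)
    have hac := hab.trans hbc
    rw [hr _ k b c ?_ ?_ hbc, hr _ (k + 1) a c ?_ ?_ hac, hr _ k a b ?_ ?_ hab,
      hr _ (k + 1) a b ?_ ?_ hab, hr _ k a c ?_ ?_ hac, hr _ (k + 1) b c ?_ ?_ hbc, h1, mul_one,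
      mul_one] at e
    · rw [mul_assoc, mul_assoc]; exact e
    all_goals
      simp only [a, b, c, Equiv.Perm.mul_apply, Equiv.Perm.one_apply, adj_val hk, adj_val hk'] <;>
        first | omega | (split_ifs <;> omega)
  · intro k l hk hl hkl
    have hk : 1 ≤ k ∧ k < N := hk
    have hl : 1 ≤ l ∧ l < N := hl
    have e := congrArg (fun w => straightBraid (gridConf 1 1) (gridConf 1 (w * 1)))
      ((isArtinSystem_adj N).comm k l hk hl hkl)
    simp only [mul_assoc] at e
    let a : Fin N := ⟨k - 1, by omega⟩
    let b : Fin N := ⟨k, by omega⟩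
    let c : Fin N := ⟨l - 1, by omega⟩
    let d : Fin N := ⟨l, by omega⟩
    have hab : a < b := Fin.lt_def.2 (show k - 1 < k by omega)
    have hcd : c < d := Fin.lt_def.2 (show l - 1 < l by omega)
    rw [hr _ k a b ?_ ?_ hab, hr _ l c d ?_ ?_ hcd, hr _ l c d ?_ ?_ hcd, hr _ k a b ?_ ?_ hab, h1,
      mul_one, mul_one] at e
    · exact e
    all_goals
      simp only [a, b, c, d, Equiv.Perm.mul_apply, Equiv.Perm.one_apply, adj_val hk, adj_val hl] <;>
        first | omega | (split_ifs <;> omega)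

/-- Factor the change of abscissas into adjacent exchanges; the heights decide whether each is a
half twist or the inverse of one. -/
theorem straightBraid_gridConf_mem_closure (u w w' : Equiv.Perm (Fin N)) :
    straightBraid (gridConf u w) (gridConf u w') ∈
      Subgroup.closure (artinSigma N '' adjIndex N) := by
  have hK := isConvexConf_heightChamber u
  have hm := gridConf_mem_heightChamber u
  have key : ∀ g ∈ Subgroup.closure (adj N '' adjIndex N), ∀ w,
      straightBraid (gridConf u w) (gridConf u (g * w)) ∈
        Subgroup.closure (artinSigma N '' adjIndex N) := by
    intro g hg
    induction hg using Subgroup.closure_induction with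
    | one =>
      intro w
      rw [one_mul, straightBraid_of_rank_eq rfl]
      exact one_mem _
    | mul g h _ _ ihg ihh =>
      intro w
      rw [mul_assoc, ← hK.straightBraid_mul (hm w) (hm (h * w)) (hm _)]
      exact mul_mem (ihg _) (ihh _)
    | inv g _ ih =>
      intro w
      have := inv_mem (ih (g⁻¹ * w))
      rwa [mul_inv_cancel_left, hK.straightBraid_inv (hm _) (hm _)] at this
    | mem g hg =>
      obtain ⟨k, hk, rfl⟩ := hg
      intro w
      have hs : artinSigma N k ∈ Subgroup.closure (artinSigma N '' adjIndex N) :=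
        Subgroup.subset_closure ⟨k, hk, rfl⟩
      obtain ⟨i, j, hij, hi, hj⟩ := exists_values hk w
      rcases lt_or_gt_of_ne (u.injective.ne hij) with h | h
      · rw [straightBraid_gridConf_adj_mul hi hj h]
        exact hs
      · rw [← inv_inv (straightBraid _ _), hK.straightBraid_inv (hm _) (hm _)]
        refine inv_mem ?_
        have e := straightBraid_gridConf_adj_mul (u := u) (w := adj N k * w) (k := k) (i := j)
          (j := i) ?_ ?_ h
        · rw [adj_mul_cancel] at e
          rwa [e]
        all_goals
          rw [Equiv.Perm.mul_apply, adj_val hk]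
          have : 1 ≤ k := hk.1
          split_ifs <;> omega
  have := key (w' * w⁻¹) (by rw [closure_adj]; trivial) w
  rwa [inv_mul_cancel_right] at this

end HalfTwists

/-! ## Neighbourhoods, lifting and generation -/

/-! ### Induction over small pieces of a path -/

section PathInduction

open unitInterval

/-- By the Lebesgue number lemma a path splits into finitely many pieces, each inside one member of
the cover. -/
theorem Path.Homotopic.Quotient.induction_of_cover {X ι : Type*} [TopologicalSpace X]
    {U : ι → Set X} (hU : ∀ i, IsOpen (U i)) (hcover : ∀ x, ∃ i, x ∈ U i)
    {P : ∀ x y : X, Path.Homotopic.Quotient x y → Prop}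
    (small : ∀ (i : ι) (x y : X) (p : Path x y), (∀ t, p t ∈ U i) → P x y (.mk p))
    (trans : ∀ (x y z : X) (γ : Path.Homotopic.Quotient x y) (δ : Path.Homotopic.Quotient y z),
      P x y γ → P y z δ → P x z (γ.trans δ))
    {x y : X} (γ : Path.Homotopic.Quotient x y) : P x y γ := by
  induction γ using Path.Homotopic.Quotient.ind with | _ p
  obtain ⟨t, ht0, htm, ⟨n, hn⟩, ht⟩ := exists_monotone_Icc_subset_open_cover_unitInterval
    (c := fun i => p ⁻¹' U i) (fun i => (hU i).preimage p.continuous)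
    (fun s _ => by
      obtain ⟨i, hi⟩ := hcover (p s)
      exact Set.mem_iUnion.2 ⟨i, hi⟩)
  have key : ∀ n, P (p 0) (p (t n)) (.mk (p.subpath 0 (t n))) := by
    intro n
    induction n with
    | zero =>
      obtain ⟨i, hi⟩ := hcover (p 0)
      rw [ht0, Path.subpath_self]
      exact small i _ _ _ fun _ => hi
    | succ n ih =>
      obtain ⟨i, hi⟩ := ht n
      have h1 : P (p (t n)) (p (t (n + 1))) (.mk (p.subpath (t n) (t (n + 1)))) := by
        refine small i _ _ _ fun s => ?_
        obtain ⟨r, hr0, hr1, hr⟩ := Path.exists_subpath_apply p (htm n.le_succ) s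
        rw [hr]
        exact hi ⟨hr0, hr1⟩
      have h2 := trans _ _ _ _ _ ih h1
      rwa [← Path.Homotopic.Quotient.mk_trans, Path.Homotopic.Quotient.eq.2
        ⟨Path.Homotopy.subpathTransSubpath p 0 (t n) (t (n + 1))⟩] at h2
  have h1 := key n
  rw [hn n le_rfl, Path.subpath_zero_one, Path.Homotopic.Quotient.mk_cast] at h1
  have hcast : ∀ (x' y' : X) (hx : x' = x) (hy : y' = y),
      P x' y' ((Path.Homotopic.Quotient.mk p).cast hx hy) → P x y (.mk p) := by
    rintro _ _ rfl rfl h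
    rwa [Path.Homotopic.Quotient.cast_rfl_rfl] at h
  exact hcast _ _ _ _ h1

end PathInduction

/-! ### Convex neighbourhoods, coverings and generation -/

section Neighbourhoods

open unitInterval

variable {N : ℕ}

/-- The configurations that keep the strict left-to-right order of the points of `a`, and the
order of the points of `a` on vertical lines. -/
def nearConf (a : OrdConf N (ℝ × ℝ)) : Set (OrdConf N (ℝ × ℝ)) :=
  coneConf fun i j => if (a.1 i).1 < (a.1 j).1 then {v | 0 < v.1} else
    if (a.1 i).1 = (a.1 j).1 ∧ (a.1 i).2 < (a.1 j).2 then {v | 0 < v.2} else Set.univ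

theorem mem_nearConf {a x : OrdConf N (ℝ × ℝ)} : x ∈ nearConf a ↔
    (∀ i j, (a.1 i).1 < (a.1 j).1 → (x.1 i).1 < (x.1 j).1) ∧
      ∀ i j, (a.1 i).1 = (a.1 j).1 → (a.1 i).2 < (a.1 j).2 → (x.1 i).2 < (x.1 j).2 := by
  constructor
  · refine fun h => ⟨fun i j hij => ?_, fun i j hij hij' => ?_⟩
    · have := h i j
      dsimp only at this
      rw [if_pos hij] at this
      exact sub_pos.1 this
    · have := h i j
      dsimp only at this
      rw [if_neg hij.not_lt, if_pos ⟨hij, hij'⟩] at this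
      exact sub_pos.1 this
  · rintro ⟨h1, h2⟩ i j
    dsimp only
    split_ifs with h h'
    · exact sub_pos.2 (h1 i j h)
    · exact sub_pos.2 (h2 i j h'.1 h'.2)
    · trivial

theorem self_mem_nearConf (a : OrdConf N (ℝ × ℝ)) : a ∈ nearConf a :=
  mem_nearConf.2 ⟨fun _ _ h => h, fun _ _ _ h => h⟩

theorem isConvexConf_nearConf (a : OrdConf N (ℝ × ℝ)) : IsConvexConf (nearConf a) := by
  refine isConvexConf_coneConf (fun i j => ?_) fun i j hij => ?_
  · split_ifs
    exacts [convex_fst_pos, convex_snd_pos, convex_univ]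
  · have : ∀ i j, LexLT (a.1 i) (a.1 j) → (0 : ℝ × ℝ) ∉
        (if (a.1 i).1 < (a.1 j).1 then {v : ℝ × ℝ | 0 < v.1} else
          if (a.1 i).1 = (a.1 j).1 ∧ (a.1 i).2 < (a.1 j).2 then {v | 0 < v.2} else Set.univ) := by
      rintro i j (h | h)
      · rw [if_pos h]; simp
      · rw [if_neg h.1.not_lt, if_pos h]; simp
    rcases lt_or_gt_of_ne (a.rank.injective.ne hij) with h | h
    · exact Or.inl (this i j ((a.rank_lt_iff i j).1 h))
    · exact Or.inr (this j i ((a.rank_lt_iff j i).1 h))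

theorem isOpen_nearConf (a : OrdConf N (ℝ × ℝ)) : IsOpen (nearConf a) := by
  have : nearConf a = ⋂ i, ⋂ j, (fun x : OrdConf N (ℝ × ℝ) => x.1 j - x.1 i) ⁻¹'
      (if (a.1 i).1 < (a.1 j).1 then {v | 0 < v.1} else
        if (a.1 i).1 = (a.1 j).1 ∧ (a.1 i).2 < (a.1 j).2 then {v | 0 < v.2} else Set.univ) := by
    ext x
    simp only [Set.mem_iInter]
    rfl
  rw [this]
  refine isOpen_iInter_of_finite fun i => isOpen_iInter_of_finite fun j => IsOpen.preimage ?_ ?_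
  · have hc : ∀ i, Continuous fun x : OrdConf N (ℝ × ℝ) => x.1 i := fun i =>
      (continuous_apply i).comp continuous_subtype_val
    exact (hc j).sub (hc i)
  · split_ifs
    · exact isOpen_lt continuous_const continuous_fst
    · exact isOpen_lt continuous_const continuous_snd
    · exact isOpen_univ

theorem smul_mem_nearConf_smul (h : Equiv.Perm (Fin N)) {a x : OrdConf N (ℝ × ℝ)}
    (hx : x ∈ nearConf a) : h • x ∈ nearConf (h • a) := fun i j => hx (h⁻¹ i) (h⁻¹ j)

theorem gridConf_mem_nearConf {a : OrdConf N (ℝ × ℝ)} {u w : Equiv.Perm (Fin N)}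
    (hw : ∀ i j, (a.1 i).1 < (a.1 j).1 → w i < w j)
    (hu : ∀ i j, (a.1 i).1 = (a.1 j).1 → (a.1 i).2 < (a.1 j).2 → u i < u j) :
    gridConf u w ∈ nearConf a := by
  refine mem_nearConf.2 ⟨fun i j h => ?_, fun i j h h' => ?_⟩
  · change ((w i : ℕ) : ℝ) < ((w j : ℕ) : ℝ)
    exact_mod_cast hw i j h
  · change ((u i : ℕ) : ℝ) < ((u j : ℕ) : ℝ)
    exact_mod_cast hu i j h h'

/-- This grid configuration has the lexicographic order of x, and its heights depend only on a. So
straight motions near a reduce to slides at fixed heights. -/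
theorem gridConf_rank_mem_nearConf {a x : OrdConf N (ℝ × ℝ)} (hx : x ∈ nearConf a) :
    gridConf a.rank x.rank ∈ nearConf a :=
  gridConf_mem_nearConf
    (fun i j h => (x.rank_lt_iff i j).2 (Or.inl ((mem_nearConf.1 hx).1 i j h)))
    fun i j h h' => (a.rank_lt_iff i j).2 (Or.inr ⟨h, h'⟩)

/-- Sorting g also sorts both f and f ∘ r⁻¹. Two monotone rearrangements of f are equal. -/
theorem comp_perm_eq_of_lt {A B : Type*} [LinearOrder A] [LinearOrder B] (f : Fin N → A)
    (g : Fin N → B) (r : Equiv.Perm (Fin N)) (h1 : ∀ i j, f i < f j → g i < g j)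
    (h2 : ∀ i j, f i < f j → g (r i) < g (r j)) (i : Fin N) : f (r i) = f i := by
  have hs : Monotone (g ∘ Tuple.sort g) := Tuple.monotone_sort g
  have m1 : Monotone (f ∘ (Tuple.sort g)) := fun i j hij =>
    not_lt.1 fun h => (hs hij).not_gt (h1 _ _ h)
  have m2 : Monotone (f ∘ (r⁻¹ * Tuple.sort g : Equiv.Perm (Fin N))) := fun i j hij =>
    not_lt.1 fun h => (hs hij).not_gt (by simpa using h2 _ _ h)
  have e := congrFun (Tuple.unique_monotone m1 m2) ((Tuple.sort g)⁻¹ (r i))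
  simpa using e

/-- The renumbering first preserves the vertical lines of a, then the heights on each of them, so it
fixes every point. Thus distinct translates of the neighbourhood are disjoint, and the orbit
projections are coverings. -/
theorem eq_one_of_smul_mem_nearConf {a x : OrdConf N (ℝ × ℝ)} {h : Equiv.Perm (Fin N)}
    (hx : x ∈ nearConf a) (hhx : h • x ∈ nearConf a) : h = 1 := by
  rw [mem_nearConf] at hx hhx
  have e1 := comp_perm_eq_of_lt (fun i => (a.1 i).1) (fun i => (x.1 i).1) h⁻¹ hx.1 hhx.1
  -- Heights are comparable only within a vertical line of a, hence abscissas from a combined with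
  -- heights from x.
  have e2 := comp_perm_eq_of_lt (fun i => toLex (a.1 i)) (fun i => toLex ((a.1 i).1, (x.1 i).2)) h⁻¹
    (fun i j hij => by
      rw [Prod.Lex.toLex_lt_toLex] at hij ⊢
      exact hij.imp id fun hh => ⟨hh.1, hx.2 i j hh.1 hh.2⟩)
    (fun i j hij => by
      rw [Prod.Lex.toLex_lt_toLex] at hij ⊢
      dsimp only at e1 ⊢
      rw [e1, e1]
      exact hij.imp id fun hh => ⟨hh.1, hhx.2 i j hh.1 hh.2⟩)
  rw [← inv_eq_one]
  exact Equiv.ext fun i => a.2 (toLex.injective (e2 i))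

/-! ### The covering by the ordered configurations -/

variable (H : Subgroup (Equiv.Perm (Fin N)))

/-- The projection to the configurations up to `H`. -/
def orbitProj : C(OrdConf N (ℝ × ℝ), OrbitConf H (ℝ × ℝ)) :=
  ⟨OrbitConf.mk H, OrbitConf.continuous_mk H⟩

theorem orbitProj_smul {h : Equiv.Perm (Fin N)} (hh : h ∈ H) (x : OrdConf N (ℝ × ℝ)) :
    orbitProj H (h • x) = orbitProj H x :=
  OrbitConf.mk_smul H hh x

theorem orbitProj_eq_iff {x y : OrdConf N (ℝ × ℝ)} :
    orbitProj H x = orbitProj H y ↔ ∃ h ∈ H, h • y = x := by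
  refine (Quotient.eq'' (s₁ := MulAction.orbitRel H (OrdConf N (ℝ × ℝ)))).trans ?_
  constructor
  · rintro ⟨h, hh⟩
    exact ⟨h, h.2, hh⟩
  · rintro ⟨h, hh, e⟩
    exact ⟨⟨h, hh⟩, e⟩

theorem isQuotientCoveringMap_orbitProj : IsQuotientCoveringMap (orbitProj H) H where
  toIsQuotientMap := isQuotientMap_quotient_mk'
  continuous_const_smul h := continuous_const_smul (h : Equiv.Perm (Fin N))
  apply_eq_iff_mem_orbit := Quotient.eq''
  disjoint e := by
    refine ⟨nearConf e, (isOpen_nearConf e).mem_nhds (self_mem_nearConf e), ?_⟩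
    rintro g ⟨_, ⟨x, hx, rfl⟩, hgx⟩
    exact Subtype.ext (eq_one_of_smul_mem_nearConf hx hgx)

theorem isCoveringMap_orbitProj : IsCoveringMap (orbitProj H) :=
  (isQuotientCoveringMap_orbitProj H).isCoveringMap

variable {H}

/-- Path lifting in the covering by ordered configurations: the end of the lift lies in the fibre
over the base point, which is the H-orbit of `baseConf N`. -/
theorem PlaneBraidGroup.exists_lift (b : PlaneBraidGroup H) :
    ∃ h, ∃ hh : h ∈ H, ∃ γ : Path.Homotopic.Quotient ((1 : Equiv.Perm (Fin N)) • baseConf N)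
      (h • baseConf N), b = FundamentalGroup.fromPath ((γ.map (orbitProj H)).cast
        (orbitProj_smul H (one_mem H) _).symm (orbitProj_smul H hh _).symm) := by
  have hcov := isCoveringMap_orbitProj H
  let γ : Path.Homotopic.Quotient (orbitProj H (baseConf N)) (orbitProj H (baseConf N)) := b.toPath
  let e : (orbitProj H) ⁻¹' {orbitProj H (baseConf N)} := ⟨baseConf N, rfl⟩
  obtain ⟨h, hh, he⟩ := (orbitProj_eq_iff H).1 (hcov.monodromy γ e).2
  have key : ∀ (y : OrdConf N (ℝ × ℝ)) (δ : Path.Homotopic.Quotient (baseConf N) y)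
      (hy : y = h • baseConf N) (hy' : orbitProj H y = orbitProj H (baseConf N)),
      δ.map (orbitProj H) = γ.cast rfl hy' →
      ∃ γ' : Path.Homotopic.Quotient ((1 : Equiv.Perm (Fin N)) • baseConf N)
      (h • baseConf N), γ = ((γ'.map (orbitProj H)).cast
        (orbitProj_smul H (one_mem H) _).symm (orbitProj_smul H hh _).symm) := by
    rintro y δ rfl hy' hδ
    refine ⟨δ.cast (one_smul _ _) rfl, ?_⟩
    rw [Path.Homotopic.Quotient.map_cast, hδ]
    simp
  obtain ⟨γ', hγ'⟩ := key _ (hcov.liftPathQuotient γ e) he.symm (hcov.monodromy γ e).2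
    (hcov.map_liftPathQuotient γ e)
  exact ⟨h, hh, γ', hγ'⟩

/-! ### Generation by the half twists -/

theorem straightBraid_mem_closure {a x y : OrdConf N (ℝ × ℝ)} (hx : x ∈ nearConf a)
    (hy : y ∈ nearConf a) :
    straightBraid x y ∈ Subgroup.closure (artinSigma N '' adjIndex N) := by
  have hK := isConvexConf_nearConf a
  have h1 := gridConf_rank_mem_nearConf hx
  have h2 := gridConf_rank_mem_nearConf hy
  rw [← hK.straightBraid_mul hx h1 hy, ← hK.straightBraid_mul h1 h2 hy,
    straightBraid_of_rank_eq (x := x) (rank_gridConf _ _).symm,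
    straightBraid_of_rank_eq (y := y) (rank_gridConf _ _), one_mul, mul_one]
  exact straightBraid_gridConf_mem_closure _ _ _

theorem tracedBraid_mem_closure {x y : OrdConf N (ℝ × ℝ)} (γ : Path.Homotopic.Quotient x y) :
    tracedBraid γ ∈ Subgroup.closure (artinSigma N '' adjIndex N) := by
  induction γ using Path.Homotopic.Quotient.induction_of_cover
    (U := fun a : OrdConf N (ℝ × ℝ) => nearConf a) isOpen_nearConf
    (fun x => ⟨x, self_mem_nearConf x⟩) with
  | small a x y p hp =>
    rw [(isConvexConf_nearConf a).tracedBraid_mk p hp]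
    exact straightBraid_mem_closure (by simpa using hp 0) (by simpa using hp 1)
  | trans x y z γ δ h1 h2 =>
    rw [tracedBraid_trans]
    exact mul_mem h2 h1

theorem closure_artinSigma (N : ℕ) : Subgroup.closure (artinSigma N '' adjIndex N) = ⊤ := by
  rw [eq_top_iff]
  intro b _
  obtain ⟨h, hh, γ, rfl⟩ := PlaneBraidGroup.exists_lift b
  have := tracedBraid_mem_closure γ
  rw [tracedBraid_smul_baseConf] at this
  exact this

end Neighbourhoods

/-! ## Transport in a locally constant cocycle -/

section Transport

open unitInterval Topology

variable {X ι Γ : Type*} [TopologicalSpace X] [Group Γ]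

/-- The bundle with discrete fibres `Γ` in which the functions `G i` describe flat sections. -/
noncomputable def flatBundle [TopologicalSpace Γ] [DiscreteTopology Γ] {U : ι → Set X}
    (hU : ∀ i, IsOpen (U i)) (hcover : ∀ x, ∃ i, x ∈ U i) (G : ι → X → Γ)
    (hG : ∀ i j x, x ∈ U i → x ∈ U j →
      ∀ᶠ y in 𝓝 x, (G j y)⁻¹ * G i y = (G j x)⁻¹ * G i x) :
    FiberBundleCore ι X Γ where
  baseSet := U
  isOpen_baseSet := hU
  indexAt x := (hcover x).choose
  mem_baseSet_at x := (hcover x).choose_spec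
  coordChange i j x v := (G j x)⁻¹ * G i x * v
  coordChange_self i x _ v := by simp
  continuousOn_coordChange i j := by
    rintro ⟨x, v⟩ ⟨⟨hi, hj⟩, -⟩
    refine ContinuousAt.continuousWithinAt ?_
    have h1 : ∀ᶠ q : X × Γ in 𝓝 (x, v), (G j q.1)⁻¹ * G i q.1 = (G j x)⁻¹ * G i x :=
      (continuous_fst.tendsto (x, v)).eventually (hG i j x hi hj)
    have h2 : ∀ᶠ q : X × Γ in 𝓝 (x, v), q.2 = v :=
      (continuous_snd.tendsto (x, v)).eventually
        (show ∀ᶠ g in 𝓝 v, g = v by rw [nhds_discrete]; exact Filter.eventually_pure.2 rfl)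
    refine ContinuousAt.congr (f := fun _ => (G j x)⁻¹ * G i x * v) continuousAt_const ?_
    filter_upwards [h1, h2] with q hq1 hq2
    rw [hq1, hq2]
  coordChange_comp i j k x _ v := by simp [mul_assoc]

/-- The total space of the flat bundle is a covering of X, and T is its monodromy read in suitable
coordinates. -/
theorem exists_transport {U : ι → Set X} (hU : ∀ i, IsOpen (U i)) (hcover : ∀ x, ∃ i, x ∈ U i)
    (G : ι → X → Γ)
    (hG : ∀ i j x, x ∈ U i → x ∈ U j →
      ∀ᶠ y in 𝓝 x, (G j y)⁻¹ * G i y = (G j x)⁻¹ * G i x) :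
    ∃ T : ∀ x y : X, Path.Homotopic.Quotient x y → Γ,
      (∀ (x y z : X) (γ : Path.Homotopic.Quotient x y) (δ : Path.Homotopic.Quotient y z),
        T x z (γ.trans δ) = T y z δ * T x y γ) ∧
      ∀ (i : ι) (x y : X) (p : Path x y), (∀ t, p t ∈ U i) →
        T x y (.mk p) = G i y * (G i x)⁻¹ := by
  let _ : TopologicalSpace Γ := ⊥
  have _ : DiscreteTopology Γ := ⟨rfl⟩
  let Z := flatBundle hU hcover G hG
  have hcov : IsCoveringMap Z.proj := FiberBundle.isCoveringMap (F := Γ) (E := Z.Fiber)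
  -- In any chart i with x in `U i` this point has coordinate (G i x)⁻¹ g; keeping the coordinate
  -- constant along a path gives the stated transport.
  let pt : ∀ (x : X) (g : Γ), Z.proj ⁻¹' {x} := fun x g =>
    ⟨⟨x, ((G (Z.indexAt x) x)⁻¹ * g : Γ)⟩, rfl⟩
  have pt_inj : ∀ x g g', pt x g = pt x g' → g = g' := by
    intro x g g' h
    have h1 : (⟨x, ((G (Z.indexAt x) x)⁻¹ * g : Γ)⟩ : Z.TotalSpace) =
        ⟨x, ((G (Z.indexAt x) x)⁻¹ * g' : Γ)⟩ := congrArg Subtype.val h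
    exact mul_left_cancel (Bundle.TotalSpace.mk_inj.1 h1)
  have hc1 : ∀ a b g : Γ, a⁻¹ * b * (b⁻¹ * g) = a⁻¹ * g := fun a b g => by group
  have hc2 : ∀ a b c g : Γ, a⁻¹ * b * (c⁻¹ * g) = a⁻¹ * (b * c⁻¹ * g) := fun a b c g => by group
  have small : ∀ (i : ι) (x y : X) (p : Path x y), (∀ t, p t ∈ U i) → ∀ g,
      hcov.monodromy (.mk p) (pt x g) = pt y (G i y * (G i x)⁻¹ * g) := by
    intro i x y p hp g
    let e := Z.localTriv i
    have hcont : Continuous fun t : I => e.toOpenPartialHomeomorph.symm (p t, (G i x)⁻¹ * g) :=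
      e.toOpenPartialHomeomorph.continuousOn_symm.comp_continuous
        (p.continuous.prodMk continuous_const) fun t => ⟨hp t, trivial⟩
    let q : Path (pt x g).1 (pt y (G i y * (G i x)⁻¹ * g)).1 :=
      { toFun := fun t => e.toOpenPartialHomeomorph.symm (p t, (G i x)⁻¹ * g)
        continuous_toFun := hcont
        source' := by
          change (⟨p 0, ((G (Z.indexAt (p 0)) (p 0))⁻¹ * G i (p 0) * ((G i x)⁻¹ * g) : Γ)⟩ :
            Z.TotalSpace) = ⟨x, ((G (Z.indexAt x) x)⁻¹ * g : Γ)⟩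
          rw [p.source]
          congr 1
          exact hc1 _ _ _
        target' := by
          change (⟨p 1, ((G (Z.indexAt (p 1)) (p 1))⁻¹ * G i (p 1) * ((G i x)⁻¹ * g) : Γ)⟩ :
            Z.TotalSpace) = ⟨y, ((G (Z.indexAt y) y)⁻¹ * (G i y * (G i x)⁻¹ * g) : Γ)⟩
          rw [p.target]
          congr 1
          exact hc2 _ _ _ _ }
    exact hcov.monodromy_eq_of_map_eq (.mk q) rfl
  -- The coordinate changes are left multiplications, so monodromy commutes with right translation
  -- of g and is left multiplication by one element t.
  have key : ∀ (x y : X) (γ : Path.Homotopic.Quotient x y),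
      ∃ t : Γ, ∀ g, hcov.monodromy γ (pt x g) = pt y (t * g) := by
    intro x y γ
    induction γ using Path.Homotopic.Quotient.induction_of_cover hU hcover with
    | small i x y p hp => exact ⟨_, small i x y p hp⟩
    | trans x y z γ δ h1 h2 =>
      obtain ⟨t, ht⟩ := h1
      obtain ⟨t', ht'⟩ := h2
      refine ⟨t' * t, fun g => ?_⟩
      rw [hcov.monodromy_trans_apply, ht, ht', mul_assoc]
  choose T hT using key
  have hu : ∀ x y γ t, hcov.monodromy γ (pt x 1) = pt y (t * 1) → T x y γ = t := by
    intro x y γ t h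
    rw [hT] at h
    exact mul_right_cancel (pt_inj _ _ _ h)
  refine ⟨T, fun x y z γ δ => hu _ _ _ _ ?_, fun i x y p hp => hu _ _ _ _ (small i x y p hp 1)⟩
  rw [hcov.monodromy_trans_apply, hT, hT, mul_assoc]

end Transport

/-! ## Representations of the braid group from Artin systems -/

section BraidTransport

open unitInterval Topology

variable {N : ℕ} {Γ : Type*} [Group Γ]

theorem isOpen_image_unorderedProj {W : Set (OrdConf N (ℝ × ℝ))} (hW : IsOpen W) :
    IsOpen (unorderedProj N '' W) :=
  (isCoveringMap_orbitProj (⊤ : Subgroup (Equiv.Perm (Fin N)))).isLocalHomeomorph.isOpenMap W hW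

theorem unorderedProj_eq_iff {x y : OrdConf N (ℝ × ℝ)} :
    unorderedProj N x = unorderedProj N y ↔ ∃ h : Equiv.Perm (Fin N), h • y = x := by
  refine (orbitProj_eq_iff (⊤ : Subgroup (Equiv.Perm (Fin N)))).trans ?_
  simp

open Classical in
/-- The value at `q`, in the chart around `a`, of the section of the braids over the
permutations. -/
noncomputable def chartValue (s : ℕ → Γ) (a : OrdConf N (ℝ × ℝ))
    (q : OrbitConf (⊤ : Subgroup (Equiv.Perm (Fin N))) (ℝ × ℝ)) : Γ :=
  if h : ∃ x ∈ nearConf a, unorderedProj N x = q then permSection s (h.choose.rank * a.rank⁻¹)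
  else 1

/-- The numbering that lies in `nearConf a` is unique, so the choice in the definition is harmless.
-/
theorem chartValue_apply (s : ℕ → Γ) {a x : OrdConf N (ℝ × ℝ)} (hx : x ∈ nearConf a) :
    chartValue s a (unorderedProj N x) = permSection s (x.rank * a.rank⁻¹) := by
  have h : ∃ y ∈ nearConf a, unorderedProj N y = unorderedProj N x := ⟨x, hx, rfl⟩
  have hc : h.choose = x := by
    obtain ⟨h1, h2⟩ := h.choose_spec
    obtain ⟨g, hg⟩ := unorderedProj_eq_iff.1 h2
    rw [← hg] at h1 ⊢
    rw [eq_one_of_smul_mem_nearConf hx h1, one_smul]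
  rw [chartValue, dif_pos h, hc]

/-- A pair that changes order near x lies on a vertical line of x. Membership of x in `nearConf a`
then forces its order in a, so any two charts at x agree on the pairs that matter for
`permSection_cocycle`. -/
theorem rank_lt_of_mem_nearConf {a x y : OrdConf N (ℝ × ℝ)} (hx : x ∈ nearConf a)
    (hy : y ∈ nearConf x) {i j : Fin N} (h1 : x.rank i < x.rank j) (h2 : y.rank j < y.rank i) :
    a.rank i < a.rank j := by
  rw [OrdConf.rank_lt_iff] at *
  rw [mem_nearConf] at hx hy
  rcases h1 with h1 | ⟨h1, h1'⟩
  · exfalso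
    have := hy.1 i j h1
    rcases h2 with h2 | h2
    · exact this.not_gt h2
    · exact this.ne' h2.1
  · rcases lt_trichotomy (a.1 i).1 (a.1 j).1 with h | h | h
    · exact Or.inl h
    · rcases lt_trichotomy (a.1 i).2 (a.1 j).2 with h' | h' | h'
      · exact Or.inr ⟨h, h'⟩
      · have := a.2 (Prod.ext h h')
        subst this
        exact absurd h1' (lt_irrefl _)
      · exact absurd h1' (hx.2 j i h.symm h').not_gt
    · exact absurd h1 (hx.1 j i h).ne'

theorem exists_braid_transport {s : ℕ → Γ} (hs : IsArtinSystem s (adjIndex N)) :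
    ∃ T : ∀ x y : OrbitConf (⊤ : Subgroup (Equiv.Perm (Fin N))) (ℝ × ℝ),
        Path.Homotopic.Quotient x y → Γ,
      (∀ (x y z : OrbitConf (⊤ : Subgroup (Equiv.Perm (Fin N))) (ℝ × ℝ))
        (γ : Path.Homotopic.Quotient x y) (δ : Path.Homotopic.Quotient y z),
        T x z (γ.trans δ) = T y z δ * T x y γ) ∧
      ∀ (a x y : OrdConf N (ℝ × ℝ)) (p : Path x y), (∀ t, p t ∈ nearConf a) →
        T _ _ ((Path.Homotopic.Quotient.mk p).map (unorderedProj N)) =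
          permSection s (y.rank * a.rank⁻¹) * (permSection s (x.rank * a.rank⁻¹))⁻¹ := by
  obtain ⟨T, hT, hT'⟩ := exists_transport
    (U := fun a : OrdConf N (ℝ × ℝ) => unorderedProj N '' nearConf a)
    (fun a => isOpen_image_unorderedProj (isOpen_nearConf a))
    (fun q => by
      obtain ⟨x, rfl⟩ := Quotient.exists_rep q
      exact ⟨x, x, self_mem_nearConf x, rfl⟩)
    (chartValue s) (by
      -- The two charts may number the common point differently; renumbering b makes both
      -- neighbourhoods contain x, and the cocycle lemma compares them.
      rintro a b _ ⟨x, hx, rfl⟩ ⟨x', hx', hxx'⟩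
      obtain ⟨h, rfl⟩ := unorderedProj_eq_iff.1 hxx'
      have hxb : x ∈ nearConf (h⁻¹ • b) := by
        simpa using smul_mem_nearConf_smul h⁻¹ hx'
      have hb : ∀ y, y ∈ nearConf (h⁻¹ • b) → chartValue s b (unorderedProj N y) =
          permSection s (y.rank * (h⁻¹ • b).rank⁻¹) := by
        intro y hy
        have hy' : h • y ∈ nearConf b := by simpa using smul_mem_nearConf_smul h hy
        rw [← unorderedProj_smul h, chartValue_apply s hy', OrdConf.rank_smul, OrdConf.rank_smul]
        simp [mul_assoc]
      have hW : IsOpen (nearConf x ∩ nearConf a ∩ nearConf (h⁻¹ • b)) :=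
        ((isOpen_nearConf x).inter (isOpen_nearConf a)).inter (isOpen_nearConf _)
      filter_upwards [(isOpen_image_unorderedProj hW).mem_nhds
        ⟨x, ⟨⟨self_mem_nearConf x, hx⟩, hxb⟩, rfl⟩]
      rintro _ ⟨y, ⟨⟨hyx, hya⟩, hyb⟩, rfl⟩
      rw [hb y hyb, hb x hxb, chartValue_apply s hya, chartValue_apply s hx]
      have := permSection_cocycle hs x.rank y.rank a.rank (h⁻¹ • b).rank fun i j h1 h2 =>
        iff_of_true (rank_lt_of_mem_nearConf hx hyx h1 h2) (rank_lt_of_mem_nearConf hxb hyx h1 h2)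
      rw [mul_inv_eq_iff_eq_mul] at this
      rw [this]
      group)
  refine ⟨T, hT, fun a x y p hp => ?_⟩
  have hx : x ∈ nearConf a := by simpa using hp 0
  have hy : y ∈ nearConf a := by simpa using hp 1
  rw [← chartValue_apply s hx, ← chartValue_apply s hy, ← Path.Homotopic.Quotient.mk_map]
  exact hT' a _ _ _ fun t => ⟨p t, hp t, rfl⟩

/-- In the middle the two moving points are on a vertical line, with k + 1 above k, and the sine
keeps it above at all interior times. So one chart covers the crossing. -/
theorem halfTwistConf_mem_nearConf {k : ℕ} {t : ℝ} (h0 : 0 < t) (h1 : t < 1) :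
    halfTwistConf N k t ∈ nearConf (midTwist N k) := by
  have hpair : ∀ i j : Fin N, (i : ℕ) + 1 = k ∧ (j : ℕ) + 1 = k + 1 →
      ∀ t, ((halfTwistConf N k t).1 j).1 - ((halfTwistConf N k t).1 i).1 = Real.cos (Real.pi * t) ∧
        ((halfTwistConf N k t).1 j).2 - ((halfTwistConf N k t).1 i).2 = Real.sin (Real.pi * t) := by
    intro i j h t
    have := halfTwistPoint_sub k t
    rw [halfTwistConf_apply, halfTwistConf_apply, h.1, h.2]
    exact ⟨congrArg Prod.fst this, congrArg Prod.snd this⟩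
  have hcos : Real.cos (Real.pi * (1 / 2)) = 0 := by
    rw [show Real.pi * (1 / 2) = Real.pi / 2 by ring, Real.cos_pi_div_two]
  have hsin : Real.sin (Real.pi * (1 / 2)) = 1 := by
    rw [show Real.pi * (1 / 2) = Real.pi / 2 by ring, Real.sin_pi_div_two]
  have hpi := Real.pi_pos
  have hlt : ∀ i j : Fin N, i < j → ¬ ((i : ℕ) + 1 = k ∧ (j : ℕ) + 1 = k + 1) →
      ∀ t, ((halfTwistConf N k t).1 i).1 < ((halfTwistConf N k t).1 j).1 := fun i j hij h t =>
    halfTwistPoint_fst_lt (by have := Fin.lt_def.1 hij; omega) h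
  refine mem_nearConf.2 ⟨fun i j h => ?_, fun i j h h' => ?_⟩
  · rcases lt_trichotomy i j with hij | rfl | hij
    · refine hlt i j hij (fun hp => ?_) t
      have := (hpair i j hp (1 / 2)).1
      rw [hcos] at this
      exact absurd h (by rw [midTwist]; linarith)
    · exact absurd h (lt_irrefl _)
    · by_cases hp : (j : ℕ) + 1 = k ∧ (i : ℕ) + 1 = k + 1
      · have := (hpair j i hp (1 / 2)).1
        rw [hcos] at this
        exact absurd h (by rw [midTwist]; linarith)
      · exact absurd h (hlt j i hij hp (1 / 2)).not_gt
  · rcases lt_trichotomy i j with hij | rfl | hij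
    · by_cases hp : (i : ℕ) + 1 = k ∧ (j : ℕ) + 1 = k + 1
      · have := (hpair i j hp t).2
        have hpos := Real.sin_pos_of_pos_of_lt_pi (x := Real.pi * t) (by positivity) (by nlinarith)
        linarith
      · exact absurd h (hlt i j hij hp (1 / 2)).ne
    · exact absurd h' (lt_irrefl _)
    · by_cases hp : (j : ℕ) + 1 = k ∧ (i : ℕ) + 1 = k + 1
      · have := (hpair j i hp (1 / 2)).2
        rw [hsin] at this
        exact absurd h' (by rw [midTwist]; linarith)
      · exact absurd h (hlt j i hij hp (1 / 2)).ne'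

theorem halfTwistConf_mem_lexChamber_adj {k : ℕ} (hk : 1 ≤ k ∧ k < N) {t : ℝ} (h0 : 1 / 2 < t)
    (h1 : t ≤ 1) : halfTwistConf N k t ∈ lexChamber (adj N k) := by
  rw [mem_lexChamber, OrdConf.rank_eq_iff]
  intro i j hij
  rw [Fin.lt_def, adj_val hk, adj_val hk] at hij
  left
  by_cases h : (j : ℕ) + 1 = k ∧ (i : ℕ) + 1 = k + 1
  · have e := congrArg Prod.fst (halfTwistPoint_sub k t)
    rw [halfTwistConf_apply, halfTwistConf_apply, h.1, h.2]
    have hpi := Real.pi_pos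
    have hcos := Real.cos_neg_of_pi_div_two_lt_of_lt (x := Real.pi * t) (by nlinarith)
      (by nlinarith)
    simp only [Prod.fst_sub] at e
    linarith
  · exact halfTwistPoint_fst_lt (by split_ifs at hij <;> omega) (by split_ifs at hij <;> omega)

/-- The homomorphism is transport along loops. The second clause evaluates it on lifted paths
whenever transport is the coboundary of a function g on ordered configurations; it serves to compute
permutations. -/
theorem exists_braidRep {s : ℕ → Γ} (hs : IsArtinSystem s (adjIndex N)) :
    ∃ f : BraidGroup N →* Γ, (∀ k ∈ adjIndex N, f (artinSigma N k) = s k) ∧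
      ∀ g : OrdConf N (ℝ × ℝ) → Γ,
        (∀ a x y, x ∈ nearConf a → y ∈ nearConf a →
          permSection s (y.rank * a.rank⁻¹) * (permSection s (x.rank * a.rank⁻¹))⁻¹ =
            g y * (g x)⁻¹) →
        ∀ (h h' : Equiv.Perm (Fin N))
          (γ : Path.Homotopic.Quotient (h • baseConf N) (h' • baseConf N)),
          f (FundamentalGroup.fromPath ((γ.map (unorderedProj N)).cast
            (unorderedProj_smul h _).symm (unorderedProj_smul h' _).symm)) =
            g (h' • baseConf N) * (g (h • baseConf N))⁻¹ := by
  obtain ⟨T, hT, hT'⟩ := exists_braid_transport hs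
  let q₀ : OrbitConf (⊤ : Subgroup (Equiv.Perm (Fin N))) (ℝ × ℝ) := OrbitConf.mk ⊤ (baseConf N)
  let f : BraidGroup N →* Γ :=
    MonoidHom.mk' (fun b => T q₀ q₀ b.toPath) fun b c => hT q₀ q₀ q₀ c.toPath b.toPath
  have hcast : ∀ (x y : OrbitConf (⊤ : Subgroup (Equiv.Perm (Fin N))) (ℝ × ℝ)) (hx : q₀ = x)
      (hy : q₀ = y) (γ : Path.Homotopic.Quotient x y),
      f (FundamentalGroup.fromPath (γ.cast hx hy)) = T x y γ := by
    rintro _ _ rfl rfl γ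
    rw [Path.Homotopic.Quotient.cast_rfl_rfl]
    rfl
  refine ⟨f, fun k hk => ?_, fun g hg h h' γ => ?_⟩
  · have hk : 1 ≤ k ∧ k < N := hk
    -- A path in one chamber may cross several charts, but within each the transport depends only on
    -- the rank, which is constant.
    have hchamber : ∀ (w : Equiv.Perm (Fin N)) (x y : OrdConf N (ℝ × ℝ)) (p : Path x y),
        (∀ t, p t ∈ lexChamber w) →
        T _ _ ((Path.Homotopic.Quotient.mk p).map (unorderedProj N)) = 1 := by
      intro w x y p hp
      let v : C(lexChamber w, OrdConf N (ℝ × ℝ)) := ⟨Subtype.val, continuous_subtype_val⟩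
      have hP : ∀ (x y : lexChamber w) (γ : Path.Homotopic.Quotient x y),
          T _ _ ((γ.map v).map (unorderedProj N)) = 1 := by
        intro x y γ
        induction γ using Path.Homotopic.Quotient.induction_of_cover
          (U := fun a : OrdConf N (ℝ × ℝ) => v ⁻¹' nearConf a)
          (fun a => (isOpen_nearConf a).preimage v.continuous)
          (fun x => ⟨x, self_mem_nearConf _⟩) with
        | small a x y p hp =>
          rw [← Path.Homotopic.Quotient.mk_map, hT' a _ _ _ hp, mul_inv_eq_one]
          rw [show (v y).rank = w from mem_lexChamber.1 y.2,
            show (v x).rank = w from mem_lexChamber.1 x.2]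
        | trans x y z γ δ h1 h2 =>
          rw [Path.Homotopic.Quotient.map_trans, Path.Homotopic.Quotient.map_trans, hT, h1, h2,
            mul_one]
      let p' : Path (⟨x, by simpa using hp 0⟩ : lexChamber w) ⟨y, by simpa using hp 1⟩ :=
        { toFun := fun t => ⟨p t, hp t⟩
          continuous_toFun := p.continuous.subtype_mk _
          source' := Subtype.ext p.source
          target' := Subtype.ext p.target }
      exact hP _ _ (.mk p')
    have hsub : ∀ {x y : OrdConf N (ℝ × ℝ)} (p : Path x y) (a b c : I),
        T _ _ ((Path.Homotopic.Quotient.mk (p.subpath b c)).map (unorderedProj N)) *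
          T _ _ ((Path.Homotopic.Quotient.mk (p.subpath a b)).map (unorderedProj N)) =
        T _ _ ((Path.Homotopic.Quotient.mk (p.subpath a c)).map (unorderedProj N)) := by
      intro x y p a b c
      rw [← hT, ← Path.Homotopic.Quotient.map_trans, ← Path.Homotopic.Quotient.mk_trans,
        Path.Homotopic.Quotient.eq.2 ⟨Path.Homotopy.subpathTransSubpath p a b c⟩]
    have hpath : ∀ {x y : OrdConf N (ℝ × ℝ)} (p : Path x y),
        T _ _ ((Path.Homotopic.Quotient.mk (p.subpath 0 1)).map (unorderedProj N)) =
          T _ _ ((Path.Homotopic.Quotient.mk p).map (unorderedProj N)) := by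
      intro x y p
      rw [Path.subpath_zero_one]
      have : ∀ (x' y' : OrdConf N (ℝ × ℝ)) (hx : x' = x) (hy : y' = y),
          T _ _ ((Path.Homotopic.Quotient.mk (p.cast hx hy)).map (unorderedProj N)) =
          T _ _ ((Path.Homotopic.Quotient.mk p).map (unorderedProj N)) := by
        rintro _ _ rfl rfl
        rfl
      exact this _ _ _ _
    rw [artinSigma_eq_tracedBraid hk, tracedBraid_smul_baseConf]
    refine (hcast _ _ _ _ _).trans ?_
    rw [← hpath]
    -- Cut the half twist in three: up to 1/2 the rank is 1, from 3/4 on it is `adj N k`, and the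
    -- middle piece lies in `nearConf (midTwist N k)`, which need not contain the ends of the
    -- motion. Any time strictly between 1/2 and 1 could replace 3/4.
    let a : I := ⟨1 / 2, by norm_num, by norm_num⟩
    let b : I := ⟨3 / 4, by norm_num, by norm_num⟩
    have hab : a ≤ b := show (1 / 2 : ℝ) ≤ 3 / 4 by norm_num
    rw [← hsub _ 0 b 1, ← hsub _ 0 a b, hchamber (adj N k) _ _ ((halfTwistPath hk).subpath b 1),
      hchamber 1 _ _ ((halfTwistPath hk).subpath 0 a),
      hT' (midTwist N k) _ _ ((halfTwistPath hk).subpath a b), mul_one, one_mul]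
    · have e1 : (halfTwistPath hk b).rank = adj N k :=
        mem_lexChamber.1 (halfTwistConf_mem_lexChamber_adj hk (show (1 / 2 : ℝ) < 3 / 4 by norm_num)
          (show (3 / 4 : ℝ) ≤ 1 by norm_num))
      have e2 : (halfTwistPath hk a).rank = 1 := rank_midTwist k
      rw [e1, e2, rank_midTwist, inv_one, mul_one, mul_one, permSection_one, inv_one, mul_one]
      have := permSection_adj_mul hs 1 k (i := ⟨k - 1, by omega⟩) (j := ⟨k, hk.2⟩)
        (Fin.lt_def.2 (show k - 1 < k by omega)) (show k - 1 + 1 = k by omega) rfl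
      rwa [mul_one, permSection_one, mul_one] at this
    · intro t
      obtain ⟨r, hr0, hr1, hr⟩ := Path.exists_subpath_apply (halfTwistPath hk) hab t
      rw [hr]
      exact halfTwistConf_mem_nearConf (lt_of_lt_of_le (by norm_num) (show (1 / 2 : ℝ) ≤ r from hr0))
        (lt_of_le_of_lt (show (r : ℝ) ≤ 3 / 4 from hr1) (by norm_num))
    · intro t
      obtain ⟨r, hr0, hr1, hr⟩ := Path.exists_subpath_apply (halfTwistPath hk)
        (show (0 : I) ≤ a from a.2.1) t
      rw [hr]
      exact halfTwistConf_mem_lexChamber r.2.1 hr1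
    · intro t
      obtain ⟨r, hr0, hr1, hr⟩ := Path.exists_subpath_apply (halfTwistPath hk)
        (show b ≤ (1 : I) from b.2.2) t
      rw [hr]
      exact halfTwistConf_mem_lexChamber_adj hk
        (lt_of_lt_of_le (by norm_num) (show (3 / 4 : ℝ) ≤ r from hr0)) r.2.2
  · refine (hcast _ _ _ _ _).trans ?_
    have hP : ∀ (x y : OrdConf N (ℝ × ℝ)) (γ : Path.Homotopic.Quotient x y),
        T _ _ (γ.map (unorderedProj N)) = g y * (g x)⁻¹ := by
      intro x y γ
      induction γ using Path.Homotopic.Quotient.induction_of_cover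
        (U := fun a : OrdConf N (ℝ × ℝ) => nearConf a) isOpen_nearConf
        (fun x => ⟨x, self_mem_nearConf x⟩) with
      | small a x y p hp =>
        rw [hT' a _ _ _ hp]
        exact hg a x y (by simpa using hp 0) (by simpa using hp 1)
      | trans x y z γ δ h1 h2 =>
        rw [Path.Homotopic.Quotient.map_trans, hT, h1, h2]
        group
    exact hP _ _ γ

/-- The permutation of a braid. -/
theorem exists_braidPerm (N : ℕ) :
    ∃ f : BraidGroup N →* Equiv.Perm (Fin N), (∀ k ∈ adjIndex N, f (artinSigma N k) = adj N k) ∧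
      ∀ (h : Equiv.Perm (Fin N))
        (γ : Path.Homotopic.Quotient ((1 : Equiv.Perm (Fin N)) • baseConf N) (h • baseConf N)),
        f (FundamentalGroup.fromPath ((γ.map (unorderedProj N)).cast
          (unorderedProj_smul 1 _).symm (unorderedProj_smul h _).symm)) = h⁻¹ := by
  obtain ⟨f, hf, hf'⟩ := exists_braidRep (isArtinSystem_adj N)
  refine ⟨f, hf, fun h γ => ?_⟩
  have hid : ∀ w : Equiv.Perm (Fin N), permSection (adj N) w = w := fun w =>
    map_permSection (s := adj N) (K := adjIndex N) (H := ⊤) (MonoidHom.id _)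
      (fun _ _ => rfl) (fun w _ k h => h.mem) (fun _ _ => Subgroup.mem_top _) w
      (Subgroup.mem_top w)
  -- For the adjacent transpositions the section is the identity, so transport is the coboundary of
  -- the rank.
  rw [hf' OrdConf.rank (fun a x y _ _ => by rw [hid, hid]; group)]
  rw [OrdConf.rank_smul, OrdConf.rank_smul, rank_baseConf]
  simp

end BraidTransport

/-! ## Mixed braids among the braids -/

section MixedBraids

variable {m n : ℕ}

theorem toBraid_fromPath {h h' : Equiv.Perm (Fin (m + n))} (hh : h ∈ youngSubgroup m n)
    (hh' : h' ∈ youngSubgroup m n)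
    (γ : Path.Homotopic.Quotient (h • baseConf (m + n)) (h' • baseConf (m + n))) :
    MixedBraidGroup.toBraid m n (FundamentalGroup.fromPath
      ((γ.map (orbitProj (youngSubgroup m n))).cast
        (orbitProj_smul _ hh _).symm (orbitProj_smul _ hh' _).symm)) =
      FundamentalGroup.fromPath ((γ.map (unorderedProj (m + n))).cast
        (unorderedProj_smul h _).symm (unorderedProj_smul h' _).symm) := by
  induction γ using Path.Homotopic.Quotient.ind with | _ p
  rfl

theorem toBraid_mixedSigma (k : ℕ) (hk : 1 ≤ k ∧ k < m + n) (hm : k ≠ m) :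
    MixedBraidGroup.toBraid m n (mixedSigma m n k hk hm) = artinSigma (m + n) k := by
  rw [artinSigma, dif_pos hk]
  rfl

/-- Lift a mixed braid to ordered configurations. If its image is trivial, so is its permutation;
the lift is then a loop with nullhomotopic projection, and coverings are injective on homotopy
classes of paths. -/
theorem toBraid_injective (m n : ℕ) : Function.Injective (MixedBraidGroup.toBraid m n) := by
  rw [injective_iff_map_eq_one]
  intro b hb
  obtain ⟨f, -, hf⟩ := exists_braidPerm (m + n)
  obtain ⟨h, hh, γ, rfl⟩ := PlaneBraidGroup.exists_lift b
  replace hb := (toBraid_fromPath (one_mem _) hh γ).symm.trans hb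
  obtain rfl : h = 1 := inv_eq_one.1 ((hf h γ).symm.trans ((congrArg f hb).trans (map_one f)))
  have hγ : γ = Path.Homotopic.Quotient.refl _ := by
    refine (isCoveringMap_orbitProj (⊤ : Subgroup
      (Equiv.Perm (Fin (m + n))))).injective_path_homotopic_map _ _ ?_
    have hrefl : ∀ {X : Type} [TopologicalSpace X] {a x : X} (δ : Path.Homotopic.Quotient x x)
        (hx hy : a = x), δ.cast hx hy = Path.Homotopic.Quotient.refl a →
          δ = Path.Homotopic.Quotient.refl x := by
      rintro X _ a _ δ rfl _ h
      rwa [Path.Homotopic.Quotient.cast_rfl_rfl] at h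
    exact hrefl _ _ _ hb
  rw [hγ]
  rfl

/-- The lift of a braid ends at h • `baseConf`, and it projects to a loop of mixed configurations
when h is in the Young subgroup; the permutation of the braid is h⁻¹. -/
theorem range_toBraid {f : BraidGroup (m + n) →* Equiv.Perm (Fin (m + n))}
    (hf : ∀ (h : Equiv.Perm (Fin (m + n)))
        (γ : Path.Homotopic.Quotient ((1 : Equiv.Perm (Fin (m + n))) • baseConf (m + n))
          (h • baseConf (m + n))),
        f (FundamentalGroup.fromPath ((γ.map (unorderedProj (m + n))).cast
          (unorderedProj_smul 1 _).symm (unorderedProj_smul h _).symm)) = h⁻¹) :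
    (MixedBraidGroup.toBraid m n).range = (youngSubgroup m n).comap f := by
  ext b
  constructor
  · rintro ⟨b, rfl⟩
    obtain ⟨h, hh, γ, rfl⟩ := PlaneBraidGroup.exists_lift b
    have h1 := (congrArg f (toBraid_fromPath (one_mem _) hh γ)).trans (hf h γ)
    exact (congrArg (· ∈ youngSubgroup m n) h1).mpr (inv_mem hh)
  · intro hb
    obtain ⟨h, hh, γ, e⟩ := PlaneBraidGroup.exists_lift b
    have h1 : f b = h⁻¹ := (congrArg f e).trans (hf h γ)
    have hh : h ∈ youngSubgroup m n := by
      rw [Subgroup.mem_comap, h1] at hb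
      simpa using inv_mem hb
    exact ⟨_, (toBraid_fromPath (one_mem _) hh γ).trans e.symm⟩

end MixedBraids

open MixedPresentation in
theorem proposition5 (n : ℕ) (hn : 2 ≤ n) :
    ∃ φ : PresentedGroup (mixedRels n) ≃* MixedBraidGroup n n,
      (∀ (k : ℕ) (hk : 1 ≤ k ∧ k < 2 * n) (hkn : k ≠ n),
        φ (PresentedGroup.of (MixedGen.sigma k hk hkn)) =
          mixedSigma n n k (by omega) hkn) ∧
      (∀ (i j : ℕ) (h : 1 ≤ i ∧ i < j ∧ j ≤ 2 * n),
        MixedBraidGroup.toBraid n n (φ (PresentedGroup.of (MixedGen.pure i j h))) =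
          pureA (n + n) i j) := by
  have hs := isArtinSystem_artinSigma (n + n)
  obtain ⟨f, hf, hf'⟩ := exists_braidPerm (n + n)
  obtain ⟨ρ, hρ, -⟩ := exists_braidRep
    (ArcAction.isArtinSystem_arcTwist.mono (Set.subset_univ (adjIndex (n + n))))
  have hinj := toArtin_injective hs f hf ρ hρ
  have hι := toBraid_injective n n
  have hrange := range_toBraid hf'
  have hsig : ∀ (k : ℕ) (hk : 1 ≤ k ∧ k < 2 * n) (hkn : k ≠ n),
      toArtin hs (PresentedGroup.of (MixedGen.sigma k hk hkn)) = artinSigma (n + n) k :=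
    fun k hk hkn => PresentedGroup.toGroup.of _
  have hpure : ∀ (i j : ℕ) (h : 1 ≤ i ∧ i < j ∧ j ≤ 2 * n),
      toArtin hs (PresentedGroup.of (MixedGen.pure i j h)) = pureA (n + n) i j :=
    fun i j h => PresentedGroup.toGroup.of _
  have heq : (toArtin (n := n) hs).range = (MixedBraidGroup.toBraid n n).range := by
    apply le_antisymm
    · rw [MonoidHom.range_eq_map, ← PresentedGroup.closure_range_of, MonoidHom.map_closure,
        Subgroup.closure_le]
      rintro _ ⟨_, ⟨g, rfl⟩, rfl⟩
      cases g with
      | sigma k hk hkn =>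
        rw [hsig, ← toBraid_mixedSigma k (by omega) hkn]
        exact ⟨_, rfl⟩
      | pure i j h =>
        rw [hpure, hrange]
        change f (bandA (artinSigma (n + n)) i j) ∈ youngSubgroup n n
        rw [perm_bandA f hf (by omega)]
        exact one_mem _
    · rw [hrange]
      intro b hb
      exact mem_range_toArtin hs f hf (closure_artinSigma (n + n)) hb
  -- Both injections have the same image in B_{2n}; φ passes through it.
  let φ : PresentedGroup (mixedRels n) ≃* MixedBraidGroup n n :=
    ((MonoidHom.ofInjective hinj).trans (MulEquiv.subgroupCongr heq)).trans
      (MonoidHom.ofInjective hι).symm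
  have hφ : ∀ g, MixedBraidGroup.toBraid n n (φ g) = toArtin hs g := by
    intro g
    have h1 : MonoidHom.ofInjective hι (φ g) =
        MulEquiv.subgroupCongr heq (MonoidHom.ofInjective hinj g) :=
      (MonoidHom.ofInjective hι).apply_symm_apply _
    exact congrArg Subtype.val h1
  refine ⟨φ, fun k hk hkn => hι ?_, fun i j h => ?_⟩
  · rw [hφ, hsig, toBraid_mixedSigma]
  · rw [hφ, hpure]
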